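/- **Definitions.** Maps are connected graphs cellularly embedded in a closed oriented surface of arbitrary (unfixed) genus, up to homeomorphism; a map is rooted if a half-edge is marked, and Eulerian if all its vertices have even degree. A *rooted plane tree* is a plane tree with a marked leaf (the root leaf); its non-leaf vertices are called nodes. An *Eulerian tree* is a rooted plane tree whose leaves are either opening or closing, with as many of the one as of the other, whose root leaf is opening, and in which every node has even degree $2k$ ($k\ge 1$) and exactly $k-1$ adjacent opening leaves (not counting the root leaf). In a clockwise walk around the tree starting at (and including) the root leaf, the *height* of a closing leaf is the number of opening leaves minus the number of closing leaves met before it. The tree is *balanced* if all these heights are positive. An *enriched* Eulerian tree is a balanced one in which each closing leaf $c$ of height $h$ carries a matching-index $\iota(c)\in\{0,\dots,h-1\}$. The *closure* of an enriched Eulerian tree with at least one node is the rooted map obtained as follows: treat the closing leaves in the order of the clockwise walk; when $c$ is met and $o_1,\dots,o_h$ are the opening leaves already met and not yet matched, in order of appearance, match $c$ with $o_{h-\iota(c)}$; then merge each matched pair of leaves into an edge. The root is the half-edge that led to the root leaf. The *leaf-extension* of a closing leaf of matching-index $\iota$ replaces it by a branch of length $\iota+1$ ending with a closing leaf, each of the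 $\iota$ inner vertices of the branch (the *crossing-vertices*) carrying a closing leaf on the left and an opening leaf on the right (the branch being seen as extended upward). For an enriched Eulerian tree $T$, let $T'$ be the tree obtained by extending all its closing leaves, with all matching-indices equal to $0$. For a commutative ring (or semiring) $R$, $q\in R$ and weights $g_1,g_2,\ldots\in R$ (for instance indeterminates), let $[i]_q=1+q+\cdots+q^{i-1}$ and let $r_i(t,q)\in R[[t]]$, $i\ge1$, be the series specified by $$r_i(t,q)=[i]_q+\sum_{k\ge1}t^kg_k\sum_{\wp\in\mathcal P_k^{(i)}}\ \prod_{\text{descending steps } h\to h-1 \text{ of } \wp} r_h(t,q),\qquad i\ge1,$$ where $\mathcal P^{(i)}_k$ is the set of nonnegative paths with $2k-1$ steps $\pm1$ from height $i$ to height $i-1$. **Statement.** 1. The closure is a bijection from enriched Eulerian trees with at least one node to rooted Eulerian maps with at least one edge. 2. For every enriched Eulerian tree $T$, the tree $T'$ is a balanced Eulerian tree. Let $M$ be a rooted Eulerian map with at least one edge and $T$ the enriched Eulerian tree with closure $M$. The closure $M'$ of $T'$, called the *canonical planar representation* of $M$ (it is determined by $M$ up to isomorphism), is a planar rooted Eulerian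 map whose crossing-vertices have degree $4$, and $M$ is recovered from $M'$ by seeing every crossing-vertex as a place where two edges cross: the vertices of $M$ are the other vertices of $M'$, the edges of $M$ are obtained by going straight through the crossing-vertices, and every passage through a crossing-vertex belongs to an edge of $M$. 3. Let $\mathrm{cr}(M)$ be the number of crossing-vertices of $M'$. Then $\mathrm{cr}(M)=0$ if and only if $M$ is planar. 4. The recursion has exactly one solution $(r_i(t,q))_{i\ge1}$, and $$r_1(t,q)=1+\sum_{E\ge1}t^E\sum_{M}q^{\mathrm{cr}(M)}\prod_{v}g_{\deg(v)/2},$$ where $M$ runs over the rooted Eulerian maps with $E$ edges, up to isomorphism, and $v$ over the vertices of $M$. In particular $r_1(t,0)$ is the counting series of planar rooted Eulerian maps, and $r_1(t,1)$ that of rooted Eulerian maps of unfixed genus, with weight $t$ per edge and $g_k$ per vertex of degree $2k$ (and a conventional first term $1$). -/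

import Mathlib

/-! ### Rooted maps of arbitrary genus, as rotation systems on half-edges -/

/-- A rooted connected map on an orientable closed surface, with set of half-edges `D`
(hence with at least one edge): `σ` sends a half-edge to the next one in clockwise order around the
incident vertex, `α` sends a half-edge to the opposite half-edge of the same edge, and `root` is
the root half-edge (the half-edge that follows the root corner in clockwise order). -/
structure RootedMap (D : Type) where
  σ : Equiv.Perm D
  α : Equiv.Perm D
  root : D
  α_invol : ∀ d, α (α d) = d
  α_ne : ∀ d, α d ≠ d
  connected : ∀ d d', ∃ x ∈ Subgroup.closure ({σ, α} : Set (Equiv.Perm D)), x d = d'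

namespace RootedMap

variable {D D' : Type}

/-- Vertices: the orbits of `σ`. -/
def Vertex (M : RootedMap D) : Type := Quotient (Equiv.Perm.SameCycle.setoid M.σ)

/-- Faces: the orbits of `σ ∘ α`. -/
def Face (M : RootedMap D) : Type := Quotient (Equiv.Perm.SameCycle.setoid (M.σ * M.α))

/-- The vertex incident to a half-edge. -/
def vertexOf (M : RootedMap D) (d : D) : M.Vertex := Quotient.mk _ d

/-- The degree of a vertex: its number of incident half-edges. -/
noncomputable def deg (M : RootedMap D) (v : M.Vertex) : ℕ := Nat.card {d : D // M.vertexOf d = v}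

/-- A map is Eulerian if all its vertices have even degree. -/
def IsEulerian (M : RootedMap D) : Prop := ∀ v : M.Vertex, Even (M.deg v)

/-- Genus zero, through Euler's relation `V - E + F = 2`; here `E` is half of the number of
half-edges. -/
def IsPlanar (M : RootedMap D) : Prop :=
  2 * (Nat.card M.Vertex + Nat.card M.Face) = Nat.card D + 4

/-- The weight of an Eulerian map: a factor `g k` for each vertex of degree `2 * k`. -/
noncomputable def vertexWeight {R : Type*} [CommSemiring R] (g : ℕ → R) (M : RootedMap D) : R :=
  ∏ᶠ v : M.Vertex, g (M.deg v / 2)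

/-- The bijection `e` between half-edges is an isomorphism of rooted maps. -/
structure IsIso (M : RootedMap D) (N : RootedMap D') (e : D ≃ D') : Prop where
  map_σ : ∀ d, e (M.σ d) = N.σ (e d)
  map_α : ∀ d, e (M.α d) = N.α (e d)
  map_root : e M.root = N.root

theorem IsIso.refl (M : RootedMap D) : IsIso M M (Equiv.refl D) :=
  ⟨fun _ => rfl, fun _ => rfl, rfl⟩

theorem IsIso.symm {M : RootedMap D} {N : RootedMap D'} {e : D ≃ D'} (h : IsIso M N e) :
    IsIso N M e.symm where
  map_σ d := by rw [Equiv.symm_apply_eq, h.map_σ, Equiv.apply_symm_apply]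
  map_α d := by rw [Equiv.symm_apply_eq, h.map_α, Equiv.apply_symm_apply]
  map_root := by rw [Equiv.symm_apply_eq, h.map_root]

theorem IsIso.trans {D'' : Type} {M : RootedMap D} {N : RootedMap D'} {P : RootedMap D''}
    {e : D ≃ D'} {f : D' ≃ D''} (h : IsIso M N e) (k : IsIso N P f) :
    IsIso M P (e.trans f) where
  map_σ d := by simp [h.map_σ, k.map_σ]
  map_α d := by simp [h.map_α, k.map_α]
  map_root := by simp [h.map_root, k.map_root]

end RootedMap

theorem sameCycle_iff_of_conj {D D' : Type} {s : Equiv.Perm D} {t : Equiv.Perm D'} (e : D ≃ D')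
    (h : ∀ d, e (s d) = t (e d)) (x y : D) : s.SameCycle x y ↔ t.SameCycle (e x) (e y) := by
  have ht : t = (e.symm.trans s).trans e := by
    ext d
    simp [h]
  have hp : ∀ n : ℤ, (t ^ n) (e x) = e ((s ^ n) x) := by
    have h1 : t = e.permCongr s := by rw [ht]; rfl
    intro n
    have h2 : t ^ n = e.permCongr (s ^ n) := by
      rw [h1]
      exact (map_zpow (e.permCongrHom) s n).symm
    rw [h2]
    simp
  constructor
  · rintro ⟨n, hn⟩
    exact ⟨n, by rw [hp, hn]⟩
  · rintro ⟨n, hn⟩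
    exact ⟨n, e.injective (by rw [← hp, hn])⟩

/-- Conjugate permutations have corresponding orbits. -/
def orbitCongr {D D' : Type} {s : Equiv.Perm D} {t : Equiv.Perm D'} (e : D ≃ D')
    (h : ∀ d, e (s d) = t (e d)) :
    Quotient (Equiv.Perm.SameCycle.setoid s) ≃ Quotient (Equiv.Perm.SameCycle.setoid t) :=
  Quotient.congr e (sameCycle_iff_of_conj e h)

namespace RootedMap

variable {D D' : Type}

theorem IsIso.deg_eq {M : RootedMap D} {N : RootedMap D'} {e : D ≃ D'} (h : IsIso M N e)
    (v : M.Vertex) : N.deg (orbitCongr e h.map_σ v) = M.deg v := by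
  refine Nat.card_congr (e.subtypeEquiv fun d => ?_).symm
  have h1 : N.vertexOf (e d) = orbitCongr e h.map_σ (M.vertexOf d) := rfl
  rw [h1]
  exact (orbitCongr e h.map_σ).injective.eq_iff.symm

theorem IsIso.isPlanar {M : RootedMap D} {N : RootedMap D'} {e : D ≃ D'} (h : IsIso M N e) :
    M.IsPlanar ↔ N.IsPlanar := by
  have h1 : Nat.card M.Vertex = Nat.card N.Vertex := Nat.card_congr (orbitCongr e h.map_σ)
  have h2 : Nat.card M.Face = Nat.card N.Face :=
    Nat.card_congr (orbitCongr e fun d => by simp [h.map_σ, h.map_α])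
  have h3 : Nat.card D = Nat.card D' := Nat.card_congr e
  rw [IsPlanar, IsPlanar, h1, h2, h3]

theorem IsIso.vertexWeight_eq {R : Type*} [CommSemiring R] (g : ℕ → R) {M : RootedMap D}
    {N : RootedMap D'} {e : D ≃ D'} (h : IsIso M N e) : M.vertexWeight g = N.vertexWeight g :=
  finprod_eq_of_bijective (orbitCongr e h.map_σ) (orbitCongr e h.map_σ).bijective
    fun v => by rw [h.deg_eq]

instance finiteRootedMap [Finite D] : Finite (RootedMap D) := by
  refine Finite.of_injective (fun M : RootedMap D => (M.σ, M.α, M.root)) ?_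
  rintro ⟨σ, α, r, _, _, _⟩ ⟨σ', α', r', _, _, _⟩ h
  simp only [Prod.mk.injEq] at h
  obtain ⟨rfl, rfl, rfl⟩ := h
  rfl

/-! ### Crossing-vertices and their resolution -/

/-- `M.Arrives X d y`: starting from the half-edge `d` and traversing its edge, then going straight
(to the opposite one of the four half-edges) through every vertex whose half-edges lie in `X`,
one arrives at some stage at the half-edge `y`. -/
inductive Arrives (M : RootedMap D) (X : Set D) (d : D) : D → Prop
  | edge : Arrives M X d (M.α d)
  | straight {y : D} : Arrives M X d y → y ∈ X → Arrives M X d (M.α (M.σ (M.σ y)))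

/-- `M'` is a drawing of `M` with crossings at the vertices of `M'` whose half-edges form the
set `X`: these vertices have degree 4, the other vertices of `M'` (with their cyclic orders)
are those of `M`, following the strands of `M'` straight through the crossings gives
the edges of `M`, and every passage through a crossing belongs to an edge of `M`. -/
def IsDrawingOf (M' : RootedMap D') (X : Set D') (M : RootedMap D) : Prop :=
  (∀ x ∈ X, M'.σ x ∈ X ∧ M'.deg (M'.vertexOf x) = 4) ∧
  (∀ x ∈ X, ∃ d, d ∉ X ∧ M'.Arrives X d x) ∧
  ∃ f : D → D', Function.Injective f ∧ Set.range f = Xᶜ ∧ f M.root = M'.root ∧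
    (∀ d, f (M.σ d) = M'.σ (f d)) ∧ ∀ d, M'.Arrives X (f d) (f (M.α d))

/-- The number of vertices whose half-edges belong to `X`. -/
noncomputable def numVerticesIn (M : RootedMap D) (X : Set D) : ℕ := (M.vertexOf '' X).ncard

end RootedMap

/-! ### Blossoming trees with matching-indices -/

/-- Planted plane trees, seen from the edge that leads to their root: the tree is an opening
leaf, a closing leaf carrying its matching-index, or a node carrying a label, with its subtrees
listed in clockwise order starting after the edge that leads to the root.
A rooted tree (marked leaf = root leaf) is given by what is attached to its root leaf,
and the root leaf (which is an opening leaf) is not represented. -/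
inductive BTree (κ : Type) : Type
  | opening : BTree κ
  | closing (ι : ℕ) : BTree κ
  | node (label : κ) (n : ℕ) (child : Fin n → BTree κ) : BTree κ

/-- The half-edges incident to nodes, met in a clockwise walk around a tree, are of four kinds:
those leading to an opening leaf, those leading to a closing leaf (with its matching-index), and,
for an edge between two nodes, the half-edge at the node closest to the root leaf (`down`), and the
other one (`up`). -/
inductive Step : Type
  | opening : Step
  | closing (ι : ℕ) : Step
  | down : Step
  | up : Step

/-- Is it a half-edge leading to a leaf? -/
def Step.isLeaf : Step → Bool
  | .opening => true
  | .closing _ => true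
  | .down => false
  | .up => false

namespace BTree

variable {κ : Type}

def isOpening : BTree κ → Bool
  | opening => true
  | closing _ => false
  | node _ _ _ => false

def IsNode : BTree κ → Prop
  | opening => False
  | closing _ => False
  | node _ _ _ => True

/-- Every node has even degree `2 * k`, and `k - 1` adjacent opening leaves (not counting the root
leaf). A node with `n` subtrees has degree `n + 1`. -/
def NodesEulerian : BTree κ → Prop
  | opening => True
  | closing _ => True
  | node _ n child =>
      (∃ k, n + 1 = 2 * k ∧ (Finset.univ.filter fun j => (child j).isOpening).card + 1 = k) ∧
        ∀ j, (child j).NodesEulerian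

/-- The leaves other than the root leaf, in clockwise order: `none` for an opening leaf, `some ι`
for a closing leaf of matching-index `ι`. -/
def leaves : BTree κ → List (Option ℕ)
  | opening => [none]
  | closing ι => [some ι]
  | node _ _ child => (List.ofFn fun j => (child j).leaves).flatten

/-- Reading leaves from height `h` (an opening leaf is an up-step, a closing leaf is a
down-step), each closing leaf has a positive height and a matching-index
in `{0, …, height - 1}`. -/
def ValidIndices : ℕ → List (Option ℕ) → Prop
  | _, [] => True
  | h, none :: w => ValidIndices (h + 1) w
  | h, some ι :: w => ι < h ∧ ValidIndices (h - 1) w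

/-- Enriched Eulerian trees: balanced Eulerian trees endowed with a matching-assignment. (The
only other leaf of a nodeless tree has to be closing.) -/
def IsEnrichedEulerian (T : BTree κ) : Prop :=
  T.isOpening = false ∧ T.NodesEulerian ∧ ValidIndices 1 T.leaves

/-- The half-edges incident to nodes, in the order of a clockwise walk, each with the label of
its node; `p` is the label of the parent node. -/
def walkFrom : κ → BTree κ → List (Step × κ)
  | p, opening => [(Step.opening, p)]
  | p, closing ι => [(Step.closing ι, p)]
  | p, node x _ child =>
      (Step.down, p) :: (List.ofFn fun j => walkFrom x (child j)).flatten ++ [(Step.up, x)]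

/-- The half-edges incident to nodes in the order of a clockwise walk around the whole tree
starting at the root leaf; the first one is the half-edge leading to the root leaf. -/
def walk : BTree κ → List (Step × κ)
  | opening => []
  | closing _ => []
  | node x _ child => (Step.opening, x) :: (List.ofFn fun j => walkFrom x (child j)).flatten

end BTree

/-- The pairs of (positions of) half-edges that form the edges of the closure of a tree, found by
reading the walk: `p` is the current position, `s` lists the positions of the opening leaves that
are not yet matched, and `b` those of the `down` half-edges that are not yet matched
(the most recent first). A closing leaf of matching-index `ι` met while `o_1, …, o_h` are the
unmatched opening leaves, in their order of appearance, is matched with `o_(h-ι)`. -/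
def matchedPairs : List Step → ℕ → List ℕ → List ℕ → List (ℕ × ℕ)
  | [], _, _, _ => []
  | Step.opening :: w, p, s, b => matchedPairs w (p + 1) (p :: s) b
  | Step.closing ι :: w, p, s, b => (s.getD ι 0, p) :: matchedPairs w (p + 1) (s.eraseIdx ι) b
  | Step.down :: w, p, s, b => matchedPairs w (p + 1) s (p :: b)
  | Step.up :: w, p, s, b => (b.headD 0, p) :: matchedPairs w (p + 1) s b.tail

namespace BTree

variable {κ : Type} {D D' : Type}

/-- `M` is the closure of `T`, the map obtained by merging each closing leaf with its matched
opening leaf to form an edge; `e` gives the half-edge of `M` at each position in the walk.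
Clockwise around a node, a half-edge leading to a leaf is followed by the next half-edge of the
walk, and a half-edge of an edge between two nodes is followed by the half-edge that comes next
in the walk after the opposite half-edge. -/
structure IsClosureVia (T : BTree κ) (M : RootedMap D) (e : Fin T.walk.length ≃ D) : Prop where
  root_eq : ∀ i, i.val = 0 → e i = M.root
  edge : ∀ i j : Fin T.walk.length,
    (i.val, j.val) ∈ matchedPairs (T.walk.map Prod.fst) 0 [] [] → M.α (e i) = e j
  rotation : ∀ i, M.σ (e i) =
    if (T.walk.get i).1.isLeaf then e (finRotate _ i) else e (finRotate _ (e.symm (M.α (e i))))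

/-- `M` is the closure of `T` (up to renaming the half-edges). -/
def IsClosure (T : BTree κ) (M : RootedMap D) : Prop := ∃ e, T.IsClosureVia M e

/-- The branch that replaces a closing leaf of matching-index `ι`: it has `ι` crossing-vertices
(label `true`), each with a closing leaf on the left and an opening leaf on the right,
and it ends with a closing leaf. All matching-indices are now `0`. -/
def branch : ℕ → BTree Bool
  | 0 => closing 0
  | ι + 1 => node true 3 ![closing 0, branch ι, opening]

/-- The leaf-extension of every closing leaf. The original nodes get the label `false`. -/
def leafExtend : BTree Unit → BTree Bool
  | opening => opening
  | closing ι => branch ι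
  | node _ n child => node false n fun j => (child j).leafExtend

theorem IsClosureVia.of_iso {T : BTree κ} {M : RootedMap D} {N : RootedMap D'}
    {e : Fin T.walk.length ≃ D} {f : D ≃ D'} (h : T.IsClosureVia M e)
    (hf : RootedMap.IsIso M N f) : T.IsClosureVia N (e.trans f) where
  root_eq i hi := by simp [h.root_eq i hi, hf.map_root]
  edge i j hij := by simp [← hf.map_α, h.edge i j hij]
  rotation i := by
    simp only [Equiv.trans_apply, ← hf.map_σ, ← hf.map_α, h.rotation i, Equiv.symm_trans_apply,
      Equiv.symm_apply_apply]
    split_ifs <;> rfl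

theorem IsClosure.of_iso {T : BTree κ} {M : RootedMap D} {N : RootedMap D'} {f : D ≃ D'}
    (h : T.IsClosure M) (hf : RootedMap.IsIso M N f) : T.IsClosure N :=
  let ⟨_, he⟩ := h
  ⟨_, he.of_iso hf⟩

end BTree

/-! ### The canonical planar representation -/

namespace RootedMap

variable {D D' : Type}

/-- `(M', X)` is the canonical planar representation of the rooted Eulerian map `M`: if `T` is the
enriched Eulerian tree whose closure is `M`, then `M'` is the closure of the tree
obtained from `T` by extending all its closing leaves, and `X` is the set of half-edges
incident to its crossing-vertices. -/
def IsCanonicalRep (M : RootedMap D) (M' : RootedMap D') (X : Set D') : Prop :=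
  ∃ T : BTree Unit, T.IsEnrichedEulerian ∧ T.IsClosure M ∧
    ∃ e, T.leafExtend.IsClosureVia M' e ∧ X = e '' {i | (T.leafExtend.walk.get i).2 = true}

/-- The number of crossing-vertices in the canonical planar representation of `M` (which
is unique up to isomorphism). -/
noncomputable def crossingNumber (M : RootedMap D) : ℕ :=
  sInf {c | ∃ (E' : ℕ) (M' : RootedMap (Fin (2 * E'))) (X : Set (Fin (2 * E'))),
    M.IsCanonicalRep M' X ∧ M'.numVerticesIn X = c}

theorem IsIso.crossingNumber_eq {M : RootedMap D} {N : RootedMap D'} {e : D ≃ D'}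
    (h : IsIso M N e) : M.crossingNumber = N.crossingNumber := by
  have key : ∀ {E' : ℕ} (M' : RootedMap (Fin (2 * E'))) (X : Set (Fin (2 * E'))),
      M.IsCanonicalRep M' X ↔ N.IsCanonicalRep M' X := fun M' X =>
    ⟨fun ⟨T, hT, hc, hr⟩ => ⟨T, hT, hc.of_iso h, hr⟩,
      fun ⟨T, hT, hc, hr⟩ => ⟨T, hT, hc.of_iso h.symm, hr⟩⟩
  simp only [crossingNumber, key]

end RootedMap

/-! ### Counting rooted Eulerian maps up to isomorphism -/

/-- Isomorphism of rooted Eulerian maps with `E` edges. -/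
def eulerianMapSetoid (E : ℕ) : Setoid {M : RootedMap (Fin (2 * E)) // M.IsEulerian} where
  r M N := ∃ e, RootedMap.IsIso M.1 N.1 e
  iseqv := ⟨fun M => ⟨_, .refl M.1⟩, fun ⟨_, h⟩ => ⟨_, h.symm⟩, fun ⟨_, h⟩ ⟨_, k⟩ => ⟨_, h.trans k⟩⟩

/-- Rooted Eulerian maps with `E` edges, up to isomorphism. -/
def EulerianMap (E : ℕ) : Type := Quotient (eulerianMapSetoid E)

noncomputable instance fintypeEulerianMap (E : ℕ) : Fintype (EulerianMap E) :=
  have : Finite (EulerianMap E) := inferInstanceAs (Finite (Quotient (eulerianMapSetoid E)))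
  Fintype.ofFinite _

namespace EulerianMap

variable {E : ℕ}

noncomputable def vertexWeight {R : Type*} [CommSemiring R] (g : ℕ → R) : EulerianMap E → R :=
  Quotient.lift (fun M => M.1.vertexWeight g) fun _ _ ⟨_, h⟩ => h.vertexWeight_eq g

noncomputable def crossingNumber : EulerianMap E → ℕ :=
  Quotient.lift (fun M => M.1.crossingNumber) fun _ _ ⟨_, h⟩ => h.crossingNumber_eq

def IsPlanar : EulerianMap E → Prop :=
  Quotient.lift (fun M => M.1.IsPlanar) fun _ _ ⟨_, h⟩ => propext h.isPlanar

end EulerianMap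

/-- The counting series in the variable `t` (conjugate to the number `E` of edges) of rooted
Eulerian maps with weights `w`, with the conventional term `1` for the map reduced to a vertex.
(There is no `RootedMap` with `E = 0`.) -/
noncomputable def countingSeries {R : Type*} [CommSemiring R] (w : (E : ℕ) → EulerianMap E → R) :
    PowerSeries R :=
  1 + PowerSeries.mk fun E => ∑ M : EulerianMap E, w E M

/-! ### The recursive system -/

/-- The height after `j` steps of a path starting at height `i` (`true` is an up-step, `false` a
down-step). -/
def pathHeight (i : ℕ) {n : ℕ} (s : Fin n → Bool) (j : ℕ) : ℤ :=
  i + ∑ l : Fin n, if l.val < j then (if s l then 1 else -1) else 0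

/-- The Dyck paths of length `2 * k - 1` from height `i` to height `i - 1`, with all heights
nonnegative. -/
def dyckPaths (k i : ℕ) : Finset (Fin (2 * k - 1) → Bool) :=
  Finset.univ.filter fun s =>
    (∀ j : Fin (2 * k), 0 ≤ pathHeight i s j) ∧ pathHeight i s (2 * k - 1) = (i : ℤ) - 1

/-- The product of the `r h` over the descending steps `h → h - 1` of a path starting at
height `i`. -/
noncomputable def pathWeight {R : Type*} [CommSemiring R] (r : ℕ → PowerSeries R) (i : ℕ) {n : ℕ}
    (s : Fin n → Bool) : PowerSeries R :=
  ∏ j : Fin n, if s j then 1 else r (pathHeight i s j).toNat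

/-- The recursive system with leaf weights `[h]_q = 1 + q + ⋯ + q ^ (h - 1)`, for the series `r i`
in the variable `t`, `i ≥ 1` (and `r 0 = 0`):
`r i = [i]_q + ∑_{k ≥ 1} t ^ k g_k ∑_{paths} ∏_{descending steps} r h`.
It is stated coefficient by coefficient, where the terms with `k > n` of the infinite sum do not
contribute to the coefficient of `t ^ n`. -/
def IsRecursiveSystem {R : Type*} [CommSemiring R] (g : ℕ → R) (q : R) (r : ℕ → PowerSeries R) :
    Prop :=
  r 0 = 0 ∧ ∀ i, 1 ≤ i → ∀ n, PowerSeries.coeff n (r i) =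
    PowerSeries.coeff n (PowerSeries.C (∑ l ∈ Finset.range i, q ^ l) +
      ∑ k ∈ Finset.Icc 1 n, PowerSeries.X ^ k * PowerSeries.C (g k) *
        ∑ s ∈ dyckPaths k i, pathWeight r i s)

/-! Everything is read off the clockwise walk around the tree. Once its positions carry the
half-edges of a map, being the closure amounts to two conditions: successive half-edges follow each
other by rotation, the edge being crossed first at a `down` or `up` step (`Rot`), and opposite
half-edges are those matched when unmatched openings and unmatched downward half-edges are kept on
two stacks (`Good`). A `ClosureWord` is such a labelling that uses every half-edge once. In it the
nodes are the vertices, with their degrees. Orient an edge made of two leaves from opening to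
closing, and an edge between two nodes from child to parent: the rule of `k - 1` opening leaves at a
node of degree `2k` says exactly that this orientation is Eulerian.

Injectivity (`closureWord_unique`). Two trees with the same closure are read in parallel. Whether
the opposite half-edge has already been met, and in which role, settles every disagreement except
"opening leaf in one tree, child in the other". In that case the two orientations are compared on
the boundary of the set of half-edges at the nodes of the child's subtree: one flux is strictly
smaller than the other, but both vanish (`not_opening_and_node`).

Surjectivity (`exists_explored`, `RootedMap.IsEulerian.exists_closureWord`). The map is explored
with an Eulerian orientation at hand. A half-edge whose opposite has been visited is a closing leaf.
Otherwise, if some Eulerian orientation compatible with the past makes it outgoing, adopt that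
orientation and declare an opening leaf; if none does, the half-edge is forced and leads to a child.
A forced half-edge cannot lead back to the current vertex or to an ancestor, since it would close a
directed cycle of forced edges, which could be reversed (`Chain.not_mem_of_forced`). At the end the
visited set has no outgoing flux, hence no boundary, and is the whole map by connectedness.

Planarity (`ClosureWord.isPlanar_iff`). The face permutation is the product of the walk, a single
cycle, with the involution that exchanges matched leaves. Each transposition changes the number of
cycles by at most one, and Euler's relation for genus 0 says that each of them creates a cycle. If
all indices are 0, the stack is constant along faces and separates enough of them; a positive index
produces two crossing chords, and a cycle is lost.

Leaf-extension (`drawing_branch`, `drawing_segment`, `ClosureWord.isDrawingOf`). A branch for the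
index `ι` lets the top `ι` strands of the stack pass straight through it and consumes the next one,
so the two walks stay synchronized. All indices of the extension are 0, so its closure is planar,
and its number of crossing-vertices is the sum of the original indices, which vanishes exactly when
the map is planar.

Counting (`BTree.isRecursiveSystem_series`). Opening children of a node are up-steps, and every
other subtree lowers the height by one: the children of a node of degree `2k` form a path of length
`2k - 1` from `i` to `i - 1`, and a closing leaf at height `i` has `i` possible indices, whence
`[i]_q`. The factor `t ^ k` with `k ≥ 1` makes the system triangular, so that its solution is
unique. -/

/-! ### Walks labelled by half-edges -/

/-- The orientation of a half-edge: edges are oriented from the opening to the closing half-edge, and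
from a node to its parent. -/
def Step.sgn : Step → ℤ
  | .opening => 1
  | .closing _ => -1
  | .down => -1
  | .up => 1

/-- The letter contributed to the word of leaves. -/
def Step.code : Step → Option (Option ℕ)
  | .opening => some none
  | .closing ι => some (some ι)
  | .down => none
  | .up => none

/-- A position of a walk, with its half-edge in a map. -/
abbrev Entry (κ D : Type) : Type := (Step × κ) × D

/-- The half-edge that determines the next one in a walk, by rotation. -/
def Step.turn {D : Type} (α : D → D) (st : Step) (x : D) : D := if st.isLeaf then x else α x

section Words

variable {κ D : Type}

/-- The entries follow each other by rotation: the first half-edge is `c`, and the one expected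
after the last entry is `z`. -/
def Rot (M : RootedMap D) : D → List (Entry κ D) → D → Prop
  | c, [], z => c = z
  | c, e :: W, z => e.2 = c ∧ Rot M (M.σ (e.1.1.turn M.α e.2)) W z

theorem rot_append {M : RootedMap D} {W V : List (Entry κ D)} {c z : D} :
    Rot M c (W ++ V) z ↔ ∃ y, Rot M c W y ∧ Rot M y V z := by
  induction W generalizing c with
  | nil => simp [Rot]
  | cons e W ih => simp [Rot, ih, and_assoc]

/-- The pairs of matched entries are exchanged by `α`, when the walk is read with unmatched
opening half-edges `s` and unmatched downward half-edges `b`. -/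
def Good (α : D → D) : List (Entry κ D) → List D → List D → Prop
  | [], s, b => s = [] ∧ b = []
  | ((.opening, _), x) :: W, s, b => Good α W (x :: s) b
  | ((.closing ι, _), x) :: W, s, b => ∃ y, s[ι]? = some y ∧ α y = x ∧ Good α W (s.eraseIdx ι) b
  | ((.down, _), x) :: W, s, b => Good α W s (x :: b)
  | ((.up, _), x) :: W, s, b => ∃ y b', b = y :: b' ∧ α y = x ∧ Good α W s b'

theorem Good.drop_append {α : D → D} {P R : List (Entry κ D)} {s b : List D}
    (h : Good α (P ++ R) s b) : ∃ s' b', Good α R s' b' := by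
  induction P generalizing s b with
  | nil => exact ⟨s, b, h⟩
  | cons e P ih =>
    obtain ⟨⟨st, l⟩, x⟩ := e
    cases st with
    | opening => exact ih h
    | closing ι => obtain ⟨y, _, _, h⟩ := h; exact ih h
    | down => exact ih h
    | up => obtain ⟨y, b', _, _, h⟩ := h; exact ih h

theorem mem_eraseIdx_of_ne {s : List D} {ι : ℕ} {y z : D} (h : s[ι]? = some y) (hz : z ∈ s)
    (hne : z ≠ y) : z ∈ s.eraseIdx ι := by
  rw [List.mem_eraseIdx_iff_getElem?]
  obtain ⟨i, hi⟩ := List.mem_iff_getElem?.1 hz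
  refine ⟨i, ?_, hi⟩
  rintro rfl
  rw [h] at hi
  exact hne (Option.some.inj hi).symm

/-- The stacks are empty at the end of the word, so whatever lies on them is removed by some later
entry, which is its opposite. -/
theorem Good.exists_closing {α : D → D} {W : List (Entry κ D)} {s b : List D}
    (h : Good α W s b) {z : D} (hz : z ∈ s) : ∃ ι l, ((Step.closing ι, l), α z) ∈ W := by
  induction W generalizing s b with
  | nil => rw [h.1] at hz; simp at hz
  | cons e W ih =>
    obtain ⟨⟨st, l⟩, x⟩ := e
    have lift : (∃ ι l, ((Step.closing ι, l), α z) ∈ W) →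
        ∃ ι l', ((Step.closing ι, l'), α z) ∈ ((st, l), x) :: W := by
      rintro ⟨ι, l', h⟩
      exact ⟨ι, l', List.mem_cons_of_mem _ h⟩
    cases st with
    | opening => exact lift (ih h (List.mem_cons_of_mem _ hz))
    | closing ι =>
      obtain ⟨y, hy, hx, h⟩ := h
      by_cases hzy : z = y
      · subst hzy; exact ⟨ι, l, by simp [hx]⟩
      · exact lift (ih h (mem_eraseIdx_of_ne hy hz hzy))
    | down => exact lift (ih h hz)
    | up => obtain ⟨y, b', _, _, h⟩ := h; exact lift (ih h hz)

theorem Good.exists_up {α : D → D} {W : List (Entry κ D)} {s b : List D}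
    (h : Good α W s b) {z : D} (hz : z ∈ b) : ∃ l, ((Step.up, l), α z) ∈ W := by
  induction W generalizing s b with
  | nil => rw [h.2] at hz; simp at hz
  | cons e W ih =>
    obtain ⟨⟨st, l⟩, x⟩ := e
    have lift : (∃ l, ((Step.up, l), α z) ∈ W) →
        ∃ l', ((Step.up, l'), α z) ∈ ((st, l), x) :: W := by
      rintro ⟨l', h⟩
      exact ⟨l', List.mem_cons_of_mem _ h⟩
    cases st with
    | opening => exact lift (ih h hz)
    | closing ι =>
      obtain ⟨y, _, _, h⟩ := h
      exact lift (ih h hz)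
    | down => exact lift (ih h (List.mem_cons_of_mem _ hz))
    | up =>
      obtain ⟨y, b', rfl, hx, h⟩ := h
      rcases List.mem_cons.1 hz with rfl | hz
      · exact ⟨l, by simp [hx]⟩
      · exact lift (ih h hz)

theorem Good.closing_of_opening {α : D → D} {P R : List (Entry κ D)} {s b : List D} {l : κ} {x : D}
    (h : Good α (P ++ ((.opening, l), x) :: R) s b) :
    ∃ ι l', ((Step.closing ι, l'), α x) ∈ R := by
  obtain ⟨s', b', h⟩ := h.drop_append
  exact Good.exists_closing (s := x :: s') h (by simp)

theorem Good.up_of_down {α : D → D} {P R : List (Entry κ D)} {s b : List D} {l : κ} {x : D}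
    (h : Good α (P ++ ((.down, l), x) :: R) s b) : ∃ l', ((Step.up, l'), α x) ∈ R := by
  obtain ⟨s', b', h⟩ := h.drop_append
  exact Good.exists_up (b := x :: b') h (by simp)

/-- What a closing entry removes from the stack was there at the start or was pushed by an opening
entry of the prefix. -/
theorem Good.opening_of_closing {α : D → D} (hα : ∀ d, α (α d) = d) {P R : List (Entry κ D)}
    {s b : List D} {ι : ℕ} {l : κ} {x : D} (h : Good α (P ++ ((.closing ι, l), x) :: R) s b) :
    α x ∈ s ∨ ∃ l', ((Step.opening, l'), α x) ∈ P := by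
  induction P generalizing s b with
  | nil =>
    obtain ⟨y, hy, rfl, h⟩ := h
    exact Or.inl (by rw [hα]; exact List.mem_of_getElem? hy)
  | cons e P ih =>
    obtain ⟨⟨st, l⟩, y⟩ := e
    cases st with
    | opening =>
      rcases ih h with h | ⟨l', h⟩
      · rcases List.mem_cons.1 h with h | h
        · exact Or.inr ⟨l, by simp [h]⟩
        · exact Or.inl h
      · exact Or.inr ⟨l', by simp [h]⟩
    | closing ι =>
      obtain ⟨y, _, _, h⟩ := h
      rcases ih h with h | ⟨l', h⟩
      · exact Or.inl (List.mem_of_mem_eraseIdx h)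
      · exact Or.inr ⟨l', by simp [h]⟩
    | down =>
      rcases ih h with h | ⟨l', h⟩
      · exact Or.inl h
      · exact Or.inr ⟨l', by simp [h]⟩
    | up =>
      obtain ⟨y, b', _, _, h⟩ := h
      rcases ih h with h | ⟨l', h⟩
      · exact Or.inl h
      · exact Or.inr ⟨l', by simp [h]⟩

theorem Good.down_of_up {α : D → D} (hα : ∀ d, α (α d) = d) {P R : List (Entry κ D)}
    {s b : List D} {l : κ} {x : D} (h : Good α (P ++ ((.up, l), x) :: R) s b) :
    α x ∈ b ∨ ∃ l', ((Step.down, l'), α x) ∈ P := by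
  induction P generalizing s b with
  | nil =>
    obtain ⟨y, b', rfl, rfl, h⟩ := h
    exact Or.inl (by simp [hα])
  | cons e P ih =>
    obtain ⟨⟨st, l⟩, y⟩ := e
    cases st with
    | opening =>
      rcases ih h with h | ⟨l', h⟩
      · exact Or.inl h
      · exact Or.inr ⟨l', by simp [h]⟩
    | closing ι =>
      obtain ⟨y, _, _, h⟩ := h
      rcases ih h with h | ⟨l', h⟩
      · exact Or.inl h
      · exact Or.inr ⟨l', by simp [h]⟩
    | down =>
      rcases ih h with h | ⟨l', h⟩
      · rcases List.mem_cons.1 h with h | h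
        · exact Or.inr ⟨l, by simp [h]⟩
        · exact Or.inl h
      · exact Or.inr ⟨l', by simp [h]⟩
    | up =>
      obtain ⟨y, b', rfl, _, h⟩ := h
      rcases ih h with h | ⟨l', h⟩
      · exact Or.inl (by simp [h])
      · exact Or.inr ⟨l', by simp [h]⟩

/-- A half-edge with nodup values has only one entry. -/
theorem entry_unique {W : List (Entry κ D)} (hW : (W.map Prod.snd).Nodup) {a a' : Step × κ} {x : D}
    (h : (a, x) ∈ W) (h' : (a', x) ∈ W) : a = a' :=
  congrArg Prod.fst (List.inj_on_of_nodup_map hW h h' rfl)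

/-- Openings are matched with closings and downward half-edges with upward ones. This makes
`Step.turn` an involution, so that the rotation may be prescribed at either half of an edge. -/
theorem Good.isLeaf_eq {α : D → D} (hα : ∀ d, α (α d) = d) {W : List (Entry κ D)}
    (h : Good α W [] []) (hW : (W.map Prod.snd).Nodup) {a a' : Step × κ} {x : D}
    (hx : (a, x) ∈ W) (hy : (a', α x) ∈ W) : a'.1.isLeaf = a.1.isLeaf := by
  obtain ⟨st, l⟩ := a
  obtain ⟨P, R, rfl⟩ := List.append_of_mem hx
  cases st with
  | opening =>
    obtain ⟨ι, l', h1⟩ := h.closing_of_opening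
    rw [entry_unique hW hy (a' := (Step.closing ι, l')) (by simp [h1])]
    rfl
  | closing ι =>
    obtain h1 | ⟨l', h1⟩ := h.opening_of_closing hα
    · simp at h1
    rw [entry_unique hW hy (a' := (Step.opening, l')) (by simp [h1])]
    rfl
  | down =>
    obtain ⟨l', h1⟩ := h.up_of_down
    rw [entry_unique hW hy (a' := (Step.up, l')) (by simp [h1])]
    rfl
  | up =>
    obtain h1 | ⟨l', h1⟩ := h.down_of_up hα
    · simp at h1
    rw [entry_unique hW hy (a' := (Step.down, l')) (by simp [h1])]
    rfl

/-- The half-edges are oppositely oriented along each edge. -/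
theorem Good.sgn_eq {α : D → D} (hα : ∀ d, α (α d) = d) {W : List (Entry κ D)}
    (h : Good α W [] []) (hW : (W.map Prod.snd).Nodup) {a a' : Step × κ} {x : D}
    (hx : (a, x) ∈ W) (hy : (a', α x) ∈ W) : a'.1.sgn = -a.1.sgn := by
  obtain ⟨st, l⟩ := a
  obtain ⟨P, R, rfl⟩ := List.append_of_mem hx
  cases st with
  | opening =>
    obtain ⟨ι, l', h1⟩ := h.closing_of_opening
    rw [entry_unique hW hy (a' := (Step.closing ι, l')) (by simp [h1])]
    rfl
  | closing ι =>
    obtain h1 | ⟨l', h1⟩ := h.opening_of_closing hα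
    · simp at h1
    rw [entry_unique hW hy (a' := (Step.opening, l')) (by simp [h1])]
    rfl
  | down =>
    obtain ⟨l', h1⟩ := h.up_of_down
    rw [entry_unique hW hy (a' := (Step.up, l')) (by simp [h1])]
    rfl
  | up =>
    obtain h1 | ⟨l', h1⟩ := h.down_of_up hα
    · simp at h1
    rw [entry_unique hW hy (a' := (Step.down, l')) (by simp [h1])]
    rfl

theorem Good.validIndices {α : D → D} {W : List (Entry κ D)} {s b : List D} (h : Good α W s b) :
    BTree.ValidIndices s.length (W.filterMap fun e => e.1.1.code) := by
  induction W generalizing s b with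
  | nil => trivial
  | cons e W ih =>
    obtain ⟨⟨st, l⟩, x⟩ := e
    cases st with
    | opening => exact ih (s := x :: s) h
    | closing ι =>
      obtain ⟨y, hy, _, h⟩ := h
      have hι : ι < s.length := (List.getElem?_eq_some_iff.1 hy).1
      have := ih h
      rw [List.length_eraseIdx_of_lt hι] at this
      exact ⟨hι, this⟩
    | down => exact ih h
    | up => obtain ⟨y, b', _, _, h⟩ := h; exact ih h

/-! ### Words of leaves and words of steps -/

/-- Downward and upward steps are balanced. -/
def DownUp : List (Step × κ) → ℕ → Prop
  | [], b => b = 0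
  | (.opening, _) :: w, b => DownUp w b
  | (.closing _, _) :: w, b => DownUp w b
  | (.down, _) :: w, b => DownUp w (b + 1)
  | (.up, _) :: w, b => 1 ≤ b ∧ DownUp w (b - 1)

/-- The truncated subtraction is harmless: when `w` is valid, its closings do not outnumber `h` plus
its openings. -/
theorem validIndices_append (w l : List (Option ℕ)) (h : ℕ) : BTree.ValidIndices h (w ++ l) ↔
    BTree.ValidIndices h w ∧
      BTree.ValidIndices (h + w.countP (·.isNone) - w.countP (·.isSome)) l := by
  induction w generalizing h with
  | nil => simp [BTree.ValidIndices]
  | cons a w ih =>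
    cases a with
    | none =>
      simp only [List.cons_append, BTree.ValidIndices, ih]
      simp
      rw [show h + 1 + List.countP (·.isNone) w = h + (List.countP (·.isNone) w + 1) by omega]
      exact fun _ => Iff.rfl
    | some ι =>
      simp only [List.cons_append, BTree.ValidIndices, ih, and_assoc]
      refine and_congr_right fun hι => and_congr_right fun _ => ?_
      simp
      rw [show h - 1 + List.countP (·.isNone) w - List.countP (·.isSome) w =
        h + List.countP (·.isNone) w - (List.countP (·.isSome) w + 1) by omega]

theorem BTree.ValidIndices.countP_le {w : List (Option ℕ)} {h : ℕ} (hw : BTree.ValidIndices h w) :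
    w.countP (·.isSome) ≤ h + w.countP (·.isNone) := by
  induction w generalizing h with
  | nil => simp
  | cons a w ih =>
    cases a with
    | none => have := ih hw; simp; omega
    | some ι => have := ih hw.2; have := hw.1; simp; omega

end Words

/-! ### Leaf counts and step words of walks -/

namespace BTree

variable {κ : Type}

theorem walkFrom_node (p x : κ) (n : ℕ) (child : Fin n → BTree κ) :
    walkFrom p (node x n child) = (Step.down, p) ::
      (((List.ofFn child).map (walkFrom x)).flatten ++ [(Step.up, x)]) := by
  simp [walkFrom, List.map_ofFn, Function.comp_def]

theorem walk_node (x : κ) (n : ℕ) (child : Fin n → BTree κ) :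
    walk (node x n child) = (Step.opening, x) :: ((List.ofFn child).map (walkFrom x)).flatten := by
  simp [walk, List.map_ofFn, Function.comp_def]

theorem leaves_node (x : κ) (n : ℕ) (child : Fin n → BTree κ) :
    leaves (node x n child) = ((List.ofFn child).map leaves).flatten := by
  simp [leaves, List.map_ofFn, Function.comp_def]

theorem countP_ofFn {A : Type} (f : A → Bool) {n : ℕ} (child : Fin n → A) :
    (List.ofFn child).countP f = (Finset.univ.filter fun j => f (child j)).card := by
  induction n with
  | zero => simp
  | succ n ih =>
    rw [List.ofFn_succ, List.countP_cons, ih, Finset.card_filter, Finset.card_filter,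
      Fin.sum_univ_succ]
    ring

theorem nodesEulerian_node (x : κ) (n : ℕ) (child : Fin n → BTree κ) :
    NodesEulerian (node x n child) ↔ (∃ k, n + 1 = 2 * k ∧
      (List.ofFn child).countP isOpening + 1 = k) ∧ ∀ t ∈ List.ofFn child, NodesEulerian t := by
  rw [List.forall_mem_ofFn_iff, countP_ofFn]
  rfl

theorem filterMap_code_walkFrom (p : κ) (t : BTree κ) :
    (walkFrom p t).filterMap (fun e => e.1.code) = t.leaves := by
  induction t generalizing p with
  | opening => rfl
  | closing ι => rfl
  | node x n child ih =>
    have h : ∀ ts : List (BTree κ), (∀ t ∈ ts, ∀ p, (walkFrom p t).filterMap (fun e => e.1.code) =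
        t.leaves) → (ts.map (walkFrom x)).flatten.filterMap (fun e => e.1.code) =
          (ts.map leaves).flatten := by
      intro ts hts
      induction ts with
      | nil => rfl
      | cons t ts ih => simp_all
    rw [walkFrom_node, leaves_node, List.filterMap_cons_none (by rfl), List.filterMap_append,
      h _ ((List.forall_mem_ofFn_iff).2 ih)]
    simp [Step.code]

theorem filterMap_code_walk {x : κ} {n : ℕ} {child : Fin n → BTree κ} :
    (walk (node x n child)).filterMap (fun e => e.1.code) = none :: (node x n child).leaves := by
  have := filterMap_code_walkFrom x (node x n child)
  rw [walkFrom_node, List.filterMap_cons_none (by rfl), List.filterMap_append] at this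
  rw [walk_node, ← this]
  simp [Step.code]

theorem downUp_walkFrom_append (p : κ) (t : BTree κ) (w : List (Step × κ)) (b : ℕ) :
    DownUp (walkFrom p t ++ w) b ↔ DownUp w b := by
  induction t generalizing p w b with
  | opening => rfl
  | closing ι => rfl
  | node x n child ih =>
    have h : ∀ ts : List (BTree κ), (∀ t ∈ ts, ∀ p w b, DownUp (walkFrom p t ++ w) b ↔ DownUp w b) →
        ∀ w b, DownUp ((ts.map (walkFrom x)).flatten ++ w) b ↔ DownUp w b := by
      intro ts hts
      induction ts with
      | nil => simp
      | cons t ts ih => intro w b; simp_all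
    rw [walkFrom_node]
    simp only [List.cons_append, List.append_assoc, DownUp]
    rw [h _ ((List.forall_mem_ofFn_iff).2 ih)]
    simp [DownUp]

theorem downUp_flatten (x : κ) (ts : List (BTree κ)) :
    DownUp (ts.map (walkFrom x)).flatten 0 := by
  induction ts with
  | nil => rfl
  | cons t ts ih => simpa [downUp_walkFrom_append] using ih

/-- A node of degree `2k` has `k - 1` opening children and `k` other subtrees, each with one closing
leaf in excess, so the excess of the node is again one. Hence a subtree that is not an opening leaf
acts as a single down-step. -/
theorem NodesEulerian.countP_leaves {t : BTree κ} (ht : t.NodesEulerian) :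
    t.leaves.countP (·.isSome) + (if t.isOpening then 1 else 0) =
      t.leaves.countP (·.isNone) + (if t.isOpening then 0 else 1) := by
  induction t with
  | opening => rfl
  | closing ι => rfl
  | node x n child ih =>
    rw [nodesEulerian_node] at ht
    obtain ⟨⟨k, hk, hc⟩, ht⟩ := ht
    have h : ∀ ts : List (BTree κ), (∀ t ∈ ts, t.leaves.countP (·.isSome) +
        (if t.isOpening then 1 else 0) = t.leaves.countP (·.isNone) +
        (if t.isOpening then 0 else 1)) →
        (ts.map leaves).flatten.countP (·.isSome) + 2 * ts.countP isOpening =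
        (ts.map leaves).flatten.countP (·.isNone) + ts.length := by
      intro ts hts
      induction ts with
      | nil => rfl
      | cons t ts ih =>
        have h1 := ih fun t ht => hts t (List.mem_cons_of_mem _ ht)
        have h2 := hts t (by simp)
        simp only [List.map_cons, List.flatten_cons, List.countP_append, List.countP_cons,
          List.length_cons]
        cases h3 : t.isOpening <;> simp only [h3, if_true, if_false, Bool.false_eq_true] at h2 ⊢ <;>
          omega
    have h1 := h (List.ofFn child) (by
      rw [List.forall_mem_ofFn_iff] at ht ⊢
      exact fun j => ih j (ht j))
    rw [leaves_node]
    simp only [isOpening, List.length_ofFn] at h1 ⊢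
    simp at h1 ⊢
    omega

/-- An enriched Eulerian tree with a node. -/
theorem IsEnrichedEulerian.countP_walk {x : κ} {n : ℕ} {child : Fin n → BTree κ}
    (hT : (node x n child).IsEnrichedEulerian) :
    ValidIndices 0 ((walk (node x n child)).filterMap fun e => e.1.code) ∧
    ((walk (node x n child)).filterMap fun e => e.1.code).countP (·.isSome) =
      ((walk (node x n child)).filterMap fun e => e.1.code).countP (·.isNone) := by
  rw [filterMap_code_walk]
  refine ⟨hT.2.2, ?_⟩
  have := hT.2.1.countP_leaves
  simpa [isOpening] using this

end BTree

/-! ### The closure of a tree, in terms of labelled walks -/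

section Closure

variable {κ D : Type}

/-- The labelled walk of a word, where `val` gives the half-edge at each position. -/
def stamp (val : ℕ → D) : List (Step × κ) → ℕ → List (Entry κ D)
  | [], _ => []
  | a :: w, p => (a, val p) :: stamp val w (p + 1)

theorem map_fst_stamp (val : ℕ → D) (w : List (Step × κ)) (p : ℕ) :
    (stamp val w p).map Prod.fst = w := by
  induction w generalizing p with
  | nil => rfl
  | cons a w ih => simp [stamp, ih]

theorem map_snd_stamp (val : ℕ → D) (w : List (Step × κ)) (p : ℕ) :
    (stamp val w p).map Prod.snd = (List.range' p w.length).map val := by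
  induction w generalizing p with
  | nil => rfl
  | cons a w ih => simp [stamp, ih, List.range'_succ]

/-- `h1` and `h3` ensure that the default values `0` of `matchedPairs` are never used; `h2` and `h3`
ensure that both stacks end empty. -/
theorem good_stamp_of_matchedPairs {α : D → D} {val : ℕ → D} {w : List (Step × κ)} {p : ℕ}
    {s b : List ℕ} (h1 : BTree.ValidIndices s.length (w.filterMap fun e => e.1.code))
    (h2 : (w.filterMap fun e => e.1.code).countP (·.isSome) =
      s.length + (w.filterMap fun e => e.1.code).countP (·.isNone)) (h3 : DownUp w b.length)
    (h4 : ∀ i j, (i, j) ∈ matchedPairs (w.map Prod.fst) p s b → α (val i) = val j) :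
    Good α (stamp val w p) (s.map val) (b.map val) := by
  induction w generalizing p s b with
  | nil =>
    simp only [List.filterMap_nil, List.countP_nil, add_zero] at h2
    exact ⟨by simp [List.eq_nil_of_length_eq_zero h2.symm],
      by simp [List.eq_nil_of_length_eq_zero h3]⟩
  | cons a w ih =>
    obtain ⟨st, l⟩ := a
    cases st with
    | opening =>
      rw [List.filterMap_cons_some (b := none) (by rfl)] at h1 h2
      refine ih (s := p :: s) (b := b) h1 ?_ h3 h4
      simp at h2 ⊢
      omega
    | closing ι =>
      rw [List.filterMap_cons_some (b := some ι) (by rfl)] at h1 h2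
      obtain ⟨hι, h1⟩ := h1
      refine ⟨val (s.getD ι 0), ?_, h4 _ _ (by simp [matchedPairs]), ?_⟩
      · simp [List.getD_eq_getElem?_getD, List.getElem?_eq_getElem hι]
      · rw [List.eraseIdx_map]
        have hl : (s.eraseIdx ι).length = s.length - 1 := List.length_eraseIdx_of_lt hι
        refine ih (by rwa [hl]) ?_ h3 fun i j hij => h4 i j ?_
        · simp at h2
          omega
        · simp [matchedPairs, hij]
    | down =>
      rw [List.filterMap_cons_none (by rfl)] at h1 h2
      exact ih (s := s) (b := p :: b) h1 h2 h3 h4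
    | up =>
      rw [List.filterMap_cons_none (by rfl)] at h1 h2
      cases b with
      | nil => exact absurd h3.1 (by simp)
      | cons y b =>
        refine ⟨val y, b.map val, rfl, h4 _ _ (by simp [matchedPairs]), ?_⟩
        exact ih h1 h2 h3.2 fun i j hij => h4 i j (by simp [matchedPairs, hij])

theorem matchedPairs_of_good_stamp {α : D → D} {val : ℕ → D} {w : List (Step × κ)} {p : ℕ}
    {s b : List ℕ} (h : Good α (stamp val w p) (s.map val) (b.map val)) {i j : ℕ}
    (hij : (i, j) ∈ matchedPairs (w.map Prod.fst) p s b) : α (val i) = val j := by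
  induction w generalizing p s b with
  | nil => simp [matchedPairs] at hij
  | cons a w ih =>
    obtain ⟨st, l⟩ := a
    cases st with
    | opening => exact ih (s := p :: s) h hij
    | closing ι =>
      obtain ⟨y, hy, hx, h⟩ := h
      simp only [List.map_cons, matchedPairs, List.mem_cons, Prod.mk.injEq] at hij
      rcases hij with ⟨rfl, rfl⟩ | hij
      · rw [List.getElem?_map, Option.map_eq_some_iff] at hy
        obtain ⟨a, ha, rfl⟩ := hy
        rw [List.getD_eq_getElem?_getD, ha]
        exact hx
      · rw [List.eraseIdx_map] at h
        exact ih h hij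
    | down => exact ih (b := p :: b) h hij
    | up =>
      obtain ⟨y, b', hb, hx, h⟩ := h
      cases b with
      | nil => simp at hb
      | cons z b =>
        simp only [List.map_cons, List.cons.injEq] at hb
        obtain ⟨rfl, rfl⟩ := hb
        simp only [List.map_cons, matchedPairs, List.mem_cons, Prod.mk.injEq] at hij
        rcases hij with ⟨rfl, rfl⟩ | hij
        · exact hx
        · exact ih h hij

theorem rot_stamp {M : RootedMap D} {val : ℕ → D} {w : List (Step × κ)} {p : ℕ} :
    Rot M (val p) (stamp val w p) (val (p + w.length)) ↔
      ∀ i (hi : i < w.length), val (p + i + 1) = M.σ (w[i].1.turn M.α (val (p + i))) := by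
  induction w generalizing p with
  | nil => simp [stamp, Rot]
  | cons a w ih =>
    have key : Rot M (val (p + 1)) (stamp val w (p + 1)) (val (p + 1 + w.length)) ↔
      ∀ i (hi : i < w.length), val (p + (i + 1) + 1) =
        M.σ (w[i].1.turn M.α (val (p + (i + 1)))) := by
      rw [ih]
      simp only [show ∀ i, p + 1 + i = p + (i + 1) by intro i; omega]
    constructor
    · rintro ⟨-, h⟩ i hi
      have h0 : M.σ (a.1.turn M.α (val p)) = val (p + 1) := by
        cases w with
        | nil => exact h
        | cons e w => exact h.1.symm
      cases i with
      | zero => exact h0.symm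
      | succ i =>
        simp only [List.getElem_cons_succ]
        refine key.1 ?_ i (by simpa using hi)
        rw [h0, List.length_cons, show p + (w.length + 1) = p + 1 + w.length by omega] at h
        exact h
    · intro h
      have h0 := h 0 (by simp)
      refine ⟨rfl, ?_⟩
      simp only [add_zero, List.getElem_cons_zero] at h0
      rw [← h0, List.length_cons, show p + (w.length + 1) = p + 1 + w.length by omega, key]
      intro i hi
      exact h (i + 1) (by simpa using hi)

/-- `W` is the walk around the tree `T`, labelled by the half-edges of its closure `M`. -/
structure ClosureWord (T : BTree κ) (M : RootedMap D) (W : List (Entry κ D)) : Prop where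
  steps : W.map Prod.fst = T.walk
  nodup : (W.map Prod.snd).Nodup
  complete : ∀ d, d ∈ W.map Prod.snd
  rot : Rot M M.root W M.root
  good : Good M.α W [] []

end Closure


/-! ### Equivalence of closures and labelled walks -/

section Closure

variable {κ D : Type}

theorem val_finRotate {n : ℕ} (i : Fin n) :
    (finRotate n i).val = if i.val + 1 < n then i.val + 1 else 0 := by
  cases n with
  | zero => exact i.elim0
  | succ n =>
    split_ifs with h
    · rw [finRotate_of_lt (by omega)]
    · have : i = Fin.last n := Fin.ext (by have := i.isLt; simp; omega)
      rw [this, finRotate_last]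
      rfl

/-- Positivity of `N` is there for the default position `0` of `matchedPairs`. -/
theorem lt_of_mem_matchedPairs {w : List Step} {N p : ℕ} {s b : List ℕ} (hN : 0 < N)
    (hs : ∀ x ∈ s, x < N) (hb : ∀ x ∈ b, x < N) (hp : p + w.length ≤ N) {i j : ℕ}
    (h : (i, j) ∈ matchedPairs w p s b) : i < N ∧ j < N := by
  induction w generalizing p s b with
  | nil => simp [matchedPairs] at h
  | cons st w ih =>
    simp only [List.length_cons] at hp
    cases st with
    | opening =>
      exact ih (by simpa using ⟨by omega, hs⟩) hb (by omega) h
    | closing ι =>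
      simp only [matchedPairs, List.mem_cons, Prod.mk.injEq] at h
      rcases h with ⟨rfl, rfl⟩ | h
      · refine ⟨?_, by omega⟩
        rcases lt_or_ge ι s.length with hι | hι
        · rw [List.getD_eq_getElem _ _ hι]
          exact hs _ (List.getElem_mem hι)
        · rwa [List.getD_eq_default _ _ hι]
      · exact ih (fun x hx => hs x (List.mem_of_mem_eraseIdx hx)) hb (by omega) h
    | down =>
      exact ih hs (by simpa using ⟨by omega, hb⟩) (by omega) h
    | up =>
      simp only [matchedPairs, List.mem_cons, Prod.mk.injEq] at h
      rcases h with ⟨rfl, rfl⟩ | h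
      · refine ⟨?_, by omega⟩
        cases b with
        | nil => exact hN
        | cons y b => exact hb y (by simp)
      · exact ih hs (fun x hx => hb x (List.mem_of_mem_tail hx)) (by omega) h

theorem list_pair_ext {A B : Type} {l l' : List (A × B)} (h1 : l.map Prod.fst = l'.map Prod.fst)
    (h2 : l.map Prod.snd = l'.map Prod.snd) : l = l' := by
  rw [← List.zip_unzip l, ← List.zip_unzip l']
  simp [List.unzip_eq_map, h1, h2]

/-- The half-edge at each position. -/
def valOf (M : RootedMap D) {N : ℕ} (e : Fin N → D) (i : ℕ) : D :=
  if h : i < N then e ⟨i, h⟩ else M.root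

theorem map_snd_stamp_valOf (M : RootedMap D) (w : List (Step × κ)) (e : Fin w.length → D) :
    (stamp (valOf M e) w 0).map Prod.snd = List.ofFn e := by
  rw [map_snd_stamp]
  refine List.ext_getElem (by simp) fun i h1 h2 => ?_
  have : i < w.length := by simpa using h1
  simp [valOf, this]

theorem BTree.length_walk_pos {T : BTree κ} (hT : T.IsNode) : 0 < T.walk.length := by
  cases T with
  | opening => exact hT.elim
  | closing ι => exact hT.elim
  | node x n child => simp [BTree.walk]

theorem stamp_valOf_eq_ofFn (M : RootedMap D) (w : List (Step × κ)) (e : Fin w.length → D) :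
    stamp (valOf M e) w 0 = List.ofFn fun i => (w.get i, e i) := by
  refine list_pair_ext ?_ ?_
  · rw [map_fst_stamp, List.map_ofFn]
    exact (List.ofFn_get w).symm
  · rw [map_snd_stamp_valOf, List.map_ofFn]
    rfl

theorem mem_stamp_valOf (M : RootedMap D) (w : List (Step × κ)) (e : Fin w.length → D)
    (i : Fin w.length) : (w.get i, e i) ∈ stamp (valOf M e) w 0 := by
  rw [stamp_valOf_eq_ofFn, List.mem_ofFn]
  exact ⟨i, rfl⟩

theorem BTree.IsClosureVia.closureWord {T : BTree κ} (hT : T.IsEnrichedEulerian) (hN : T.IsNode)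
    {M : RootedMap D} {e : Fin T.walk.length ≃ D} (h : T.IsClosureVia M e) :
    ClosureWord T M (List.ofFn fun i => (T.walk.get i, e i)) := by
  have hpos := BTree.length_walk_pos hN
  have hval : ∀ i (hi : i < T.walk.length), valOf M e i = e ⟨i, hi⟩ := fun i hi => by
    simp [valOf, hi]
  have hnd : ((stamp (valOf M e) T.walk 0).map Prod.snd).Nodup := by
    rw [map_snd_stamp_valOf]
    exact List.nodup_ofFn.2 e.injective
  have hgood : Good M.α (stamp (valOf M e) T.walk 0) [] [] := by
    have h4 : ∀ i j, (i, j) ∈ matchedPairs (T.walk.map Prod.fst) 0 [] [] →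
        M.α (valOf M e i) = valOf M e j := by
      intro i j hij
      obtain ⟨hi, hj⟩ := lt_of_mem_matchedPairs hpos (by simp) (by simp) (by simp) hij
      rw [hval i hi, hval j hj]
      exact h.edge ⟨i, hi⟩ ⟨j, hj⟩ hij
    cases T with
    | opening => exact hN.elim
    | closing ι => exact hN.elim
    | node x n child =>
      have hc := hT.countP_walk
      refine good_stamp_of_matchedPairs (s := []) (b := []) hc.1 (by simpa using hc.2) ?_ h4
      rw [BTree.walk_node]
      exact BTree.downUp_flatten x _
  rw [← stamp_valOf_eq_ofFn M]
  refine ⟨map_fst_stamp _ _ _, hnd, ?_, ?_, hgood⟩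
  · intro d
    rw [map_snd_stamp_valOf, List.mem_ofFn]
    exact e.surjective d
  · have h0 : valOf M e 0 = M.root := by rw [hval 0 hpos]; exact h.root_eq _ rfl
    have hl : valOf M e (0 + T.walk.length) = M.root := by simp [valOf]
    have := (rot_stamp (M := M) (val := valOf M e) (w := T.walk) (p := 0)).2 ?_
    · rwa [h0, hl] at this
    intro i hi
    rw [zero_add, hval i hi]
    have hnext : valOf M e (i + 1) = e (finRotate _ ⟨i, hi⟩) := by
      by_cases hi' : i + 1 < T.walk.length
      · rw [hval _ hi']
        congr 1
        exact Fin.ext (by rw [val_finRotate]; simp [hi'])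
      · have : finRotate T.walk.length ⟨i, hi⟩ = ⟨0, hpos⟩ :=
          Fin.ext (by rw [val_finRotate]; simp [hi'])
        rw [this, ← hval, h0]
        simp [valOf, hi']
    rw [hnext]
    by_cases hleaf : (T.walk[i]).1.isLeaf
    · have hr := h.rotation ⟨i, hi⟩
      rw [if_pos (by exact hleaf)] at hr
      simp [Step.turn, hleaf, hr]
    -- `rotation` is applied at the opposite half-edge, whose own opposite is back at position `i`.
    · set j := e.symm (M.α (e ⟨i, hi⟩)) with hj
      have hej : e j = M.α (e ⟨i, hi⟩) := by simp [hj]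
      have hjl : (T.walk.get j).1.isLeaf = (T.walk.get ⟨i, hi⟩).1.isLeaf :=
        hgood.isLeaf_eq M.α_invol hnd (mem_stamp_valOf M T.walk e ⟨i, hi⟩)
          (hej ▸ mem_stamp_valOf M T.walk e j)
      have hr := h.rotation j
      have hjl' : (T.walk.get j).1.isLeaf = false := by
        rw [hjl]
        simpa using hleaf
      rw [hjl', hej, M.α_invol, Equiv.symm_apply_apply] at hr
      simp only [Bool.false_eq_true, if_false] at hr
      rw [← hr]
      simp [Step.turn, hleaf]

theorem ClosureWord.exists_via {T : BTree κ} (hN : T.IsNode) {M : RootedMap D}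
    {W : List (Entry κ D)} (h : ClosureWord T M W) : T.IsClosure M := by
  classical
  have hpos := BTree.length_walk_pos hN
  have hlen : T.walk.length = (W.map Prod.snd).length := by rw [← h.steps]; simp
  set e : Fin T.walk.length ≃ D := (finCongr hlen).trans
    (List.Nodup.getEquivOfForallMemList _ h.nodup h.complete) with he
  have hval : ∀ i (hi : i < T.walk.length), valOf M e i = e ⟨i, hi⟩ := fun i hi => by
    simp [valOf, hi]
  have hW : W = stamp (valOf M e) T.walk 0 := by
    refine list_pair_ext (by rw [h.steps, map_fst_stamp]) ?_
    rw [map_snd_stamp_valOf]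
    refine List.ext_getElem (by simpa using hlen.symm) fun i h1 h2 => ?_
    simp [he]
  have hg := h.good
  have hr := h.rot
  have hnd := h.nodup
  have hmem := mem_stamp_valOf M T.walk e
  rw [hW] at hg hr hnd
  have h0 : valOf M e 0 = M.root := by
    obtain ⟨a, w, haw⟩ := List.exists_cons_of_ne_nil (List.ne_nil_of_length_pos hpos)
    have key : ∀ w' : List (Step × κ), w' = a :: w →
        Rot M M.root (stamp (valOf M e) w' 0) M.root → valOf M e 0 = M.root := by
      rintro _ rfl h
      exact h.1
    exact key _ haw hr
  have hl : valOf M e (0 + T.walk.length) = M.root := by simp [valOf]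
  have hr2 : Rot M (valOf M e 0) (stamp (valOf M e) T.walk 0) (valOf M e (0 + T.walk.length)) := by
    rwa [h0, hl]
  rw [rot_stamp] at hr2
  have hnext : ∀ i : Fin T.walk.length, e (finRotate _ i) =
      M.σ ((T.walk.get i).1.turn M.α (e i)) := by
    intro i
    have h2 := hr2 i.1 i.2
    rw [zero_add, hval _ i.2] at h2
    refine Eq.trans ?_ h2
    by_cases hi' : i.1 + 1 < T.walk.length
    · rw [hval _ hi']
      congr 1
      exact Fin.ext (by rw [val_finRotate]; simp [hi'])
    · have : finRotate T.walk.length i = ⟨0, hpos⟩ :=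
        Fin.ext (by rw [val_finRotate]; simp [hi'])
      rw [this, ← hval, h0]
      simp [valOf, hi']
  refine ⟨e, ?_, ?_, ?_⟩
  · intro i hi
    rw [← h0, hval 0 hpos]
    congr 1
    exact Fin.ext hi
  · intro i j hij
    have := matchedPairs_of_good_stamp (s := []) (b := []) hg hij
    rwa [hval _ i.2, hval _ j.2] at this
  · intro i
    set j := e.symm (M.α (e i)) with hj
    have hej : e j = M.α (e i) := by simp [hj]
    have hjl : (T.walk.get j).1.isLeaf = (T.walk.get i).1.isLeaf :=
      hg.isLeaf_eq M.α_invol hnd (hmem i) (hej ▸ hmem j)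
    by_cases hleaf : (T.walk.get i).1.isLeaf
    · rw [if_pos hleaf, hnext, Step.turn, if_pos hleaf]
    · rw [if_neg hleaf, hnext, Step.turn, hjl, if_neg hleaf, hej, M.α_invol]

/-- Corresponding half-edges of two closures of the same tree. -/
theorem Good.conj {D' : Type} {α : D → D} {α' : D' → D'} (hα : ∀ d, α (α d) = d)
    (hα' : ∀ d, α' (α' d) = d) (g : D → D') {W : List (Entry κ D)} {s b : List D}
    (h : Good α W s b) (h' : Good α' (W.map fun e => (e.1, g e.2)) (s.map g) (b.map g)) :
    ∀ x, x ∈ s ∨ x ∈ b ∨ x ∈ W.map Prod.snd → g (α x) = α' (g x) := by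
  induction W generalizing s b with
  | nil =>
    rw [h.1, h.2]
    simp
  | cons e W ih =>
    obtain ⟨⟨st, l⟩, y⟩ := e
    intro x hx
    simp only [List.map_cons, List.mem_cons] at hx
    cases st with
    | opening =>
      refine ih (s := y :: s) h h' x ?_
      simp only [List.mem_cons]
      tauto
    | closing ι =>
      obtain ⟨z, hz, hy, h⟩ := h
      obtain ⟨z', hz', hy', h'⟩ := h'
      rw [List.getElem?_map, hz, Option.map_some, Option.some.injEq] at hz'
      subst hz'
      rw [List.eraseIdx_map] at h'
      by_cases hxz : x = z
      · rw [hxz, hy, hy']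
      by_cases hxy : x = y
      · rw [hxy, ← hy', ← hy, hα, hα']
      · refine ih h h' x ?_
        rcases hx with hx | hx | hx | hx
        · exact Or.inl (mem_eraseIdx_of_ne hz hx hxz)
        · exact Or.inr (Or.inl hx)
        · exact absurd hx hxy
        · exact Or.inr (Or.inr hx)
    | down =>
      refine ih (b := y :: b) h h' x ?_
      simp only [List.mem_cons]
      tauto
    | up =>
      obtain ⟨z, b1, rfl, hy, h⟩ := h
      obtain ⟨z', b2, hb, hy', h'⟩ := h'
      simp only [List.map_cons, List.cons.injEq] at hb
      obtain ⟨rfl, rfl⟩ := hb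
      by_cases hxz : x = z
      · rw [hxz, hy, hy']
      by_cases hxy : x = y
      · rw [hxy, ← hy', ← hy, hα, hα']
      · refine ih h h' x ?_
        simp only [List.mem_cons] at hx
        tauto

/-- The position in the walk identifies the half-edges. The involutions correspond because the same
stack rule determines both, and then so do the rotations. -/
theorem BTree.IsClosureVia.isIso {D' : Type} {T : BTree κ} (hT : T.IsEnrichedEulerian)
    (hN : T.IsNode) {M : RootedMap D} {M' : RootedMap D'} {e : Fin T.walk.length ≃ D}
    {e' : Fin T.walk.length ≃ D'} (h : T.IsClosureVia M e) (h' : T.IsClosureVia M' e') :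
    RootedMap.IsIso M M' (e.symm.trans e') := by
  have hW := h.closureWord hT hN
  have hW' := h'.closureWord hT hN
  set g := e.symm.trans e' with hg
  have hα : ∀ d, g (M.α d) = M'.α (g d) := by
    intro d
    refine Good.conj M.α_invol M'.α_invol g hW.good ?_ d (Or.inr (Or.inr (hW.complete d)))
    have := hW'.good
    rw [List.map_ofFn]
    simpa [hg, Function.comp_def] using this
  refine ⟨fun d => ?_, hα, ?_⟩
  · obtain ⟨i, rfl⟩ := e.surjective d
    have h1 := hα (e i)
    simp only [hg, Equiv.trans_apply, Equiv.symm_apply_apply] at h1 ⊢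
    rw [h.rotation, h'.rotation, ← h1]
    split_ifs <;> simp
  · have hpos := BTree.length_walk_pos hN
    rw [← h.root_eq ⟨0, hpos⟩ rfl, ← h'.root_eq ⟨0, hpos⟩ rfl]
    simp [hg]

end Closure


/-! ### Existence of the closure of a tree -/

section Construction

variable {κ D : Type}

theorem Good.congr {f g : D → D} {W : List (Entry κ D)} {s b : List D} (h : Good f W s b)
    (hfg : ∀ x, x ∈ s ∨ x ∈ b ∨ x ∈ W.map Prod.snd → f x = g x) : Good g W s b := by
  induction W generalizing s b with
  | nil => exact h
  | cons e W ih =>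
    obtain ⟨⟨st, l⟩, y⟩ := e
    simp only [List.map_cons, List.mem_cons] at hfg
    cases st with
    | opening =>
      refine ih (s := y :: s) h fun x hx => hfg x ?_
      simp only [List.mem_cons] at hx
      tauto
    | closing ι =>
      obtain ⟨z, hz, hy, h⟩ := h
      refine ⟨z, hz, ?_, ih h fun x hx => hfg x ?_⟩
      · rw [← hfg z (Or.inl (List.mem_of_getElem? hz)), hy]
      · rcases hx with hx | hx | hx
        · exact Or.inl (List.mem_of_mem_eraseIdx hx)
        · tauto
        · tauto
    | down =>
      refine ih (b := y :: b) h fun x hx => hfg x ?_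
      simp only [List.mem_cons] at hx
      tauto
    | up =>
      obtain ⟨z, b1, rfl, hy, h⟩ := h
      refine ⟨z, b1, rfl, ?_, ih h fun x hx => hfg x ?_⟩
      · rw [← hfg z (by simp), hy]
      · simp only [List.mem_cons]
        tauto

theorem exists_mul_swap [DecidableEq D] {f : Equiv.Perm D} (hf : ∀ d, f (f d) = d) {x y : D}
    (hx : f x = x) (hy : f y = y) :
    ∃ g : Equiv.Perm D, (∀ d, g (g d) = d) ∧ g x = y ∧ g y = x ∧
      ∀ z, z ≠ x → z ≠ y → g z = f z := by
  have h1 : ∀ z, z ≠ x → z ≠ y → (f * Equiv.swap x y) z = f z := fun z hzx hzy => by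
    simp [Equiv.swap_apply_of_ne_of_ne hzx hzy]
  have h2 : (f * Equiv.swap x y) x = y := by simp [hy]
  have h3 : (f * Equiv.swap x y) y = x := by simp [hx]
  refine ⟨f * Equiv.swap x y, fun d => ?_, h2, h3, h1⟩
  by_cases hdx : d = x
  · rw [hdx, h2, h3]
  by_cases hdy : d = y
  · rw [hdy, h3, h2]
  rw [h1 d hdx hdy, h1, hf]
  · intro h
    exact hdx (by rw [← hf d, h, hx])
  · intro h
    exact hdy (by rw [← hf d, h, hy])

/-- Matching the letters of a word. -/
theorem exists_perm_good [DecidableEq D] {W : List (Entry κ D)} {s b : List D}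
    (hnd : (W.map Prod.snd ++ (s ++ b)).Nodup)
    (h1 : BTree.ValidIndices s.length (W.filterMap fun e => e.1.1.code))
    (h2 : (W.filterMap fun e => e.1.1.code).countP (·.isSome) =
      s.length + (W.filterMap fun e => e.1.1.code).countP (·.isNone))
    (h3 : DownUp (W.map Prod.fst) b.length) :
    ∃ f : Equiv.Perm D, (∀ d, f (f d) = d) ∧
      (∀ d, f d ≠ d ↔ d ∈ W.map Prod.snd ++ (s ++ b)) ∧ Good f W s b := by
  induction W generalizing s b with
  | nil =>
    simp only [List.filterMap_nil, List.countP_nil, add_zero] at h2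
    obtain rfl := List.eq_nil_of_length_eq_zero h2.symm
    obtain rfl := List.eq_nil_of_length_eq_zero h3
    exact ⟨1, by simp, by simp, rfl, rfl⟩
  | cons e W ih =>
    obtain ⟨⟨st, l⟩, x⟩ := e
    simp only [List.map_cons, List.cons_append] at hnd
    have hx := (List.nodup_cons.1 hnd).1
    have hnd' := (List.nodup_cons.1 hnd).2
    cases st with
    | opening =>
      rw [List.filterMap_cons_some (b := none) (by rfl)] at h1 h2
      have hp : (W.map Prod.snd ++ (x :: s ++ b)).Perm (x :: (W.map Prod.snd ++ (s ++ b))) :=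
        List.perm_middle
      obtain ⟨f, hf1, hf2, hf3⟩ := ih (s := x :: s) (b := b) (hp.nodup_iff.2 hnd) h1 (by
        simp at h2 ⊢
        omega) h3
      exact ⟨f, hf1, fun d => (hf2 d).trans hp.mem_iff, hf3⟩
    | down =>
      rw [List.filterMap_cons_none (by rfl)] at h1 h2
      have hp : (W.map Prod.snd ++ (s ++ x :: b)).Perm (x :: (W.map Prod.snd ++ (s ++ b))) := by
        rw [← List.append_assoc, ← List.append_assoc]
        exact List.perm_middle
      obtain ⟨f, hf1, hf2, hf3⟩ := ih (s := s) (b := x :: b) (hp.nodup_iff.2 hnd) h1 h2 h3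
      exact ⟨f, hf1, fun d => (hf2 d).trans hp.mem_iff, hf3⟩
    | closing ι =>
      rw [List.filterMap_cons_some (b := some ι) (by rfl)] at h1 h2
      obtain ⟨hι, h1⟩ := h1
      have hp : (W.map Prod.snd ++ (s ++ b)).Perm
          (s[ι] :: (W.map Prod.snd ++ (s.eraseIdx ι ++ b))) := by
        refine List.Perm.trans ?_ List.perm_middle
        exact ((List.getElem_cons_eraseIdx_perm hι).symm.append_right b).append_left _
      have hy := (List.nodup_cons.1 (hp.nodup_iff.1 hnd')).1
      have hl : (s.eraseIdx ι).length = s.length - 1 := List.length_eraseIdx_of_lt hι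
      obtain ⟨f, hf1, hf2, hf3⟩ := ih (s := s.eraseIdx ι) (b := b)
        (List.nodup_cons.1 (hp.nodup_iff.1 hnd')).2 (by rwa [hl])
        (by simp at h2; omega) h3
      -- The involution obtained for the rest of the word moves neither `x` nor `s[ι]`, so composing
      -- it with their transposition gives an involution again.
      have hxy : x ≠ s[ι] := fun h => hx (by rw [h]; simp)
      have hfx : f x = x := by
        by_contra h
        exact hx (hp.mem_iff.2 (List.mem_cons_of_mem _ ((hf2 x).1 h)))
      have hfy : f s[ι] = s[ι] := by
        by_contra h
        exact hy ((hf2 _).1 h)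
      obtain ⟨g, hg1, hgx, hgy, hg⟩ := exists_mul_swap hf1 hfx hfy
      refine ⟨g, hg1, fun d => ?_, s[ι], by simp, hgy, hf3.congr fun z hz => ?_⟩
      · simp only [List.map_cons, List.cons_append, List.mem_cons]
        rw [hp.mem_iff, List.mem_cons, ← hf2 d]
        by_cases hdx : d = x
        · simp [hdx, hgx, hxy.symm]
        by_cases hdy : d = s[ι]
        · rw [hdy, hgy]
          simp [hxy]
        · simp [hdx, hdy, hg d hdx hdy]
      · have hz' : z ∈ W.map Prod.snd ++ (s.eraseIdx ι ++ b) := by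
          simp only [List.mem_append]
          tauto
        refine (hg z ?_ ?_).symm
        · rintro rfl
          exact hx (hp.mem_iff.2 (List.mem_cons_of_mem _ hz'))
        · rintro rfl
          exact hy hz'
    | up =>
      rw [List.filterMap_cons_none (by rfl)] at h1 h2
      cases b with
      | nil => exact absurd h3.1 (by simp)
      | cons y b =>
        have hp : (W.map Prod.snd ++ (s ++ y :: b)).Perm (y :: (W.map Prod.snd ++ (s ++ b))) := by
          rw [← List.append_assoc, ← List.append_assoc]
          exact List.perm_middle
        have hy := (List.nodup_cons.1 (hp.nodup_iff.1 hnd')).1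
        obtain ⟨f, hf1, hf2, hf3⟩ := ih (s := s) (b := b)
          (List.nodup_cons.1 (hp.nodup_iff.1 hnd')).2 h1 h2 h3.2
        have hxy : x ≠ y := fun h => hx (by rw [h]; simp)
        have hfx : f x = x := by
          by_contra h
          exact hx (hp.mem_iff.2 (List.mem_cons_of_mem _ ((hf2 x).1 h)))
        have hfy : f y = y := by
          by_contra h
          exact hy ((hf2 _).1 h)
        obtain ⟨g, hg1, hgx, hgy, hg⟩ := exists_mul_swap hf1 hfx hfy
        refine ⟨g, hg1, fun d => ?_, y, b, rfl, hgy, hf3.congr fun z hz => ?_⟩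
        · simp only [List.map_cons, List.cons_append, List.mem_cons]
          rw [hp.mem_iff, List.mem_cons, ← hf2 d]
          by_cases hdx : d = x
          · simp [hdx, hgx, hxy.symm]
          by_cases hdy : d = y
          · rw [hdy, hgy]
            simp [hxy]
          · simp [hdx, hdy, hg d hdx hdy]
        · have hz' : z ∈ W.map Prod.snd ++ (s ++ b) := by
            simp only [List.mem_append]
            tauto
          refine (hg z ?_ ?_).symm
          · rintro rfl
            exact hx (hp.mem_iff.2 (List.mem_cons_of_mem _ hz'))
          · rintro rfl
            exact hy hz'

theorem exists_good_walk {T : BTree κ} (hT : T.IsEnrichedEulerian) (hN : T.IsNode)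
    (e : Fin T.walk.length ≃ D) : ∃ f : Equiv.Perm D, (∀ d, f (f d) = d) ∧ (∀ d, f d ≠ d) ∧
      Good f (List.ofFn fun i => (T.walk.get i, e i)) [] [] := by
  classical
  have h1 : (List.ofFn fun i => (T.walk.get i, e i)).map Prod.fst = T.walk := by
    rw [List.map_ofFn]
    exact List.ofFn_get _
  have h2 : (List.ofFn fun i => (T.walk.get i, e i)).map Prod.snd = List.ofFn e := by
    rw [List.map_ofFn]
    rfl
  have h3 : (List.ofFn fun i => (T.walk.get i, e i)).filterMap (fun e => e.1.1.code) =
      T.walk.filterMap fun e => e.1.code := by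
    conv_rhs => rw [← h1, List.filterMap_map]
    rfl
  cases T with
  | opening => exact hN.elim
  | closing ι => exact hN.elim
  | node x n child =>
    have hc := hT.countP_walk
    obtain ⟨f, hf1, hf2, hf3⟩ := exists_perm_good (s := []) (b := [])
      (W := List.ofFn fun i => ((BTree.node x n child).walk.get i, e i))
      (by rw [h2]; simpa using List.nodup_ofFn.2 e.injective) (by rw [h3]; exact hc.1)
      (by rw [h3]; simpa using hc.2)
      (by rw [h1, BTree.walk_node]; exact BTree.downUp_flatten x _)
    refine ⟨f, hf1, fun d => ?_, hf3⟩
    rw [hf2, h2]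
    simpa using ⟨e.symm d, by simp⟩

/-- The matching is a fixed-point-free involution of the positions. -/
theorem BTree.even_length_walk {T : BTree κ} (hT : T.IsEnrichedEulerian) (hN : T.IsNode) :
    ∃ E, T.walk.length = 2 * E := by
  obtain ⟨f, hf1, hf2, -⟩ := exists_good_walk hT hN (Equiv.refl _)
  have h1 : f ^ 2 = 1 := by
    ext d
    simp [sq, hf1]
  have h2 := Equiv.Perm.two_dvd_card_support h1
  have h3 : f.support = Finset.univ := by
    ext d
    simp [hf2]
  rw [h3, Finset.card_univ, Fintype.card_fin] at h2
  exact h2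

/-- The rotation is imposed by the walk: it is the cyclic shift of positions preceded by the turn
`τ`, which crosses the edges between nodes and fixes the half-edges leading to leaves. -/
theorem BTree.exists_isClosureVia {T : BTree κ} (hT : T.IsEnrichedEulerian) (hN : T.IsNode)
    (e : Fin T.walk.length ≃ D) : ∃ M : RootedMap D, T.IsClosureVia M e := by
  obtain ⟨α, hα1, hα2, hgood⟩ := exists_good_walk hT hN e
  have hpos := BTree.length_walk_pos hN
  have hnd : ((List.ofFn fun i => (T.walk.get i, e i)).map Prod.snd).Nodup := by
    rw [List.map_ofFn]
    exact List.nodup_ofFn.2 e.injective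
  have hmem : ∀ d, (T.walk.get (e.symm d), d) ∈ List.ofFn fun i => (T.walk.get i, e i) := by
    intro d
    rw [List.mem_ofFn]
    exact ⟨e.symm d, by simp⟩
  have hleaf : ∀ d, (T.walk.get (e.symm (α d))).1.isLeaf = (T.walk.get (e.symm d)).1.isLeaf :=
    fun d => hgood.isLeaf_eq hα1 hnd (hmem d) (hmem (α d))
  set τ : D → D := fun d => (T.walk.get (e.symm d)).1.turn α d with hτ
  have hτ1 : Function.Involutive τ := by
    intro d
    by_cases h : (T.walk.get (e.symm d)).1.isLeaf
    · have : τ d = d := by simp only [hτ, Step.turn, if_pos h]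
      rw [this, this]
    · have h1 : τ d = α d := by simp only [hτ, Step.turn, if_neg h]
      have h2 : τ (α d) = d := by simp only [hτ, Step.turn, hleaf, if_neg h, hα1]
      rw [h1, h2]
  set σ : Equiv.Perm D := hτ1.toPerm.trans ((e.symm.trans (finRotate _)).trans e) with hσ
  have hσd : ∀ d, σ d = e (finRotate _ (e.symm (τ d))) := fun d => rfl
  -- The next position of the walk is reached by `σ` at a leaf and by `σ * α` otherwise, so every
  -- half-edge is reached from the first one.
  have hconn : ∀ d d', ∃ x ∈ Subgroup.closure ({σ, α} : Set (Equiv.Perm D)), x d = d' := by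
    have hstep : ∀ d, ∃ x ∈ Subgroup.closure ({σ, α} : Set (Equiv.Perm D)),
        x d = e (finRotate _ (e.symm d)) := by
      intro d
      have h1 : σ (τ d) = e (finRotate _ (e.symm d)) := by rw [hσd, hτ1]
      by_cases h : (T.walk.get (e.symm d)).1.isLeaf
      · refine ⟨σ, Subgroup.subset_closure (by simp), ?_⟩
        rw [← h1]
        simp only [hτ, Step.turn, if_pos h]
      · refine ⟨σ * α, Subgroup.mul_mem _ (Subgroup.subset_closure (by simp))
          (Subgroup.subset_closure (by simp)), ?_⟩
        rw [← h1]
        simp only [hτ, Step.turn, if_neg h, Equiv.Perm.mul_apply]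
    have h0 : ∀ i (hi : i < T.walk.length),
        ∃ x ∈ Subgroup.closure ({σ, α} : Set (Equiv.Perm D)), x (e ⟨0, hpos⟩) = e ⟨i, hi⟩ := by
      intro i
      induction i with
      | zero => exact fun _ => ⟨1, Subgroup.one_mem _, rfl⟩
      | succ i ih =>
        intro hi
        obtain ⟨x, hx, hx0⟩ := ih (by omega)
        obtain ⟨y, hy, hy0⟩ := hstep (e ⟨i, by omega⟩)
        refine ⟨y * x, Subgroup.mul_mem _ hy hx, ?_⟩
        rw [Equiv.Perm.mul_apply, hx0, hy0]
        congr 1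
        refine Fin.ext ?_
        rw [val_finRotate]
        simp [hi]
    intro d d'
    obtain ⟨x, hx, hx0⟩ := h0 (e.symm d).1 (e.symm d).2
    obtain ⟨y, hy, hy0⟩ := h0 (e.symm d').1 (e.symm d').2
    simp only [Fin.eta, Equiv.apply_symm_apply] at hx0 hy0
    refine ⟨y * x⁻¹, Subgroup.mul_mem _ hy (Subgroup.inv_mem _ hx), ?_⟩
    simp [← hx0, hy0]
  let M : RootedMap D := ⟨σ, α, e ⟨0, hpos⟩, hα1, hα2, hconn⟩
  refine ⟨M, ?_, ?_, ?_⟩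
  · rintro ⟨i, hi⟩ rfl
    rfl
  · intro i j hij
    have hg : Good M.α (stamp (valOf M e) T.walk 0) [] [] := by
      rw [stamp_valOf_eq_ofFn]
      exact hgood
    have := matchedPairs_of_good_stamp (s := []) (b := []) hg hij
    simpa [valOf] using this
  · intro i
    change σ (e i) = _
    rw [hσd]
    simp only [hτ, Step.turn, Equiv.symm_apply_apply]
    split_ifs <;> simp [M]

end Construction


/-! ### The vertices of the closure of a tree -/

/-- The nodes of a tree, each with its label and its degree. -/
def BTree.nodeData {κ : Type} : BTree κ → List (κ × ℕ)
  | opening => []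
  | closing _ => []
  | node x n child => (x, n + 1) :: (List.ofFn fun j => (child j).nodeData).flatten

theorem BTree.nodeData_node {κ : Type} (x : κ) (n : ℕ) (child : Fin n → BTree κ) :
    nodeData (node x n child) = (x, n + 1) :: ((List.ofFn child).map nodeData).flatten := by
  simp [nodeData, List.map_ofFn, Function.comp_def]

/-- The list of the elements of a cycle of `f`. -/
def IsOrbitList {D : Type} (f : Equiv.Perm D) (l : List D) : Prop :=
  l ≠ [] ∧ ∃ a, l = (List.range l.length).map (fun i => (f ^ i) a) ∧ (f ^ l.length) a = a

theorem IsOrbitList.mem_iff {D : Type} {f : Equiv.Perm D} {l : List D} (h : IsOrbitList f l)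
    {x y : D} (hx : x ∈ l) : y ∈ l ↔ f.SameCycle x y := by
  obtain ⟨hne, a, hl, ha⟩ := h
  have hpos : (0 : ℤ) < l.length := by exact_mod_cast List.length_pos_iff.2 hne
  have hmem : ∀ z, z ∈ l ↔ f.SameCycle a z := by
    intro z
    rw [hl]
    constructor
    · intro hz
      obtain ⟨i, -, rfl⟩ := List.mem_map.1 hz
      exact ⟨i, by simp⟩
    · rintro ⟨k, rfl⟩
      have h1 := Int.emod_add_mul_ediv k l.length
      have h2 := Int.emod_nonneg k hpos.ne'
      have h3 := Int.emod_lt_of_pos k hpos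
      obtain ⟨i, hi⟩ := Int.eq_ofNat_of_zero_le h2
      rw [hi] at h1 h3
      refine List.mem_map.2 ⟨i, by simpa using h3, ?_⟩
      rw [← h1, zpow_add, zpow_mul, Equiv.Perm.mul_apply, zpow_natCast, zpow_natCast,
        Equiv.Perm.zpow_apply_eq_self_of_apply_eq_self ha]
  rw [hmem] at hx ⊢
  exact ⟨fun hy => hx.symm.trans hy, fun hy => hx.trans hy⟩

section Groups

variable {κ D : Type}

/-- The entries of the half-edges at a node of label `g.1`. -/
def groupEntries (g : κ × List (Step × D)) : List (Entry κ D) :=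
  g.2.map fun e => ((e.1, g.1), e.2)

/-- The half-edges are grouped according to the nodes with the given list of labels and degrees;
if the nodes are Eulerian, there are as many outgoing as ingoing half-edges in each group. -/
structure GroupsOf (M : RootedMap D) (nd : List (κ × ℕ)) (eul : Prop)
    (Gs : List (κ × List (Step × D))) : Prop where
  data : Gs.map (fun g => (g.1, g.2.length)) = nd
  orbit : ∀ g ∈ Gs, IsOrbitList M.σ (g.2.map Prod.snd)
  sum_sgn : eul → ∀ g ∈ Gs, (g.2.map fun e => e.1.sgn).sum = 0

theorem GroupsOf.cons {M : RootedMap D} {nd : List (κ × ℕ)} {eul eul' : Prop}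
    {Gs : List (κ × List (Step × D))} (h : GroupsOf M nd eul Gs) {x : κ} {g : List (Step × D)}
    (hg : IsOrbitList M.σ (g.map Prod.snd)) (h1 : eul' → eul)
    (h2 : eul' → (g.map fun e => e.1.sgn).sum = 0) :
    GroupsOf M ((x, g.length) :: nd) eul' ((x, g) :: Gs) where
  data := by simp [h.data]
  orbit := by simpa using ⟨hg, fun a b hab => h.orbit _ hab⟩
  sum_sgn he := by simpa using ⟨h2 he, fun a b hab => h.sum_sgn (h1 he) _ hab⟩

theorem GroupsOf.append {M : RootedMap D} {nd nd' : List (κ × ℕ)} {eul eul' eul'' : Prop}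
    {Gs Gs' : List (κ × List (Step × D))} (h : GroupsOf M nd eul Gs)
    (h' : GroupsOf M nd' eul' Gs') (h1 : eul'' → eul) (h2 : eul'' → eul') :
    GroupsOf M (nd ++ nd') eul'' (Gs ++ Gs') where
  data := by simp [h.data, h'.data]
  orbit g hg := (List.mem_append.1 hg).elim (h.orbit g) (h'.orbit g)
  sum_sgn he g hg := (List.mem_append.1 hg).elim (h.sum_sgn (h1 he) g) (h'.sum_sgn (h2 he) g)

/-- `hts` is the induction hypothesis of `walkFrom_groups`. After the tree attached at `d` the walk
resumes at `σ d`, so the half-edges at the common parent are `c, σ c, …`, one for each tree. -/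
theorem forest_groups {M : RootedMap D} (ts : List (BTree κ))
    (hts : ∀ t ∈ ts, ∀ (p : κ) (d : D) (W R : List (Entry κ D)) (z : D) (s b : List D),
      W.map Prod.fst = t.walkFrom p → Rot M d (W ++ R) z → Good M.α (W ++ R) s b →
      Rot M (M.σ d) R z ∧ (∃ s', Good M.α R s' b) ∧
      (∃ st : Step, st.sgn = (if t.isOpening then 1 else -1) ∧
        ∃ Gs, W.Perm (((st, p), d) :: Gs.flatMap groupEntries) ∧
          GroupsOf M t.nodeData t.NodesEulerian Gs) ∧
      ∀ l x, ((Step.down, l), x) ∈ W → M.α x ∈ W.map Prod.snd)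
    (p : κ) (c : D) (W R : List (Entry κ D)) (z : D) (s b : List D)
    (h1 : W.map Prod.fst = (ts.map (BTree.walkFrom p)).flatten) (h2 : Rot M c (W ++ R) z)
    (h3 : Good M.α (W ++ R) s b) :
    Rot M ((M.σ ^ ts.length) c) R z ∧ (∃ s', Good M.α R s' b) ∧
      (∃ hs : List (Step × D), hs.map Prod.snd = (List.range ts.length).map (fun i => (M.σ ^ i) c) ∧
        (hs.map fun e => e.1.sgn).sum = 2 * ts.countP BTree.isOpening - ts.length ∧
        ∃ Gs, W.Perm (groupEntries (p, hs) ++ Gs.flatMap groupEntries) ∧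
          GroupsOf M (ts.map BTree.nodeData).flatten (∀ t ∈ ts, t.NodesEulerian) Gs) ∧
      ∀ l x, ((Step.down, l), x) ∈ W → M.α x ∈ W.map Prod.snd := by
  induction ts generalizing c W s with
  | nil =>
    simp only [List.map_nil, List.flatten_nil, List.map_eq_nil_iff] at h1
    subst h1
    exact ⟨h2, ⟨s, h3⟩, ⟨[], rfl, rfl, [], List.Perm.refl _, rfl, by simp, by simp⟩, by simp⟩
  | cons t ts ih =>
    rw [List.map_cons, List.flatten_cons, List.map_eq_append_iff] at h1
    obtain ⟨W1, W2, rfl, h1, h1'⟩ := h1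
    rw [List.append_assoc] at h2 h3
    obtain ⟨r1, ⟨s1, g1⟩, ⟨st, hst, G1, p1, q1⟩, u1⟩ :=
      hts t (by simp) p c W1 (W2 ++ R) z s b h1 h2 h3
    obtain ⟨r2, ⟨s2, g2⟩, ⟨hs, hs1, hs2, G2, p2, q2⟩, u2⟩ :=
      ih (fun t ht => hts t (List.mem_cons_of_mem _ ht)) (M.σ c) W2 s1 h1' r1 g1
    refine ⟨?_, ⟨s2, g2⟩, ⟨(st, c) :: hs, ?_, ?_, G1 ++ G2, ?_, ?_⟩, ?_⟩
    · rw [List.length_cons, pow_succ]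
      exact r2
    · rw [List.map_cons, hs1, List.length_cons, List.range_succ_eq_map, List.map_cons,
        List.map_map]
      simp [Function.comp_def, pow_succ]
    · rw [List.map_cons, List.sum_cons, hs2, hst, List.countP_cons, List.length_cons]
      push_cast
      split_ifs <;> ring
    · refine (p1.append p2).trans ?_
      simp only [groupEntries, List.map_cons, List.cons_append, List.flatMap_append]
      refine List.Perm.cons _ ?_
      rw [← List.append_assoc, ← List.append_assoc]
      exact List.perm_append_comm.append_right _
    · rw [List.map_cons, List.flatten_cons]
      exact q1.append q2 (fun h => h t (by simp)) fun h t ht => h t (List.mem_cons_of_mem _ ht)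
    · intro l x hx
      rw [List.map_append, List.mem_append]
      exact (List.mem_append.1 hx).imp (u1 l x) (u2 l x)

/-- A subtree contributes one half-edge `d` at its parent, plus complete `σ`-orbits, one for each of
its nodes. The last conjunct, that edges between nodes stay within the subtree once entered, serves
for the uniqueness of the tree. -/
theorem walkFrom_groups {M : RootedMap D} (t : BTree κ) (p : κ) (d : D)
    (W R : List (Entry κ D)) (z : D) (s b : List D)
    (h1 : W.map Prod.fst = t.walkFrom p) (h2 : Rot M d (W ++ R) z) (h3 : Good M.α (W ++ R) s b) :
    Rot M (M.σ d) R z ∧ (∃ s', Good M.α R s' b) ∧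
      (∃ st : Step, st.sgn = (if t.isOpening then 1 else -1) ∧
        ∃ Gs, W.Perm (((st, p), d) :: Gs.flatMap groupEntries) ∧
          GroupsOf M t.nodeData t.NodesEulerian Gs) ∧
      ∀ l x, ((Step.down, l), x) ∈ W → M.α x ∈ W.map Prod.snd := by
  induction t generalizing p d W R z s b with
  | opening =>
    simp only [BTree.walkFrom, List.map_eq_singleton_iff] at h1
    obtain ⟨⟨a, y⟩, rfl, rfl⟩ := h1
    obtain ⟨rfl, h2⟩ := h2
    exact ⟨h2, ⟨_, h3⟩, ⟨_, rfl, [], List.Perm.refl _, rfl, by simp, by simp⟩, by simp⟩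
  | closing ι =>
    simp only [BTree.walkFrom, List.map_eq_singleton_iff] at h1
    obtain ⟨⟨a, y⟩, rfl, rfl⟩ := h1
    obtain ⟨rfl, h2⟩ := h2
    obtain ⟨y, -, -, h3⟩ := h3
    exact ⟨h2, ⟨_, h3⟩, ⟨_, rfl, [], List.Perm.refl _, rfl, by simp, by simp⟩, by simp⟩
  | node x n child ih =>
    rw [BTree.walkFrom_node, List.map_eq_cons_iff] at h1
    obtain ⟨⟨a, y⟩, W', rfl, rfl, h1⟩ := h1
    rw [List.map_eq_append_iff] at h1
    obtain ⟨W1, W2, rfl, h1, h1'⟩ := h1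
    simp only [List.map_eq_singleton_iff] at h1'
    obtain ⟨⟨a', y'⟩, rfl, rfl⟩ := h1'
    rw [List.cons_append, List.append_assoc] at h2 h3
    obtain ⟨rfl, h2⟩ := h2
    obtain ⟨r1, ⟨s1, g1⟩, ⟨hs, hs1, hs2, Gs, p1, q1⟩, u1⟩ := forest_groups (List.ofFn child)
      ((List.forall_mem_ofFn_iff).2 ih) x _ W1 _ z s (y :: b) h1 h2 h3
    obtain ⟨h4, r1⟩ := r1
    obtain ⟨w, b', hb, hw, g1⟩ := g1
    obtain ⟨rfl, rfl⟩ := List.cons.inj hb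
    dsimp only at hw h4
    have h4' : y' = (M.σ ^ n) (M.σ (M.α y)) := by
      simpa [Step.turn, Step.isLeaf] using h4
    -- Rotating from `α y` past the `n` children leads to the upward half-edge `y'`, which the
    -- matching identifies with `α y`: the orbit is closed.
    have h5 : (M.σ ^ (n + 1)) (M.α y) = M.α y := by
      rw [pow_succ, Equiv.Perm.mul_apply, ← h4', hw]
    have hlen : hs.length = n := by simpa using congrArg List.length hs1
    have hcons : ((x, n + 1) : κ × ℕ) = (x, ((Step.up, M.α y) :: hs).length) := by
      rw [List.length_cons, hlen]
    refine ⟨?_, ⟨s1, g1⟩, ⟨Step.down, rfl, (x, (Step.up, M.α y) :: hs) :: Gs, ?_, ?_⟩, ?_⟩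
    · rw [← hw] at r1
      simpa [Step.turn, Step.isLeaf, M.α_invol] using r1
    · refine List.Perm.cons _ ?_
      rw [hw]
      refine List.perm_append_comm.trans ?_
      exact List.Perm.cons _ p1
    · rw [BTree.nodeData_node, hcons]
      refine q1.cons ⟨by simp, M.α y, ?_, ?_⟩ ?_ ?_
      · rw [List.map_cons, List.length_cons, List.range_succ_eq_map, List.map_cons, List.map_map,
          hs1]
        simp [Function.comp_def, pow_succ, Step.turn, Step.isLeaf]
      · rw [List.length_map, List.length_cons, hlen, h5]
      · intro h
        exact ((BTree.nodesEulerian_node x n child).1 h).2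
      · intro h
        obtain ⟨⟨k, hk, hc⟩, -⟩ := (BTree.nodesEulerian_node x n child).1 h
        rw [List.map_cons, List.sum_cons, hs2, List.length_ofFn]
        simp only [Step.sgn]
        -- The upward half-edge counts `1` and the `2k - 1` children contribute `2(k - 1) - (2k - 1)
        -- = -1`.
        omega
    · intro l w hw'
      simp only [List.mem_cons, List.mem_append, Prod.mk.injEq, List.not_mem_nil, or_false] at hw'
      simp only [List.map_cons, List.map_append, List.mem_cons, List.mem_append, List.map_nil]
      rcases hw' with ⟨-, rfl⟩ | hw' | ⟨hw', -⟩
      · exact Or.inr (Or.inr (Or.inl hw))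
      · exact Or.inr (Or.inl (u1 l w hw'))
      · simp at hw'

theorem ClosureWord.groups {T : BTree κ} (hN : T.IsNode) {M : RootedMap D}
    {W : List (Entry κ D)} (h : ClosureWord T M W) :
    ∃ Gs, W.Perm (Gs.flatMap groupEntries) ∧ GroupsOf M T.nodeData T.NodesEulerian Gs := by
  cases T with
  | opening => exact hN.elim
  | closing ι => exact hN.elim
  | node x n child =>
    have h1 := h.steps
    have h2 := h.rot
    have h3 := h.good
    rw [BTree.walk_node, List.map_eq_cons_iff] at h1
    obtain ⟨⟨a, y⟩, W1, rfl, rfl, h1⟩ := h1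
    obtain ⟨h4, h2⟩ := h2
    dsimp only at h4
    subst h4
    rw [← List.append_nil W1] at h2
    obtain ⟨r1, -, ⟨hs, hs1, hs2, Gs, p1, q1⟩, u1⟩ := forest_groups (List.ofFn child)
      (fun t _ => walkFrom_groups t) x _ W1 [] _ [M.root] [] h1 h2 (by rw [List.append_nil]; exact h3)
    have hlen : hs.length = n := by simpa using congrArg List.length hs1
    have hcons : ((x, n + 1) : κ × ℕ) = (x, ((Step.opening, M.root) :: hs).length) := by
      rw [List.length_cons, hlen]
    refine ⟨(x, (Step.opening, M.root) :: hs) :: Gs, List.Perm.cons _ p1, ?_⟩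
    rw [BTree.nodeData_node, hcons]
    refine q1.cons ⟨by simp, M.root, ?_, ?_⟩ ?_ ?_
    · rw [List.map_cons, List.length_cons, List.range_succ_eq_map, List.map_cons, List.map_map,
        hs1]
      simp [Function.comp_def, pow_succ, Step.turn, Step.isLeaf]
    · rw [List.length_map, List.length_cons, hlen]
      have : (M.σ ^ n) (M.σ M.root) = M.root := by
        simpa [Rot, Step.turn, Step.isLeaf] using r1
      rw [pow_succ, Equiv.Perm.mul_apply, this]
    · intro h
      exact ((BTree.nodesEulerian_node x n child).1 h).2
    · intro h
      obtain ⟨⟨k, hk, hc⟩, -⟩ := (BTree.nodesEulerian_node x n child).1 h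
      rw [List.map_cons, List.sum_cons, hs2, List.length_ofFn]
      simp only [Step.sgn]
      omega

end Groups


/-! ### Degrees, weights and orientation of a closure -/

section Vertices

variable {κ D : Type}

theorem map_snd_flatMap_groupEntries (Gs : List (κ × List (Step × D))) :
    (Gs.flatMap groupEntries).map Prod.snd = Gs.flatMap fun g => g.2.map Prod.snd := by
  rw [List.map_flatMap]
  simp [groupEntries, Function.comp_def]

theorem RootedMap.vertexOf_eq_iff {M : RootedMap D} {x y : D} :
    M.vertexOf x = M.vertexOf y ↔ M.σ.SameCycle x y :=
  Quotient.eq (r := Equiv.Perm.SameCycle.setoid M.σ)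

/-- The groups of half-edges are the vertices. -/
theorem ClosureWord.exists_vertexEquiv {T : BTree κ} (hN : T.IsNode) {M : RootedMap D}
    {W : List (Entry κ D)} (h : ClosureWord T M W) :
    ∃ Gs, W.Perm (Gs.flatMap groupEntries) ∧ GroupsOf M T.nodeData T.NodesEulerian Gs ∧
      ∃ φ : Fin Gs.length ≃ M.Vertex,
        ∀ i x, M.vertexOf x = φ i ↔ x ∈ (Gs[i].2.map Prod.snd) := by
  obtain ⟨Gs, h1, h2⟩ := h.groups hN
  refine ⟨Gs, h1, h2, ?_⟩
  have hp := h1.map Prod.snd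
  rw [map_snd_flatMap_groupEntries] at hp
  have hnd := List.nodup_flatMap.1 (hp.nodup_iff.1 h.nodup)
  have hdisj := List.pairwise_iff_getElem.1 hnd.2
  have horb : ∀ i : Fin Gs.length, IsOrbitList M.σ (Gs[i].2.map Prod.snd) :=
    fun i => h2.orbit _ (List.getElem_mem i.2)
  have hex : ∀ i : Fin Gs.length, ∃ x, x ∈ Gs[i].2.map Prod.snd :=
    fun i => List.exists_mem_of_ne_nil _ (horb i).1
  choose rep hrep using hex
  have hiff : ∀ i x, M.vertexOf x = M.vertexOf (rep i) ↔ x ∈ (Gs[i].2.map Prod.snd) := by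
    intro i x
    rw [(horb i).mem_iff (hrep i), RootedMap.vertexOf_eq_iff]
    exact Equiv.Perm.sameCycle_comm
  have hinj : ∀ (i j : Fin Gs.length) x, x ∈ (Gs[i].2.map Prod.snd) →
      x ∈ (Gs[j].2.map Prod.snd) → i = j := by
    intro i j x hi hj
    by_contra hne
    rcases lt_or_gt_of_ne hne with hij | hij
    · exact hdisj i j i.2 j.2 hij hi hj
    · exact hdisj j i j.2 i.2 hij hj hi
  refine ⟨Equiv.ofBijective (fun i => M.vertexOf (rep i)) ⟨fun i j hij => ?_, fun v => ?_⟩, hiff⟩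
  · exact hinj i j (rep j) ((hiff i _).1 hij.symm) (hrep j)
  · obtain ⟨x, rfl⟩ := Quotient.exists_rep v
    obtain ⟨g, hg, hx⟩ := List.mem_flatMap.1 (hp.mem_iff.1 (h.complete x))
    obtain ⟨i, hi, rfl⟩ := List.getElem_of_mem hg
    exact ⟨⟨i, hi⟩, ((hiff ⟨i, hi⟩ x).2 hx).symm⟩

/-- The vertices are the nodes, with their degrees. -/
theorem ClosureWord.exists_vertexEquiv_deg {T : BTree κ} (hN : T.IsNode) {M : RootedMap D}
    {W : List (Entry κ D)} (h : ClosureWord T M W) :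
    ∃ φ : Fin T.nodeData.length ≃ M.Vertex, (∀ i, M.deg (φ i) = (T.nodeData[i]).2) ∧
      (∀ i st l x, ((st, l), x) ∈ W → M.vertexOf x = φ i → l = (T.nodeData[i]).1) := by
  obtain ⟨Gs, h1, h2, φ, hφ⟩ := h.exists_vertexEquiv hN
  have hlen : T.nodeData.length = Gs.length := by rw [← h2.data, List.length_map]
  have hdata : ∀ i : Fin T.nodeData.length, T.nodeData[i] =
      ((Gs[finCongr hlen i]).1, (Gs[finCongr hlen i]).2.length) := by
    intro i
    simp [← h2.data]
  have hnd : ∀ i : Fin Gs.length, (Gs[i].2.map Prod.snd).Nodup := by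
    have hp := h1.map Prod.snd
    rw [map_snd_flatMap_groupEntries] at hp
    exact fun i => (List.nodup_flatMap.1 (hp.nodup_iff.1 h.nodup)).1 _ (List.getElem_mem i.2)
  refine ⟨(finCongr hlen).trans φ, fun i => ?_, fun i st l x hx hv => ?_⟩
  · rw [hdata, RootedMap.deg]
    simp only [Equiv.trans_apply, hφ]
    classical
    rw [Nat.card_congr ((Equiv.refl D).subtypeEquiv fun x => (List.mem_toFinset).symm),
      Nat.card_eq_fintype_card, Fintype.card_coe, List.toFinset_card_of_nodup (hnd _),
      List.length_map]
  · rw [hdata]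
    obtain ⟨g, hg, hx'⟩ := List.mem_flatMap.1 (h1.mem_iff.1 hx)
    obtain ⟨⟨st', y⟩, he, he'⟩ := List.mem_map.1 hx'
    simp only [Prod.mk.injEq] at he'
    obtain ⟨⟨rfl, rfl⟩, rfl⟩ := he'
    obtain ⟨j, hj, rfl⟩ := List.getElem_of_mem hg
    have h3 := (hφ ⟨j, hj⟩ y).2 (List.mem_map.2 ⟨_, he, rfl⟩)
    rw [Equiv.trans_apply, h3] at hv
    have hij : j = (finCongr hlen i).1 := congrArg Fin.val (φ.injective hv)
    subst hij
    rfl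

/-- Outgoing and ingoing half-edges are balanced at each vertex. -/
def IsBalanced [Fintype D] (M : RootedMap D) (ω : D → ℤ) : Prop :=
  open scoped Classical in ∀ v : M.Vertex, ∑ x with M.vertexOf x = v, ω x = 0

theorem IsBalanced.sum_eq_zero [Fintype D] {M : RootedMap D} {ω : D → ℤ} (h : IsBalanced M ω)
    (B : Finset D) (hB : ∀ x ∈ B, ∀ y, M.vertexOf y = M.vertexOf x → y ∈ B) :
    ∑ x ∈ B, ω x = 0 := by
  classical
  rw [← Finset.sum_fiberwise_of_maps_to (t := B.image M.vertexOf) (g := M.vertexOf)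
    fun x hx => Finset.mem_image_of_mem _ hx]
  refine Finset.sum_eq_zero fun v hv => ?_
  obtain ⟨x, hx, rfl⟩ := Finset.mem_image.1 hv
  rw [← h (M.vertexOf x)]
  congr 1
  ext y
  simp only [Finset.mem_filter, Finset.mem_univ, true_and, and_iff_right_iff_imp]
  exact hB x hx y

/-- The orientation of the half-edges of a closure. -/
theorem ClosureWord.exists_orientation [Fintype D] {T : BTree κ} (hN : T.IsNode)
    (hT : T.NodesEulerian) {M : RootedMap D} {W : List (Entry κ D)} (h : ClosureWord T M W) :
    ∃ ω : D → ℤ, (∀ e ∈ W, ω e.2 = e.1.1.sgn) ∧ (∀ x, ω (M.α x) = -ω x) ∧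
      (∀ x, ω x = 1 ∨ ω x = -1) ∧ IsBalanced M ω := by
  classical
  have hex : ∀ x, ∃ e ∈ W, e.2 = x := fun x => by simpa using h.complete x
  choose f hf hfx using hex
  have hω : ∀ e ∈ W, (f e.2).1.1.sgn = e.1.1.sgn := by
    rintro ⟨a, x⟩ he
    rcases hfe : f x with ⟨a', x'⟩
    have h1 := hf x
    have h2 := hfx x
    rw [hfe] at h1 h2
    simp only at h2
    subst h2
    rw [entry_unique h.nodup h1 he]
  refine ⟨fun x => (f x).1.1.sgn, hω, fun x => ?_, fun x => ?_, fun v => ?_⟩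
  · rcases hfe : f x with ⟨a, x'⟩
    rcases hfe' : f (M.α x) with ⟨a', x''⟩
    have h1 := hf x
    have h2 := hfx x
    have h1' := hf (M.α x)
    have h2' := hfx (M.α x)
    rw [hfe] at h1 h2
    rw [hfe'] at h1' h2'
    simp only at h2 h2'
    subst h2
    subst h2'
    simp only [hfe, hfe']
    exact h.good.sgn_eq M.α_invol h.nodup h1 h1'
  · dsimp only
    cases (f x).1.1 <;> simp [Step.sgn]
  · obtain ⟨Gs, h1, h2, φ, hφ⟩ := h.exists_vertexEquiv hN
    have hp := h1.map Prod.snd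
    rw [map_snd_flatMap_groupEntries] at hp
    obtain ⟨i, rfl⟩ := φ.surjective v
    have hnd : (Gs[i].2.map Prod.snd).Nodup :=
      (List.nodup_flatMap.1 (hp.nodup_iff.1 h.nodup)).1 _ (List.getElem_mem i.2)
    have hset : Finset.univ.filter (fun x => M.vertexOf x = φ i) =
        (Gs[i].2.map Prod.snd).toFinset := by
      ext x
      simp only [Finset.mem_filter, Finset.mem_univ, true_and, hφ, List.mem_toFinset]
    rw [hset, List.sum_toFinset _ hnd, List.map_map, ← h2.sum_sgn hT _ (List.getElem_mem i.2)]
    congr 1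
    refine List.map_congr_left fun e he => ?_
    exact hω ((e.1, Gs[i].1), e.2) (h1.mem_iff.2 (List.mem_flatMap.2
      ⟨Gs[i], List.getElem_mem i.2, List.mem_map.2 ⟨e, he, rfl⟩⟩))

theorem BTree.NodesEulerian.even_nodeData {T : BTree κ} (hT : T.NodesEulerian) :
    ∀ a ∈ T.nodeData, Even a.2 := by
  induction T with
  | opening => simp [BTree.nodeData]
  | closing ι => simp [BTree.nodeData]
  | node x n child ih =>
    obtain ⟨⟨k, hk, -⟩, hT⟩ := hT
    intro a ha
    simp only [BTree.nodeData, List.mem_cons, List.mem_flatten, List.mem_ofFn] at ha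
    rcases ha with rfl | ⟨_, ⟨j, rfl⟩, ha⟩
    · exact ⟨k, by simp; omega⟩
    · exact ih j (hT j) a ha

theorem ClosureWord.isEulerian {T : BTree κ} (hN : T.IsNode) (hT : T.NodesEulerian)
    {M : RootedMap D} {W : List (Entry κ D)} (h : ClosureWord T M W) : M.IsEulerian := by
  intro v
  obtain ⟨φ, hφ, -⟩ := h.exists_vertexEquiv_deg hN
  obtain ⟨i, rfl⟩ := φ.surjective v
  rw [hφ]
  exact hT.even_nodeData _ (List.getElem_mem i.2)

theorem ClosureWord.card_vertex {T : BTree κ} (hN : T.IsNode)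
    {M : RootedMap D} {W : List (Entry κ D)} (h : ClosureWord T M W) :
    Nat.card M.Vertex = T.nodeData.length := by
  obtain ⟨φ, -⟩ := h.exists_vertexEquiv_deg hN
  rw [← Nat.card_congr φ, Nat.card_fin]

theorem ClosureWord.vertexWeight {R : Type*} [CommSemiring R] (g : ℕ → R) {T : BTree κ}
    (hN : T.IsNode) {M : RootedMap D} {W : List (Entry κ D)} (h : ClosureWord T M W) :
    M.vertexWeight g = (T.nodeData.map fun a => g (a.2 / 2)).prod := by
  obtain ⟨φ, hφ, -⟩ := h.exists_vertexEquiv_deg hN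
  have key : ∏ᶠ i : Fin T.nodeData.length, g ((T.nodeData[i]).2 / 2) =
      ∏ᶠ v, g (M.deg v / 2) :=
    finprod_eq_of_bijective φ φ.bijective fun i => by rw [hφ]
  rw [RootedMap.vertexWeight, ← key, finprod_eq_prod_of_fintype, ← List.prod_ofFn]
  congr 1
  refine List.ext_getElem (by simp) fun i h1 h2 => by simp

/-- The half-edges are partitioned by the nodes. -/
theorem ClosureWord.length_eq {T : BTree κ} (hN : T.IsNode)
    {M : RootedMap D} {W : List (Entry κ D)} (h : ClosureWord T M W) :
    Nat.card D = (T.nodeData.map Prod.snd).sum := by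
  classical
  obtain ⟨Gs, h1, h2⟩ := h.groups hN
  have h3 : Nat.card D = W.length := by
    rw [← Nat.card_congr (List.Nodup.getEquivOfForallMemList _ h.nodup h.complete), Nat.card_fin,
      List.length_map]
  rw [h3, h1.length_eq, ← h2.data, List.length_flatMap, List.map_map]
  simp [groupEntries, Function.comp_def]

theorem ClosureWord.numVerticesIn {T : BTree Bool} (hN : T.IsNode)
    {M : RootedMap D} {W : List (Entry Bool D)} (h : ClosureWord T M W) {X : Set D}
    (hX : ∀ e ∈ W, e.2 ∈ X ↔ e.1.2 = true) :
    M.numVerticesIn X = T.nodeData.countP (·.1) ∧ (∀ x ∈ X, M.σ x ∈ X) ∧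
      ∀ x ∈ X, ∃ a ∈ T.nodeData, a.1 = true ∧ M.deg (M.vertexOf x) = a.2 := by
  obtain ⟨φ, hφ, hl⟩ := h.exists_vertexEquiv_deg hN
  have hmem : ∀ x i, M.vertexOf x = φ i → (x ∈ X ↔ (T.nodeData[i]).1 = true) := by
    intro x i hi
    obtain ⟨⟨⟨st, l⟩, x'⟩, he, rfl⟩ := List.mem_map.1 (h.complete x)
    rw [hX _ he, ← hl i st l x' he hi]
  have hmem' : ∀ x, x ∈ X ↔ (T.nodeData[φ.symm (M.vertexOf x)]).1 = true :=
    fun x => hmem x _ (by simp)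
  have himage : M.vertexOf '' X = φ '' {i | (T.nodeData[i]).1 = true} := by
    ext v
    obtain ⟨i, rfl⟩ := φ.surjective v
    obtain ⟨x, hx⟩ := Quotient.exists_rep (φ i)
    change M.vertexOf x = φ i at hx
    rw [φ.injective.mem_set_image]
    constructor
    · rintro ⟨y, hy, hyi⟩
      exact (hmem y i hyi).1 hy
    · exact fun hi => ⟨x, (hmem x i hx).2 hi, hx⟩
  refine ⟨?_, fun x hx => ?_, fun x hx => ⟨_, List.getElem_mem (φ.symm (M.vertexOf x)).2,
    (hmem' x).1 hx, ?_⟩⟩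
  · rw [RootedMap.numVerticesIn, himage, Set.ncard_image_of_injective _ φ.injective]
    conv_rhs => rw [← List.ofFn_getElem (xs := T.nodeData)]
    rw [BTree.countP_ofFn, Set.ncard_eq_toFinset_card']
    congr 1
    ext i
    simp
  · rw [hmem'] at hx
    have : M.vertexOf (M.σ x) = M.vertexOf x :=
      RootedMap.vertexOf_eq_iff.2 (Equiv.Perm.sameCycle_apply_left.2 (Equiv.Perm.SameCycle.refl _ _))
    exact (hmem (M.σ x) _ (this.trans (by simp))).2 hx
  · have := hφ (φ.symm (M.vertexOf x))
    rw [Equiv.apply_symm_apply] at this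
    exact this

end Vertices


/-! ### Uniqueness of the tree with a given closure -/

section Uniqueness

variable {D : Type}

/-- The two halves of an edge inside `B` cancel. For `B` a union of vertices and `ω` balanced, the
flux through the boundary is therefore zero. -/
theorem sum_boundary_eq_sum [DecidableEq D] {M : RootedMap D} {ω : D → ℤ}
    (h : ∀ x, ω (M.α x) = -ω x) (B : Finset D) :
    ∑ x ∈ B with M.α x ∉ B, ω x = ∑ x ∈ B, ω x := by
  rw [← Finset.sum_filter_add_sum_filter_not B (fun x => M.α x ∈ B)]
  have : ∑ x ∈ B with M.α x ∈ B, ω x = 0 := by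
    refine Finset.sum_involution (fun x _ => M.α x) ?_ ?_ ?_ ?_
    · intro x _
      rw [h]
      ring
    · intro x _ _
      exact M.α_ne x
    · intro x hx
      simp only [Finset.mem_filter] at hx ⊢
      exact ⟨hx.2, by rw [M.α_invol]; exact hx.1⟩
    · intro x _
      exact M.α_invol x
  rw [this, zero_add]

/-- The crux of uniqueness. Let `B` consist of the half-edges at the nodes of the subtree that `T₂`
has at `d`. Both tree orientations have zero flux through the boundary of `B`. Yet the first is
nowhere larger on this boundary, and it is strictly smaller at `α d`, since the edge of `d` points
towards `B` in `T₁` and out of `B` in `T₂`. -/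
theorem not_opening_and_node [Finite D] {κ : Type} {M : RootedMap D} {T₁ T₂ : BTree κ}
    (hN₁ : T₁.IsNode) (hT₁ : T₁.NodesEulerian) (hN₂ : T₂.IsNode) (hT₂ : T₂.NodesEulerian)
    {P A R₁ R₂ : List (Entry κ D)} {p l x : κ} {d z : D} {n : ℕ} {child : Fin n → BTree κ}
    {s b : List D}
    (h₁ : ClosureWord T₁ M (P ++ ((Step.opening, l), d) :: R₁))
    (h₂ : ClosureWord T₂ M (P ++ (A ++ R₂)))
    (hA : A.map Prod.fst = (BTree.node x n child).walkFrom p) (hr : Rot M d (A ++ R₂) z)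
    (hg : Good M.α (A ++ R₂) s b) : False := by
  classical
  have := Fintype.ofFinite D
  obtain ⟨-, -, ⟨st, -, Gs, hperm, hGs⟩, hdown⟩ := walkFrom_groups _ p d A R₂ z s b hA hr hg
  obtain ⟨ω₁, hω₁, hα₁, hpm₁, hb₁⟩ := h₁.exists_orientation hN₁ hT₁
  obtain ⟨ω₂, hω₂, hα₂, hpm₂, hb₂⟩ := h₂.exists_orientation hN₂ hT₂
  have hd : ((Step.down, p), d) ∈ A := by
    rw [BTree.walkFrom_node, List.map_eq_cons_iff] at hA
    obtain ⟨⟨a, y⟩, A', rfl, rfl, -⟩ := hA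
    obtain ⟨rfl, -⟩ := hr
    simp
  have hAnd : (A.map Prod.snd).Nodup := by
    have := h₂.nodup
    rw [List.map_append, List.map_append] at this
    exact (List.nodup_append.1 (List.nodup_append.1 this).2.1).1
  have hval := hperm.map Prod.snd
  rw [List.map_cons, map_snd_flatMap_groupEntries] at hval
  set B := (Gs.flatMap fun g => g.2.map Prod.snd).toFinset with hB
  have hmemB : ∀ y, y ∈ A.map Prod.snd ↔ y = d ∨ y ∈ B := by
    intro y
    rw [hval.mem_iff, List.mem_cons, hB, List.mem_toFinset]
  have hdB : d ∉ B := by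
    rw [hB, List.mem_toFinset]
    exact (List.nodup_cons.1 (hval.nodup_iff.1 hAnd)).1
  have hclosed : ∀ y ∈ B, ∀ w, M.vertexOf w = M.vertexOf y → w ∈ B := by
    intro y hy w hw
    rw [hB, List.mem_toFinset] at hy ⊢
    obtain ⟨g, hg, hy⟩ := List.mem_flatMap.1 hy
    exact List.mem_flatMap.2 ⟨g, hg, ((hGs.orbit g hg).mem_iff hy).2
      (RootedMap.vertexOf_eq_iff.1 hw).symm⟩
  have hs₁ := sum_boundary_eq_sum hα₁ B
  have hs₂ := sum_boundary_eq_sum hα₂ B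
  rw [hb₁.sum_eq_zero B hclosed] at hs₁
  rw [hb₂.sum_eq_zero B hclosed] at hs₂
  have h2d : ω₂ (M.α d) = 1 := by
    rw [hα₂, hω₂ ((Step.down, p), d) (by simp [hd])]
    rfl
  have h1d : ω₁ (M.α d) = -1 := by
    rw [hα₁, hω₁ ((Step.opening, l), d) (by simp)]
    rfl
  have hαd : M.α d ∈ B :=
    ((hmemB _).1 (hdown p d hd)).resolve_left (M.α_ne d)
  -- A boundary half-edge that is ingoing for `ω₂` is a closing leaf of the subtree, because
  -- downward half-edges have their opposite inside. Its matching opening precedes the subtree,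
  -- hence lies in the common prefix `P`, where the two orientations agree.
  have hlt : ∑ x ∈ B with M.α x ∉ B, ω₁ x < ∑ x ∈ B with M.α x ∉ B, ω₂ x := by
    refine Finset.sum_lt_sum (fun y hy => ?_) ⟨M.α d, ?_, by rw [h1d, h2d]; norm_num⟩
    · rw [Finset.mem_filter] at hy
      rcases hpm₂ y with h | h
      · rcases hpm₁ y with h' | h' <;> rw [h, h']
        norm_num
      have hyd : y ≠ M.α d := by
        rintro rfl
        rw [h2d] at h
        norm_num at h
      have hαy : M.α y ∉ A.map Prod.snd := by
        rw [hmemB]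
        rintro (h3 | h3)
        · exact hyd (by rw [← h3, M.α_invol])
        · exact hy.2 h3
      obtain ⟨⟨⟨st', l'⟩, y'⟩, he, rfl⟩ := List.mem_map.1 ((hmemB y).2 (Or.inr hy.1))
      dsimp only at h hαy ⊢
      have h4 := hω₂ _ (List.mem_append_right P (List.mem_append_left R₂ he))
      dsimp only at h4
      rw [h] at h4 ⊢
      cases st' with
      | opening => simp [Step.sgn] at h4
      | up => simp [Step.sgn] at h4
      | down => exact absurd (hdown _ _ he) hαy
      | closing ι =>
        obtain ⟨A₁, A₂, rfl⟩ := List.append_of_mem he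
        have h5 := h₂.good
        rw [List.append_assoc, List.cons_append, ← List.append_assoc] at h5
        obtain h6 | ⟨l', h6⟩ := h5.opening_of_closing M.α_invol
        · simp at h6
        rcases List.mem_append.1 h6 with h6 | h6
        · have h7 := hω₁ _ (List.mem_append_left _ h6)
          rw [hα₁] at h7
          simp only [Step.sgn] at h7
          omega
        · exact (hαy (List.mem_map.2 ⟨_, List.mem_append_left _ h6, rfl⟩)).elim
    · rw [Finset.mem_filter, M.α_invol]
      exact ⟨hαd, hdB⟩
  rw [hs₁, hs₂] at hlt
  exact lt_irrefl _ hlt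

/-- What is known about the opposite half-edge when a step is read. -/
theorem ClosureWord.step_cases {κ : Type} {T : BTree κ} {M : RootedMap D}
    {P R : List (Entry κ D)} {st : Step} {l : κ} {d : D}
    (h : ClosureWord T M (P ++ ((st, l), d) :: R)) :
    ((st = .opening ∨ st = .down) ∧ M.α d ∉ P.map Prod.snd) ∨
    ((∃ ι, st = .closing ι) ∧ ∃ l', ((Step.opening, l'), M.α d) ∈ P) ∨
    (st = .up ∧ ∃ l', ((Step.down, l'), M.α d) ∈ P) := by
  have hdisj : ∀ a x, (a, x) ∈ R → x ∉ P.map Prod.snd := by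
    intro a x hx hP
    have := h.nodup
    rw [List.map_append, List.map_cons, List.nodup_append] at this
    exact this.2.2 x hP x (List.mem_cons_of_mem _ (List.mem_map.2 ⟨_, hx, rfl⟩)) rfl
  cases st with
  | opening =>
    obtain ⟨ι, l', h1⟩ := h.good.closing_of_opening
    exact Or.inl ⟨Or.inl rfl, hdisj _ _ h1⟩
  | down =>
    obtain ⟨l', h1⟩ := h.good.up_of_down
    exact Or.inl ⟨Or.inr rfl, hdisj _ _ h1⟩
  | closing ι =>
    obtain h1 | ⟨l', h1⟩ := h.good.opening_of_closing M.α_invol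
    · simp at h1
    · exact Or.inr (Or.inl ⟨⟨ι, rfl⟩, l', h1⟩)
  | up =>
    obtain h1 | ⟨l', h1⟩ := h.good.down_of_up M.α_invol
    · simp at h1
    · exact Or.inr (Or.inr ⟨rfl, l', h1⟩)

/-- If the first walk is over, `d` has already been used in `P`. If it goes up, the opposite of `d`
is a downward half-edge of `P`, whereas for a child it is either not in `P` or an opening of `P`. -/
theorem ClosureWord.not_end_and_child {κ : Type} {T₁ T₂ : BTree κ} {M : RootedMap D}
    {P R₁ R₂ : List (Entry κ D)} {st : Step} {l : κ} {d : D}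
    (h₁ : ClosureWord T₁ M (P ++ R₁))
    (hR : R₁ = [] ∨ ∃ l' R', R₁ = ((Step.up, l'), d) :: R')
    (h₂ : ClosureWord T₂ M (P ++ ((st, l), d) :: R₂)) (hst : st ≠ .up) : False := by
  have hPnd : (P.map Prod.snd).Nodup := by
    have := h₂.nodup
    rw [List.map_append] at this
    exact (List.nodup_append.1 this).1
  rcases hR with rfl | ⟨l', R', rfl⟩
  · have h3 := h₁.complete d
    have h4 := h₂.nodup
    rw [List.append_nil] at h3
    rw [List.map_append, List.map_cons, List.nodup_append] at h4
    exact h4.2.2 d h3 d (by simp) rfl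
  · have h3 := h₁.step_cases
    have h4 := h₂.step_cases
    simp only [reduceCtorEq, or_self, false_and, exists_false, true_and, false_or] at h3
    obtain ⟨l1, h3⟩ := h3
    rcases h4 with ⟨-, h4⟩ | ⟨-, l2, h4⟩ | ⟨h4, -⟩
    · exact h4 (List.mem_map.2 ⟨_, h3, rfl⟩)
    · have := entry_unique hPnd h3 h4
      simp at this
    · exact hst h4

theorem BTree.walkFrom_head {κ : Type} (p : κ) (t : BTree κ) :
    ∃ st w, t.walkFrom p = (st, p) :: w ∧ st ≠ .up := by
  cases t with
  | opening => exact ⟨_, _, rfl, by simp⟩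
  | closing ι => exact ⟨_, _, rfl, by simp⟩
  | node x n child => exact ⟨_, _, rfl, by simp⟩

/-- Two subtrees read from the same state of the walk, in two trees with closure `M`, agree. -/
def SubtreeUnique (M : RootedMap D) (T₁ T₂ : BTree Unit) (t₁ : BTree Unit) : Prop :=
  ∀ (t₂ : BTree Unit) (P A₁ A₂ R₁ R₂ : List (Entry Unit D)) (d : D) (s b : List D),
    ClosureWord T₁ M (P ++ (A₁ ++ R₁)) → ClosureWord T₂ M (P ++ (A₂ ++ R₂)) →
    A₁.map Prod.fst = t₁.walkFrom () → A₂.map Prod.fst = t₂.walkFrom () →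
    Rot M d (A₁ ++ R₁) M.root → Rot M d (A₂ ++ R₂) M.root →
    Good M.α (A₁ ++ R₁) s b → Good M.α (A₂ ++ R₂) s b →
    s.Nodup → (∀ y ∈ s, y ∈ P.map Prod.snd) →
    t₁ = t₂ ∧ A₁ = A₂ ∧ ∃ s', s'.Nodup ∧ (∀ y ∈ s', y ∈ (P ++ A₁).map Prod.snd) ∧
      Good M.α R₁ s' b ∧ Good M.α R₂ s' b

theorem forest_unique {M : RootedMap D} {T₁ T₂ : BTree Unit} (ts₁ : List (BTree Unit))
    (hts : ∀ t ∈ ts₁, SubtreeUnique M T₁ T₂ t)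
    (ts₂ : List (BTree Unit)) (P A₁ A₂ R₁ R₂ : List (Entry Unit D)) (d : D) (s b : List D)
    (h₁ : ClosureWord T₁ M (P ++ (A₁ ++ R₁))) (h₂ : ClosureWord T₂ M (P ++ (A₂ ++ R₂)))
    (hA₁ : A₁.map Prod.fst = (ts₁.map (BTree.walkFrom ())).flatten)
    (hA₂ : A₂.map Prod.fst = (ts₂.map (BTree.walkFrom ())).flatten)
    (hr₁ : Rot M d (A₁ ++ R₁) M.root) (hr₂ : Rot M d (A₂ ++ R₂) M.root)
    (hg₁ : Good M.α (A₁ ++ R₁) s b) (hg₂ : Good M.α (A₂ ++ R₂) s b)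
    (hs : s.Nodup) (hsP : ∀ y ∈ s, y ∈ P.map Prod.snd)
    (hR₁ : R₁ = [] ∨ ∃ y R', R₁ = ((Step.up, ()), y) :: R')
    (hR₂ : R₂ = [] ∨ ∃ y R', R₂ = ((Step.up, ()), y) :: R') :
    ts₁ = ts₂ ∧ A₁ = A₂ ∧ ∃ s', s'.Nodup ∧ (∀ y ∈ s', y ∈ (P ++ A₁).map Prod.snd) ∧
      Good M.α R₁ s' b ∧ Good M.α R₂ s' b := by
  -- One forest cannot end where the other one goes on. It is stated for arbitrary trees so as to be
  -- used in both directions.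
  have hends : ∀ {T T' : BTree Unit} {t : BTree Unit} {ts : List (BTree Unit)}
      {P A R R' : List (Entry Unit D)} {d : D}, ClosureWord T M (P ++ R) →
      (R = [] ∨ ∃ y R', R = ((Step.up, ()), y) :: R') → Rot M d R M.root →
      A.map Prod.fst = ((t :: ts).map (BTree.walkFrom ())).flatten →
      ClosureWord T' M (P ++ (A ++ R')) → Rot M d (A ++ R') M.root → False := by
    intro T T' t ts P A R R' d h hR hr hA h' hr'
    obtain ⟨st, w, hw, hst⟩ := BTree.walkFrom_head () t
    rw [List.map_cons, hw, List.flatten_cons, List.cons_append, List.map_eq_cons_iff] at hA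
    obtain ⟨⟨a, y⟩, A', rfl, rfl, -⟩ := hA
    obtain ⟨rfl, -⟩ := hr'
    refine h.not_end_and_child ?_ h' hst
    rcases hR with rfl | ⟨z, R', rfl⟩
    · exact Or.inl rfl
    · obtain ⟨rfl, -⟩ := hr
      exact Or.inr ⟨(), R', rfl⟩
  induction ts₁ generalizing ts₂ P A₁ A₂ d s with
  | nil =>
    simp only [List.map_nil, List.flatten_nil, List.map_eq_nil_iff] at hA₁
    subst hA₁
    cases ts₂ with
    | nil =>
      simp only [List.map_nil, List.flatten_nil, List.map_eq_nil_iff] at hA₂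
      subst hA₂
      exact ⟨rfl, rfl, s, hs, by simpa using hsP, hg₁, hg₂⟩
    | cons t ts => exact (hends h₁ hR₁ hr₁ hA₂ h₂ hr₂).elim
  | cons t₁ ts₁ ih =>
    cases ts₂ with
    | nil =>
      simp only [List.map_nil, List.flatten_nil, List.map_eq_nil_iff] at hA₂
      subst hA₂
      exact (hends h₂ hR₂ hr₂ hA₁ h₁ hr₁).elim
    | cons t₂ ts₂ =>
      rw [List.map_cons, List.flatten_cons, List.map_eq_append_iff] at hA₁ hA₂
      obtain ⟨A₁, A₁', rfl, hA₁, hA₁'⟩ := hA₁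
      obtain ⟨A₂, A₂', rfl, hA₂, hA₂'⟩ := hA₂
      simp only [List.append_assoc] at h₁ h₂ hr₁ hr₂ hg₁ hg₂
      obtain ⟨rfl, rfl, s', hs', hsP', hg₁', hg₂'⟩ := hts t₁ (by simp) t₂ P A₁ A₂ _ _ d s b
        h₁ h₂ hA₁ hA₂ hr₁ hr₂ hg₁ hg₂ hs hsP
      have hr₁' := (walkFrom_groups t₁ () d A₁ _ _ s b hA₁ hr₁ hg₁).1
      have hr₂' := (walkFrom_groups t₁ () d A₁ _ _ s b hA₁ hr₂ hg₂).1
      rw [← List.append_assoc] at h₁ h₂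
      obtain ⟨rfl, rfl, s'', hs'', hsP'', hg₁'', hg₂''⟩ := ih
        (fun t ht => hts t (List.mem_cons_of_mem _ ht)) ts₂ _ A₁' A₂' _ s' h₁ h₂ hA₁' hA₂'
        hr₁' hr₂' hg₁' hg₂' hs' hsP'
      exact ⟨rfl, rfl, s'', hs'', by simpa using hsP'', hg₁'', hg₂''⟩

/-- Openings and downward half-edges come before their opposite, closings after it, and
`ClosureWord.step_cases` tells these situations apart from the common past. Only opening against
node needs the flux argument. -/
theorem subtreeUnique [Finite D] {M : RootedMap D} {T₁ T₂ : BTree Unit}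
    (hN₁ : T₁.IsNode) (hT₁ : T₁.NodesEulerian) (hN₂ : T₂.IsNode) (hT₂ : T₂.NodesEulerian)
    (t : BTree Unit) : SubtreeUnique M T₁ T₂ t := by
  induction t with
  | opening =>
    intro t₂ P A₁ A₂ R₁ R₂ d s b h₁ h₂ hA₁ hA₂ hr₁ hr₂ hg₁ hg₂ hs hsP
    simp only [BTree.walkFrom, List.map_eq_singleton_iff] at hA₁
    obtain ⟨⟨a, y⟩, rfl, rfl⟩ := hA₁
    obtain ⟨rfl, -⟩ := hr₁
    dsimp only at *
    cases t₂ with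
    | opening =>
      simp only [BTree.walkFrom, List.map_eq_singleton_iff] at hA₂
      obtain ⟨⟨a, y'⟩, rfl, rfl⟩ := hA₂
      obtain ⟨rfl, -⟩ := hr₂
      refine ⟨rfl, rfl, y' :: s, List.nodup_cons.2 ⟨fun hy => ?_, hs⟩, ?_, hg₁, hg₂⟩
      · have := h₁.nodup
        rw [List.map_append, List.nodup_append] at this
        exact this.2.2 y' (hsP _ hy) y' (by simp) rfl
      · intro z hz
        rw [List.map_append, List.mem_append]
        rcases List.mem_cons.1 hz with rfl | hz
        · exact Or.inr (by simp)
        · exact Or.inl (hsP z hz)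
    | closing ι =>
      simp only [BTree.walkFrom, List.map_eq_singleton_iff] at hA₂
      obtain ⟨⟨a, y'⟩, rfl, rfl⟩ := hA₂
      obtain ⟨rfl, -⟩ := hr₂
      have h3 := ClosureWord.step_cases (P := P) h₁
      have h4 := ClosureWord.step_cases (P := P) h₂
      simp at h3 h4
      obtain ⟨_, h4⟩ := h4
      exact (h3 _ _ h4).elim
    | node x n child =>
      exact (not_opening_and_node hN₁ hT₁ hN₂ hT₂ h₁ h₂ hA₂ hr₂ hg₂).elim
  | closing ι =>
    intro t₂ P A₁ A₂ R₁ R₂ d s b h₁ h₂ hA₁ hA₂ hr₁ hr₂ hg₁ hg₂ hs hsP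
    simp only [BTree.walkFrom, List.map_eq_singleton_iff] at hA₁
    obtain ⟨⟨a, y⟩, rfl, rfl⟩ := hA₁
    obtain ⟨rfl, -⟩ := hr₁
    dsimp only at *
    cases t₂ with
    | opening =>
      simp only [BTree.walkFrom, List.map_eq_singleton_iff] at hA₂
      obtain ⟨⟨a, y'⟩, rfl, rfl⟩ := hA₂
      obtain ⟨rfl, -⟩ := hr₂
      have h3 := ClosureWord.step_cases (P := P) h₁
      have h4 := ClosureWord.step_cases (P := P) h₂
      simp at h3 h4
      obtain ⟨_, h3⟩ := h3
      exact (h4 _ _ h3).elim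
    | closing ι' =>
      simp only [BTree.walkFrom, List.map_eq_singleton_iff] at hA₂
      obtain ⟨⟨a, y'⟩, rfl, rfl⟩ := hA₂
      obtain ⟨rfl, -⟩ := hr₂
      obtain ⟨z, hz, hzy, hg₁⟩ := hg₁
      obtain ⟨z', hz', hzy', hg₂⟩ := hg₂
      -- Both indices locate the opposite of the same half-edge in the same stack, which has no
      -- repetition: they are equal.
      have hzz : z = z' := M.α.injective (hzy.trans hzy'.symm)
      subst hzz
      have hι : ι = ι' :=
        (List.getElem?_inj (List.getElem?_eq_some_iff.1 hz).1 hs).1 (hz.trans hz'.symm)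
      subst hι
      refine ⟨rfl, rfl, s.eraseIdx ι, hs.eraseIdx ι, fun w hw => ?_, hg₁, hg₂⟩
      rw [List.map_append, List.mem_append]
      exact Or.inl (hsP w (List.mem_of_mem_eraseIdx hw))
    | node x n child =>
      rw [BTree.walkFrom_node, List.map_eq_cons_iff] at hA₂
      obtain ⟨⟨a, y'⟩, A', rfl, rfl, -⟩ := hA₂
      obtain ⟨rfl, -⟩ := hr₂
      have h3 := ClosureWord.step_cases (P := P) h₁
      have h4 := ClosureWord.step_cases (P := P) h₂
      simp at h3 h4
      obtain ⟨_, h3⟩ := h3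
      exact (h4 _ _ h3).elim
  | node x n child ih =>
    intro t₂ P A₁ A₂ R₁ R₂ d s b h₁ h₂ hA₁ hA₂ hr₁ hr₂ hg₁ hg₂ hs hsP
    cases t₂ with
    | opening =>
      simp only [BTree.walkFrom, List.map_eq_singleton_iff] at hA₂
      obtain ⟨⟨a, y'⟩, rfl, rfl⟩ := hA₂
      obtain ⟨rfl, -⟩ := hr₂
      exact (not_opening_and_node hN₂ hT₂ hN₁ hT₁ h₂ h₁ hA₁ hr₁ hg₁).elim
    | closing ι =>
      simp only [BTree.walkFrom, List.map_eq_singleton_iff] at hA₂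
      obtain ⟨⟨a, y'⟩, rfl, rfl⟩ := hA₂
      obtain ⟨rfl, -⟩ := hr₂
      rw [BTree.walkFrom_node, List.map_eq_cons_iff] at hA₁
      obtain ⟨⟨a, y⟩, A', rfl, rfl, -⟩ := hA₁
      obtain ⟨rfl, -⟩ := hr₁
      have h3 := ClosureWord.step_cases (P := P) h₁
      have h4 := ClosureWord.step_cases (P := P) h₂
      simp at h3 h4
      obtain ⟨_, h4⟩ := h4
      exact (h3 _ _ h4).elim
    | node x' n' child' =>
      rw [BTree.walkFrom_node, List.map_eq_cons_iff] at hA₁ hA₂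
      obtain ⟨⟨a₁, y⟩, A₁, rfl, rfl, hA₁⟩ := hA₁
      obtain ⟨⟨a₂, y'⟩, A₂, rfl, rfl, hA₂⟩ := hA₂
      rw [List.map_eq_append_iff] at hA₁ hA₂
      obtain ⟨A₁, A₁', rfl, hA₁, hA₁'⟩ := hA₁
      obtain ⟨A₂, A₂', rfl, hA₂, hA₂'⟩ := hA₂
      simp only [List.map_eq_singleton_iff] at hA₁' hA₂'
      obtain ⟨⟨a₁, z₁⟩, rfl, rfl⟩ := hA₁'
      obtain ⟨⟨a₂, z₂⟩, rfl, rfl⟩ := hA₂'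
      obtain ⟨hyd, hr₁⟩ := hr₁
      obtain ⟨hyd', hr₂⟩ := hr₂
      dsimp only at hyd hyd' hr₁ hr₂
      subst hyd
      subst hyd'
      rw [List.cons_append, List.append_assoc] at h₁ h₂ hg₁ hg₂
      rw [List.append_eq, List.append_assoc] at hr₁ hr₂
      have hcons : ∀ L : List (Entry Unit D), P ++ ((Step.down, ()), y') :: L =
          (P ++ [((Step.down, ()), y')]) ++ L := by simp
      rw [hcons] at h₁ h₂
      obtain ⟨hts, rfl, s', hs', hsP', hg₁', hg₂'⟩ := forest_unique (List.ofFn child)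
        ((List.forall_mem_ofFn_iff).2 ih) (List.ofFn child') _ A₁ A₂ _ _ _ s (y' :: b) h₁ h₂ hA₁ hA₂
        hr₁ hr₂ hg₁ hg₂ hs (fun z hz => by
          rw [List.map_append, List.mem_append]
          exact Or.inl (hsP z hz)) (Or.inr ⟨_, _, rfl⟩) (Or.inr ⟨_, _, rfl⟩)
      have hn := congrArg List.length hts
      simp only [List.length_ofFn] at hn
      subst hn
      have hchild := List.ofFn_injective hts
      subst hchild
      obtain ⟨w₁, b₁, hb₁, hw₁, hg₁'⟩ := hg₁'
      obtain ⟨w₂, b₂, hb₂, hw₂, hg₂'⟩ := hg₂'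
      obtain ⟨rfl, rfl⟩ := List.cons.inj hb₁
      obtain ⟨rfl, rfl⟩ := List.cons.inj hb₂
      subst hw₁
      subst hw₂
      refine ⟨rfl, rfl, s', hs', fun z hz => ?_, hg₁', hg₂'⟩
      have := hsP' z hz
      simp only [List.map_append, List.map_cons, List.map_nil, List.mem_append, List.mem_cons] at this ⊢
      tauto

theorem closureWord_unique [Finite D] {M : RootedMap D} {T₁ T₂ : BTree Unit}
    (hN₁ : T₁.IsNode) (hT₁ : T₁.NodesEulerian) (hN₂ : T₂.IsNode) (hT₂ : T₂.NodesEulerian)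
    {W₁ W₂ : List (Entry Unit D)} (h₁ : ClosureWord T₁ M W₁) (h₂ : ClosureWord T₂ M W₂) :
    T₁ = T₂ := by
  have key := subtreeUnique (M := M) hN₁ hT₁ hN₂ hT₂
  cases hT : T₁ with
  | opening => rw [hT] at hN₁; exact hN₁.elim
  | closing ι => rw [hT] at hN₁; exact hN₁.elim
  | node x n child =>
  cases hT' : T₂ with
  | opening => rw [hT'] at hN₂; exact hN₂.elim
  | closing ι => rw [hT'] at hN₂; exact hN₂.elim
  | node x' n' child' =>
    have h1 := h₁.steps
    have h2 := h₂.steps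
    rw [hT, BTree.walk_node, List.map_eq_cons_iff] at h1
    rw [hT', BTree.walk_node, List.map_eq_cons_iff] at h2
    obtain ⟨⟨a₁, y⟩, A₁, rfl, rfl, h1⟩ := h1
    obtain ⟨⟨a₂, y'⟩, A₂, rfl, rfl, h2⟩ := h2
    obtain ⟨hy, hr₁⟩ := h₁.rot
    obtain ⟨hy', hr₂⟩ := h₂.rot
    dsimp only at hy hy' hr₁ hr₂
    subst hy
    subst hy'
    have hnil : ∀ L : List (Entry Unit D), ((Step.opening, ()), M.root) :: L =
        [((Step.opening, ()), M.root)] ++ (L ++ []) := by simp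
    have hg₁ := h₁.good
    have hg₂ := h₂.good
    have h₁' := h₁
    have h₂' := h₂
    rw [hnil] at h₁' h₂'
    obtain ⟨hts, -⟩ := forest_unique (M := M) (T₁ := T₁) (T₂ := T₂) (List.ofFn child)
      (fun t _ => key t) (List.ofFn child')
      [((Step.opening, ()), M.root)] A₁ A₂ [] [] _ [M.root] [] h₁' h₂' h1 h2
      (by rw [List.append_nil]; exact hr₁) (by rw [List.append_nil]; exact hr₂)
      (by rw [List.append_nil]; exact hg₁) (by rw [List.append_nil]; exact hg₂)
      (by simp) (by simp) (Or.inl rfl) (Or.inl rfl)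
    have hn := congrArg List.length hts
    simp only [List.length_ofFn] at hn
    subst hn
    rw [List.ofFn_injective hts]

end Uniqueness


/-! ### Eulerian orientations -/

section Orientation

variable {D : Type}

theorem exists_involution_of_even {F : Type} [Finite F] (h : Even (Nat.card F)) :
    ∃ β : F → F, (∀ x, β (β x) = x) ∧ ∀ x, β x ≠ x := by
  obtain ⟨k, hk⟩ := h
  have e : F ≃ Fin k ⊕ Fin k := ((Finite.equivFin F).trans (finCongr hk)).trans finSumFinEquiv.symm
  refine ⟨fun x => e.symm (e x).swap, fun x => by simp, fun x hx => ?_⟩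
  have : (e x).swap = e x := by
    rw [Equiv.symm_apply_eq] at hx
    exact hx
  cases h : e x <;> simp [h] at this

theorem RootedMap.IsEulerian.exists_involution [Finite D] {M : RootedMap D} (hM : M.IsEulerian) :
    ∃ β : D → D, (∀ x, β (β x) = x) ∧ (∀ x, β x ≠ x) ∧ ∀ x, M.vertexOf (β x) = M.vertexOf x := by
  have hex := fun v => exists_involution_of_even (hM v)
  choose β hβ1 hβ2 using hex
  have key : ∀ x v (h : M.vertexOf x = v), (β (M.vertexOf x) ⟨x, rfl⟩).1 = (β v ⟨x, h⟩).1 := by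
    rintro x _ rfl
    rfl
  refine ⟨fun x => (β (M.vertexOf x) ⟨x, rfl⟩).1, fun x => ?_, fun x hx => ?_, fun x => ?_⟩
  · dsimp only
    rw [key _ _ (β (M.vertexOf x) ⟨x, rfl⟩).2]
    simp [hβ1]
  · exact hβ2 _ _ (Subtype.ext hx)
  · exact (β (M.vertexOf x) ⟨x, rfl⟩).2

/-- Two fixed-point-free involutions have a common proper 2-coloring. -/
theorem exists_coloring [Finite D] (α β : Equiv.Perm D) (hα : ∀ x, α (α x) = x)
    (hβ : ∀ x, β (β x) = x) (hα' : ∀ x, α x ≠ x) (hβ' : ∀ x, β x ≠ x) :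
    ∃ c : D → Prop, (∀ x, c (α x) ↔ ¬c x) ∧ ∀ x, c (β x) ↔ ¬c x := by
  set ρ : Equiv.Perm D := α * β with hρ
  have hρ1 : ρ⁻¹ = β * α := by
    rw [hρ, mul_inv_rev]
    congr 1 <;> refine inv_eq_of_mul_eq_one_left ?_ <;> ext x <;> simp [hα, hβ]
  have hconj : ∀ x, α (ρ x) = ρ⁻¹ (α x) := fun x => by
    rw [hρ1]
    simp [hρ, hα]
  have hpow : ∀ (k : ℤ) x, α ((ρ ^ k) x) = (ρ ^ (-k)) (α x) := by
    intro k x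
    have h1 : α * ρ * α⁻¹ = ρ⁻¹ := by
      ext y
      have := hconj (α⁻¹ y)
      simpa using this
    have h2 : α * ρ ^ k * α⁻¹ = ρ ^ (-k) := by
      rw [← conj_zpow, h1, inv_zpow']
    rw [← h2]
    simp
  -- `α` conjugates `ρ` to its inverse. If `ρ ^ k` sent `x` to `α x`, then the point halfway would
  -- be fixed by `α` for `k` even, or by `β` for `k` odd.
  have hne : ∀ x, ¬ρ.SameCycle x (α x) := by
    rintro x ⟨k, hk⟩
    rcases Int.even_or_odd' k with ⟨j, rfl | rfl⟩
    · refine hα' ((ρ ^ j) x) ?_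
      rw [hpow, ← hk, ← Equiv.Perm.mul_apply, ← zpow_add]
      congr 2
      ring
    · refine hβ' ((ρ ^ j) x) ?_
      have h1 : α ((ρ ^ j) x) = (ρ ^ (j + 1)) x := by
        rw [hpow, ← hk, ← Equiv.Perm.mul_apply, ← zpow_add]
        congr 2
        ring
      have h2 : (ρ ^ (j + 1)) x = α (β ((ρ ^ j) x)) := by
        rw [add_comm, zpow_add, zpow_one, Equiv.Perm.mul_apply]
        rfl
      exact (α.injective (h1.trans h2)).symm
  have := Finite.of_surjective (Quotient.mk (Equiv.Perm.SameCycle.setoid ρ)) Quotient.mk_surjective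
  -- The cycles of `ρ` are numbered by `f`. Both `α` and `β` exchange the cycle of `x` with the
  -- distinct cycle of `α x`; the colour tells which of the two has the smaller number.
  set f : D → ℕ := fun x => (Finite.equivFin (Quotient (Equiv.Perm.SameCycle.setoid ρ))
    (Quotient.mk _ x)).val with hf
  have hfiff : ∀ x y, f x = f y ↔ ρ.SameCycle x y := by
    intro x y
    rw [hf]
    dsimp only
    rw [Fin.val_inj, (Finite.equivFin _).injective.eq_iff]
    exact Quotient.eq (r := Equiv.Perm.SameCycle.setoid ρ)
  have hβα : ∀ x, f (β x) = f (α x) := fun x => by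
    rw [hfiff]
    exact ⟨1, by simp [hρ, hβ]⟩
  have hαβ : ∀ x, f (α (β x)) = f x := fun x => by
    rw [hfiff]
    exact Equiv.Perm.SameCycle.symm ⟨1, by simp [hρ]⟩
  have hfne : ∀ x, f x ≠ f (α x) := fun x h => hne x ((hfiff _ _).1 h)
  refine ⟨fun x => f x < f (α x), fun x => ?_, fun x => ?_⟩
  · dsimp only
    rw [hα]
    have := hfne x
    omega
  · dsimp only
    rw [hαβ, hβα]
    have := hfne x
    omega

/-- An Eulerian orientation (`1` at outgoing half-edges, `-1` at ingoing ones). -/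
structure IsOri [Fintype D] (M : RootedMap D) (ω : D → ℤ) : Prop where
  pm : ∀ x, ω x = 1 ∨ ω x = -1
  anti : ∀ x, ω (M.α x) = -ω x
  bal : IsBalanced M ω

theorem IsOri.neg [Fintype D] {M : RootedMap D} {ω : D → ℤ} (h : IsOri M ω) :
    IsOri M fun x => -ω x where
  pm x := by rcases h.pm x with h | h <;> simp [h]
  anti x := by rw [h.anti]
  bal v := by
    rw [Finset.sum_neg_distrib, h.bal v, neg_zero]

/-- Pair up the half-edges at each vertex, which is possible since degrees are even. A colouring
that alternates along the edges and along the pairs is an Eulerian orientation; negate it if the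
root is ingoing. -/
theorem RootedMap.IsEulerian.exists_isOri [Fintype D] {M : RootedMap D} (hM : M.IsEulerian) :
    ∃ ω, IsOri M ω ∧ ω M.root = 1 := by
  classical
  obtain ⟨β, hβ1, hβ2, hβ3⟩ := hM.exists_involution
  obtain ⟨c, hc1, hc2⟩ := exists_coloring M.α (Function.Involutive.toPerm β hβ1) M.α_invol hβ1
    M.α_ne hβ2
  have hori : IsOri M fun x => if c x then 1 else -1 := by
    refine ⟨fun x => ?_, fun x => ?_, fun v => ?_⟩
    · by_cases h : c x <;> simp [h]
    · by_cases h : c x <;> simp [h, hc1]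
    · refine Finset.sum_involution (fun x _ => β x) ?_ (fun x _ _ => hβ2 x) ?_ fun x _ => hβ1 x
      · intro x _
        have : c (β x) ↔ ¬c x := hc2 x
        by_cases h : c x <;> simp [h, this]
      · intro x hx
        simpa [hβ3] using hx
  rcases hori.pm M.root with h | h
  · exact ⟨_, hori, h⟩
  · exact ⟨_, hori.neg, by rw [h]; rfl⟩

/-- Reversing the edges of the ingoing half-edges in `l`. -/
noncomputable def flipOri (M : RootedMap D) (l : List D) (ω : D → ℤ) (x : D) : ℤ :=
  open scoped Classical in if x ∈ l ∨ M.α x ∈ l then -ω x else ω x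

/-- Reversal adds `2` at each half-edge of `l` and subtracts `2` at its opposite. By `hp` each
vertex receives as many changes of one kind as of the other; this holds in particular for a directed
cycle. -/
theorem IsOri.flip [Fintype D] {M : RootedMap D} {ω : D → ℤ} (h : IsOri M ω) {l : List D}
    (hl : l.Nodup) (hω : ∀ x ∈ l, ω x = -1)
    (hp : (l.map M.vertexOf).Perm (l.map fun x => M.vertexOf (M.α x))) :
    IsOri M (flipOri M l ω) := by
  classical
  refine ⟨fun x => ?_, fun x => ?_, fun v => ?_⟩
  · rcases h.pm x with h | h <;> unfold flipOri <;> split_ifs <;> simp [h]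
  · unfold flipOri
    rw [M.α_invol, h.anti]
    by_cases h1 : x ∈ l <;> by_cases h2 : M.α x ∈ l <;> simp [h1, h2]
  · have hdiff : ∀ x, flipOri M l ω x =
        ω x + ((if x ∈ l then 2 else 0) - (if M.α x ∈ l then 2 else 0)) := by
      intro x
      unfold flipOri
      by_cases h1 : x ∈ l
      · have h2 : M.α x ∉ l := fun h2 => by
          have := hω _ h2
          rw [h.anti, hω x h1] at this
          norm_num at this
        simp [h1, h2, hω x h1]
      · by_cases h2 : M.α x ∈ l
        · have h3 := hω _ h2
          rw [h.anti] at h3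
          have h4 : ω x = 1 := by omega
          simp [h1, h2, h4]
        · simp [h1, h2]
    simp only [hdiff]
    rw [Finset.sum_add_distrib, h.bal v, zero_add, Finset.sum_sub_distrib, sub_eq_zero]
    have e1 : ∑ x with M.vertexOf x = v, (if x ∈ l then (2 : ℤ) else 0) =
        ((l.map M.vertexOf).map fun w => if w = v then (2 : ℤ) else 0).sum := by
      rw [List.map_map, ← List.sum_toFinset _ hl, Finset.sum_filter, ← Finset.sum_filter_add_sum_filter_not
        Finset.univ (fun x => x ∈ l)]
      rw [Finset.sum_eq_zero (s := Finset.univ.filter fun x => x ∉ l), add_zero]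
      · refine Finset.sum_congr (by ext; simp) fun x hx => ?_
        simp only [List.mem_toFinset] at hx
        simp [hx]
      · intro x hx
        simp only [Finset.mem_filter] at hx
        simp [hx.2]
    have e2 : ∑ x with M.vertexOf x = v, (if M.α x ∈ l then (2 : ℤ) else 0) =
        ((l.map fun x => M.vertexOf (M.α x)).map fun w => if w = v then (2 : ℤ) else 0).sum := by
      rw [List.map_map, ← List.sum_toFinset _ hl, Finset.sum_filter, ← Equiv.sum_comp M.α,
        ← Finset.sum_filter_add_sum_filter_not Finset.univ (fun x => x ∈ l)]
      rw [Finset.sum_eq_zero (s := Finset.univ.filter fun x => x ∉ l), add_zero]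
      · refine Finset.sum_congr (by ext; simp) fun x hx => ?_
        simp only [List.mem_toFinset] at hx
        simp [hx, M.α_invol]
      · intro x hx
        simp only [Finset.mem_filter] at hx
        simp [hx.2, M.α_invol]
    rw [e1, e2]
    exact (hp.map _).sum_eq

/-- All Eulerian orientations that extend the one given on `S` are ingoing at `d`. -/
def Forced [Fintype D] (M : RootedMap D) (ω : D → ℤ) (S : Finset D) (d : D) : Prop :=
  ∀ ω', IsOri M ω' → (∀ y ∈ S, ω' y = ω y) → ω' d = -1

/-- The current vertex, with anchor `a`, and its ancestors, reached by the downward half-edges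
`b`: each of these was forced when it was met. -/
def Chain [Fintype D] (M : RootedMap D) (ω : D → ℤ) : Finset D → D → List D → Prop
  | _, a, [] => a = M.root
  | S, a, d :: b => a = M.α d ∧ d ∈ S ∧ ω d = -1 ∧
      M.vertexOf a ∉ (d :: b).map M.vertexOf ∧
      ∃ S₀ a', S₀ ⊆ S ∧ d ∉ S₀ ∧ M.α d ∉ S₀ ∧ Forced M ω S₀ d ∧ M.vertexOf d = M.vertexOf a' ∧
        Chain M ω S₀ a' b

/-- Each forcing condition involves the orientation only on the set visited at that time, so the
orientation may be changed outside the visited set. -/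
theorem Chain.mono [Fintype D] {M : RootedMap D} {ω ω' : D → ℤ} {S S' : Finset D} {a : D}
    {b : List D} (h : Chain M ω S a b) (hS : S ⊆ S') (hω : ∀ y ∈ S, ω' y = ω y) :
    Chain M ω' S' a b := by
  induction b generalizing S S' a with
  | nil => exact h
  | cons d b ih =>
    obtain ⟨h1, h2, h3, h4, S₀, a', h5, h6, h7, h8, h9, h10⟩ := h
    refine ⟨h1, hS h2, by rw [hω d h2, h3], h4, S₀, a', h5.trans hS, h6, h7, ?_, h9,
      ih h10 (Finset.Subset.refl _) fun y hy => hω y (h5 hy)⟩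
    intro ω'' h11 h12
    exact h8 ω'' h11 fun y hy => by rw [h12 y hy, hω y (h5 hy)]

theorem Chain.not_mem [Fintype D] {M : RootedMap D} {ω : D → ℤ} {S : Finset D} {a : D}
    {b : List D} (h : Chain M ω S a b) : M.vertexOf a ∉ b.map M.vertexOf := by
  cases b with
  | nil => simp
  | cons d b => exact h.2.2.2.1

theorem Chain.anchor [Fintype D] {M : RootedMap D} {ω : D → ℤ} {S : Finset D} {a : D}
    {b : List D} (h : Chain M ω S a b) {d : D} (hd : d ∈ b) :
    M.α d = a ∨ M.vertexOf (M.α d) ∈ b.map M.vertexOf := by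
  induction b generalizing S a with
  | nil => simp at hd
  | cons e b ih =>
    obtain ⟨h1, h2, h3, h4, S₀, a', h5, h6, h7, h8, h9, h10⟩ := h
    rcases List.mem_cons.1 hd with rfl | hd
    · exact Or.inl h1.symm
    · rcases ih h10 hd with h | h
      · refine Or.inr ?_
        rw [h, ← h9]
        simp
      · exact Or.inr (List.mem_cons_of_mem _ h)

/-- The list `l` is the downward path from the ancestor `X` to the current vertex; along it all
vertices cancel except the two ends. The half-edge `e` is the oldest one of the path: when it was
forced, no edge of the path had been visited. -/
theorem Chain.exists_cycle [Fintype D] {M : RootedMap D} {ω : D → ℤ} {S : Finset D} {a : D}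
    {b : List D} (h : Chain M ω S a b) {X : M.Vertex}
    (hX : X ∈ M.vertexOf a :: b.map M.vertexOf) :
    ∃ l : List D, l.Nodup ∧ (∀ y ∈ l, ω y = -1 ∧ y ∈ S) ∧
      (M.vertexOf a :: l.map M.vertexOf).Perm (X :: l.map fun x => M.vertexOf (M.α x)) ∧
      (l = [] ∨ ∃ e ∈ l, ∃ S₀ ⊆ S, Forced M ω S₀ e ∧ ∀ y ∈ l, y ∉ S₀ ∧ M.α y ∉ S₀) := by
  induction b generalizing S a with
  | nil =>
    simp only [List.map_nil, List.mem_singleton] at hX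
    subst hX
    exact ⟨[], by simp⟩
  | cons d b ih =>
    obtain ⟨h1, h2, h3, h4, S₀, a', h5, h6, h7, h8, h9, h10⟩ := h
    rcases List.mem_cons.1 hX with rfl | hX
    · exact ⟨[], by simp⟩
    rw [List.map_cons, h9] at hX
    obtain ⟨l, hl1, hl2, hl3, hl4⟩ := ih h10 hX
    refine ⟨d :: l, List.nodup_cons.2 ⟨fun hd => h6 (hl2 d hd).2, hl1⟩, ?_, ?_, Or.inr ?_⟩
    · intro y hy
      rcases List.mem_cons.1 hy with rfl | hy
      · exact ⟨h3, h2⟩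
      · exact ⟨(hl2 y hy).1, h5 (hl2 y hy).2⟩
    · rw [List.map_cons, List.map_cons, h9, ← h1]
      exact (List.Perm.cons _ hl3).trans (List.Perm.swap _ _ _)
    · rcases hl4 with rfl | ⟨e, he, S₁, hS₁, hf, hl4⟩
      · exact ⟨d, by simp, S₀, h5, h8, by simpa using ⟨h6, h7⟩⟩
      · refine ⟨e, List.mem_cons_of_mem _ he, S₁, hS₁.trans h5, hf, fun y hy => ?_⟩
        rcases List.mem_cons.1 hy with rfl | hy
        · exact ⟨fun h => h6 (hS₁ h), fun h => h7 (hS₁ h)⟩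
        · exact hl4 y hy

/-- A forced half-edge does not lead back to the current vertex or to its ancestors. -/
theorem Chain.not_mem_of_forced [Fintype D] {M : RootedMap D} {ω : D → ℤ} {S : Finset D} {a : D}
    {b : List D} (h : Chain M ω S a b) (hω : IsOri M ω) {c : D} (hc : c ∉ S) (hc' : M.α c ∉ S)
    (hca : M.vertexOf c = M.vertexOf a) (hf : Forced M ω S c) :
    M.vertexOf (M.α c) ∉ M.vertexOf a :: b.map M.vertexOf := by
  intro hX
  obtain ⟨l, hl1, hl2, hl3, hl4⟩ := h.exists_cycle hX
  have hωc : ω c = -1 := hf ω hω fun _ _ => rfl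
  have hall : ∀ y ∈ c :: l, ω y = -1 := by
    intro y hy
    rcases List.mem_cons.1 hy with rfl | hy
    · exact hωc
    · exact (hl2 y hy).1
  -- The edge of `c` and those of the path form a directed cycle, whose reversal is again an
  -- Eulerian orientation.
  have hflip := hω.flip (l := c :: l) (List.nodup_cons.2 ⟨fun h => hc (hl2 c h).2, hl1⟩) hall
    (by rw [List.map_cons, List.map_cons, hca]; exact hl3)
  -- The reversal leaves `S₀` untouched but makes `e` outgoing. It contradicts the forcing of the
  -- oldest edge of the cycle, which is `c` itself when the cycle is a loop.
  have hcontra : ∀ e ∈ c :: l, ∀ S₀ ⊆ S, Forced M ω S₀ e → (∀ y ∈ l, y ∉ S₀ ∧ M.α y ∉ S₀) →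
      False := by
    intro e he S₀ hS₀ hf' hl
    have h1 := hf' _ hflip fun y hy => by
      unfold flipOri
      rw [if_neg]
      rintro (h | h)
      · rcases List.mem_cons.1 h with rfl | h
        · exact hc (hS₀ hy)
        · exact (hl y h).1 hy
      · rcases List.mem_cons.1 h with h | h
        · rw [← h, M.α_invol] at hc'
          exact hc' (hS₀ hy)
        · have := (hl _ h).2
          rw [M.α_invol] at this
          exact this hy
    unfold flipOri at h1
    rw [if_pos (Or.inl he), hall e he] at h1
    norm_num at h1
  rcases hl4 with rfl | ⟨e, he, S₀, hS₀, hf', hl⟩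
  · exact hcontra c (by simp) S (Finset.Subset.refl _) hf (by simp)
  · exact hcontra e (List.mem_cons_of_mem _ he) S₀ hS₀ hf' hl

end Orientation


/-! ### Opening a map into a tree -/

section Exploration

set_option linter.unusedSectionVars false

variable {D : Type} [Fintype D] [DecidableEq D]

/-- The bookkeeping of an exploration: `S` is the set of visited half-edges, `s` lists those
which are unmatched openings, `b` contains the unmatched downward half-edges, and a vertex with
unvisited half-edges is unvisited, or the current one (with anchor `a`), or one of its
ancestors. -/
structure Bookkeeping (M : RootedMap D) (ω : D → ℤ) (S : Finset D) (s b : List D) (a : D) :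
    Prop where
  nodup : s.Nodup
  mem_iff : ∀ y, y ∈ s ↔ y ∈ S ∧ ω y = 1 ∧ M.α y ∉ S
  pending : ∀ y ∈ S, ω y = -1 → M.α y ∉ S → y ∈ b
  fresh : ∀ y, y ∉ S → M.vertexOf y ∈ M.vertexOf a :: b.map M.vertexOf ∨
    ∀ w ∈ S, M.vertexOf w ≠ M.vertexOf y

/-- The half-edges `c, σ c, …` (`m` of them) remain to be visited at the current vertex. -/
structure Exploring (M : RootedMap D) (ω : D → ℤ) (S : Finset D) (s b : List D) (a c : D)
    (m : ℕ) : Prop extends Bookkeeping M ω S s b a where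
  ori : IsOri M ω
  chain : Chain M ω S a b
  anchor : (M.σ ^ m) c = a
  unseen : ∀ i < m, (M.σ ^ i) c ∉ S
  ne : ∀ i < m, (M.σ ^ i) c ≠ a
  inj : ∀ i < m, ∀ j < m, (M.σ ^ i) c = (M.σ ^ j) c → i = j
  seen_anchor : a ∈ S ↔ b = []

/-- The trees `ts` explored at the half-edges `c, σ c, …` (`m` of them). -/
structure Explored (M : RootedMap D) (ω : D → ℤ) (S : Finset D) (s b : List D) (a c : D)
    (m : ℕ) (ts : List (BTree Unit)) (W : List (Entry Unit D)) (ω' : D → ℤ) (S' : Finset D)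
    (s' : List D) : Prop extends Bookkeeping M ω' S' s' b a where
  ori : IsOri M ω'
  agree : ∀ y ∈ S, ω' y = ω y
  mem_visited : ∀ y, y ∈ S' ↔ y ∈ S ∨ y ∈ W.map Prod.snd
  nodup_walk : (W.map Prod.snd).Nodup
  disjoint : ∀ y ∈ W.map Prod.snd, y ∉ S
  new : ∀ y ∈ W.map Prod.snd, (∃ i < m, y = (M.σ ^ i) c) ∨
    (∀ w ∈ S, M.vertexOf w ≠ M.vertexOf y) ∧ M.vertexOf y ∉ M.vertexOf a :: b.map M.vertexOf
  seen : ∀ i < m, (M.σ ^ i) c ∈ S'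
  steps : W.map Prod.fst = (ts.map (BTree.walkFrom ())).flatten
  eulerian : ∀ t ∈ ts, t.NodesEulerian
  opening : ts.map BTree.isOpening = (List.range m).map fun i => decide (ω' ((M.σ ^ i) c) = 1)
  rot : Rot M c W ((M.σ ^ m) c)
  good : ∀ R, Good M.α R s' b → Good M.α (W ++ R) s b

/-- The common end of the three cases of the exploration: `A` is the walk around the first subtree
`t`, leading from `(S, s)` to `(S₁, s₁)`, and the remaining half-edges of the vertex are explored
afterwards. -/
theorem Explored.cons {M : RootedMap D} {ω ω₁ ω' : D → ℤ} {S S₁ S' : Finset D}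
    {s s₁ s' b : List D} {a c : D} {m : ℕ} {t : BTree Unit} {ts : List (BTree Unit)}
    {A W : List (Entry Unit D)} (h : Explored M ω₁ S₁ s₁ b a (M.σ c) m ts W ω' S' s')
    (hω : ∀ y ∈ S, ω₁ y = ω y) (hS : ∀ y, y ∈ S₁ ↔ y ∈ S ∨ y ∈ A.map Prod.snd)
    (hnd : (A.map Prod.snd).Nodup) (hdisj : ∀ y ∈ A.map Prod.snd, y ∉ S)
    (hnew : ∀ y ∈ A.map Prod.snd, y = c ∨
      (∀ w ∈ S, M.vertexOf w ≠ M.vertexOf y) ∧ M.vertexOf y ∉ M.vertexOf a :: b.map M.vertexOf)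
    (hc : c ∈ S₁) (hsteps : A.map Prod.fst = t.walkFrom ()) (ht : t.NodesEulerian)
    (hop : t.isOpening = decide (ω₁ c = 1)) (hrot : Rot M c A (M.σ c))
    (hgood : ∀ R, Good M.α R s₁ b → Good M.α (A ++ R) s b) :
    Explored M ω S s b a c (m + 1) (t :: ts) (A ++ W) ω' S' s' where
  toBookkeeping := h.toBookkeeping
  ori := h.ori
  agree y hy := by rw [h.agree y ((hS y).2 (Or.inl hy)), hω y hy]
  mem_visited y := by rw [h.mem_visited, hS, List.map_append, List.mem_append, or_assoc]
  nodup_walk := by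
    rw [List.map_append, List.nodup_append]
    refine ⟨hnd, h.nodup_walk, ?_⟩
    rintro y hy z hz rfl
    exact h.disjoint y hz ((hS y).2 (Or.inr hy))
  disjoint y hy := by
    rw [List.map_append, List.mem_append] at hy
    rcases hy with hy | hy
    · exact hdisj y hy
    · exact fun hyS => h.disjoint y hy ((hS y).2 (Or.inl hyS))
  new y hy := by
    rw [List.map_append, List.mem_append] at hy
    rcases hy with hy | hy
    · exact (hnew y hy).imp_left fun h => ⟨0, by omega, h⟩
    · rcases h.new y hy with ⟨i, hi, rfl⟩ | ⟨h1, h2⟩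
      · exact Or.inl ⟨i + 1, by omega, by rw [pow_succ]; rfl⟩
      · exact Or.inr ⟨fun w hw => h1 w ((hS w).2 (Or.inl hw)), h2⟩
  seen i hi := by
    cases i with
    | zero => exact (h.mem_visited _).2 (Or.inl hc)
    | succ i =>
      rw [pow_succ]
      exact h.seen i (by omega)
  steps := by rw [List.map_append, hsteps, h.steps]; rfl
  eulerian := by simpa using ⟨ht, h.eulerian⟩
  opening := by
    rw [List.map_cons, h.opening, List.range_succ_eq_map, List.map_cons, List.map_map, hop]
    congr 1
    rw [pow_zero, Equiv.Perm.one_apply, h.agree c hc]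
  rot := by
    rw [rot_append]
    refine ⟨_, hrot, ?_⟩
    rw [pow_succ]
    exact h.rot
  good R hR := by
    rw [List.append_assoc]
    exact hgood _ (h.good R hR)

theorem IsOri.sum_orbit {M : RootedMap D} {ω : D → ℤ} (h : IsOri M ω) (x : D) :
    ∑ i ∈ Finset.range (Function.minimalPeriod M.σ x), ω ((M.σ ^ i) x) = 0 := by
  have hpos : 0 < Function.minimalPeriod M.σ x :=
    Function.minimalPeriod_pos_of_mem_periodicPts (Function.Injective.mem_periodicPts M.σ.injective x)
  have h1 := h.bal.sum_eq_zero (Finset.univ.filter fun y => M.σ.SameCycle x y) fun y hy w hw => by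
    simp only [Finset.mem_filter, Finset.mem_univ, true_and] at hy ⊢
    exact hy.trans (RootedMap.vertexOf_eq_iff.1 hw).symm
  rw [← h1]
  refine Finset.sum_bij (fun i _ => (M.σ ^ i) x) ?_ ?_ ?_ fun _ _ => rfl
  · intro i _
    simp only [Finset.mem_filter, Finset.mem_univ, true_and]
    exact ⟨i, by simp⟩
  · intro i hi j hj hij
    rw [Finset.mem_range] at hi hj
    simp only [Equiv.Perm.coe_pow] at hij
    exact Function.iterate_injOn_Iio_minimalPeriod hi hj hij
  · intro y hy
    simp only [Finset.mem_filter, Finset.mem_univ, true_and] at hy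
    obtain ⟨i, -, hi⟩ := hy.exists_pow_eq'
    refine ⟨i % Function.minimalPeriod M.σ x, Finset.mem_range.2 (Nat.mod_lt _ hpos), ?_⟩
    rw [← hi, Equiv.Perm.coe_pow, Equiv.Perm.coe_pow, Function.iterate_mod_minimalPeriod_eq]

theorem Bookkeeping.fresh_insert {M : RootedMap D} {ω : D → ℤ} {S : Finset D} {s b : List D}
    {a : D} (h : Bookkeeping M ω S s b a) {c : D} (hc : M.vertexOf c = M.vertexOf a) (y : D)
    (hy : y ∉ insert c S) : M.vertexOf y ∈ M.vertexOf a :: b.map M.vertexOf ∨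
    ∀ w ∈ insert c S, M.vertexOf w ≠ M.vertexOf y := by
  rw [Finset.mem_insert, not_or] at hy
  rcases h.fresh y hy.2 with h1 | h1
  · exact Or.inl h1
  · by_cases h2 : M.vertexOf y = M.vertexOf a
    · exact Or.inl (by rw [h2]; simp)
    · refine Or.inr fun w hw => ?_
      rcases Finset.mem_insert.1 hw with rfl | hw
      · rw [hc]
        exact fun h => h2 h.symm
      · exact h1 w hw

/-- After a leaf has been visited. -/
theorem Exploring.step {M : RootedMap D} {ω ω₁ : D → ℤ} {S S₁ : Finset D} {s s₁ b : List D}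
    {a c : D} {m : ℕ} (h : Exploring M ω S s b a c (m + 1)) (hb : Bookkeeping M ω₁ S₁ s₁ b a)
    (hω : IsOri M ω₁) (hagree : ∀ y ∈ S, ω₁ y = ω y) (hS : S ⊆ S₁)
    (hun : ∀ i < m, (M.σ ^ (i + 1)) c ∉ S₁) (ha : a ∈ S₁ → a ∈ S) :
    Exploring M ω₁ S₁ s₁ b a (M.σ c) m where
  toBookkeeping := hb
  ori := hω
  chain := h.chain.mono hS hagree
  anchor := by
    have := h.anchor
    rwa [pow_succ] at this
  unseen i hi := by
    have := hun i hi
    rwa [pow_succ] at this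
  ne i hi := by
    have := h.ne (i + 1) (by omega)
    rwa [pow_succ] at this
  inj i hi j hj hij := by
    have := h.inj (i + 1) (by omega) (j + 1) (by omega) (by rw [pow_succ, pow_succ]; exact hij)
    omega
  seen_anchor := by
    rw [← h.seen_anchor]
    exact ⟨ha, fun h => hS h⟩

theorem Exploring.vertexOf_eq {M : RootedMap D} {ω : D → ℤ} {S : Finset D} {s b : List D}
    {a c : D} {m : ℕ} (h : Exploring M ω S s b a c m) (i : ℕ) :
    M.vertexOf ((M.σ ^ i) c) = M.vertexOf a := by
  rw [RootedMap.vertexOf_eq_iff, ← h.anchor]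
  have h1 : ∀ k : ℕ, M.σ.SameCycle c ((M.σ ^ k) c) := fun k => ⟨k, by simp⟩
  exact (h1 i).symm.trans (h1 m)

/-- Induction on the number of unvisited half-edges. If `α c` is visited, `c` is a closing leaf, and
its index is the position of `α c` in the stack. If `c` is forced, the vertex of `α c` is new and is
explored first. Otherwise the orientation is replaced by one that is outgoing at `c` and agrees with
it on `S`, and `c` is an opening leaf. -/
theorem exists_explored {M : RootedMap D} {ω : D → ℤ} {S : Finset D} {s b : List D} {a c : D}
    {m : ℕ} (h : Exploring M ω S s b a c m) :
    ∃ ts W ω' S' s', Explored M ω S s b a c m ts W ω' S' s' := by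
  induction hN : (Sᶜ).card using Nat.strong_induction_on generalizing ω S s b a c m with
  | _ N ih =>
  subst hN
  have hlt : ∀ {S₁ : Finset D} {x : D}, S ⊆ S₁ → x ∈ S₁ → x ∉ S → (S₁ᶜ).card < (Sᶜ).card := by
    intro S₁ x hS hx hx'
    refine Finset.card_lt_card ⟨Finset.compl_subset_compl.2 hS, fun h => ?_⟩
    have := h (Finset.mem_compl.2 hx')
    exact Finset.mem_compl.1 this hx
  cases m with
  | zero =>
    exact ⟨[], [], ω, S, s, h.toBookkeeping, h.ori, fun _ _ => rfl, by simp, by simp, by simp,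
      by simp, by simp, by simp, by simp, by simp, rfl, fun R hR => hR⟩
  | succ m =>
  have hcS : c ∉ S := h.unseen 0 (by omega)
  have hca : c ≠ a := h.ne 0 (by omega)
  have hvc : M.vertexOf c = M.vertexOf a := h.vertexOf_eq 0
  have hun : ∀ i < m, (M.σ ^ (i + 1)) c ∉ insert c S := by
    intro i hi
    rw [Finset.mem_insert, not_or]
    refine ⟨fun h1 => ?_, h.unseen (i + 1) (by omega)⟩
    have := h.inj (i + 1) (by omega) 0 (by omega) h1
    omega
  have ha : a ∈ insert c S → a ∈ S := fun h1 =>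
    (Finset.mem_insert.1 h1).resolve_left hca.symm
  by_cases hαc : M.α c ∈ S
  · -- a closing leaf
    -- Otherwise `α c` would be a pending ingoing half-edge, hence one of the list `b`. Then `c`
    -- would be the anchor, or its vertex would be a proper ancestor of itself.
    have hωc : ω c = -1 := by
      refine (h.ori.pm c).resolve_left fun h1 => ?_
      have h2 := h.pending (M.α c) hαc (by rw [h.ori.anti, h1]) (by rw [M.α_invol]; exact hcS)
      have h3 := h.chain.anchor h2
      rw [M.α_invol] at h3
      rcases h3 with h3 | h3
      · exact hca h3
      · rw [hvc] at h3
        exact h.chain.not_mem h3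
    have hmem : M.α c ∈ s := (h.mem_iff _).2 ⟨hαc, by rw [h.ori.anti, hωc]; rfl, by
      rw [M.α_invol]; exact hcS⟩
    obtain ⟨ι, hι, hιc⟩ := List.getElem_of_mem hmem
    have hb : Bookkeeping M ω (insert c S) (s.eraseIdx ι) b a := by
      refine ⟨h.nodup.eraseIdx ι, fun y => ?_, fun y hy h1 h2 => ?_, h.fresh_insert hvc⟩
      · have h1 : y ∈ s.eraseIdx ι ↔ y ∈ s ∧ y ≠ M.α c := by
          rw [← h.nodup.erase_getElem ι hι, h.nodup.mem_erase_iff, hιc, and_comm]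
        rw [h1, h.mem_iff, Finset.mem_insert, Finset.mem_insert]
        constructor
        · rintro ⟨⟨h2, h3, h4⟩, h5⟩
          refine ⟨Or.inr h2, h3, ?_⟩
          rintro (h6 | h6)
          · exact h5 (by rw [← h6, M.α_invol])
          · exact h4 h6
        · rintro ⟨h2, h3, h4⟩
          rw [not_or] at h4
          refine ⟨⟨h2.resolve_left ?_, h3, h4.2⟩, ?_⟩
          · rintro rfl
            rw [hωc] at h3
            norm_num at h3
          · rintro rfl
            exact h4.1 (M.α_invol c)
      · rw [Finset.mem_insert, not_or] at h2
        rcases Finset.mem_insert.1 hy with rfl | hy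
        · exact absurd hαc h2.2
        · exact h.pending y hy h1 h2.2
    obtain ⟨ts, W, ω', S', s', hout⟩ := ih _ (hlt (Finset.subset_insert c S)
      (Finset.mem_insert_self c S) hcS)
      (h.step hb h.ori (fun _ _ => rfl) (Finset.subset_insert c S) hun ha) rfl
    refine ⟨BTree.closing ι :: ts, _, ω', S', s', hout.cons (A := [((Step.closing ι, ()), c)])
      (fun _ _ => rfl) ?_ (by simp) (by simpa using hcS) (by simp) (by simp) rfl trivial ?_ ?_ ?_⟩
    · intro y
      simp [or_comm]
    · rw [hωc]
      rfl
    · exact ⟨rfl, rfl⟩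
    · intro R hR
      exact ⟨M.α c, by rw [← hιc]; exact List.getElem?_eq_getElem hι, M.α_invol c, hR⟩
  by_cases hf : Forced M ω S c
  · -- a new vertex
    have hωc : ω c = -1 := hf ω h.ori fun _ _ => rfl
    -- The child is neither the current vertex nor an ancestor, so by `fresh` none of its half-edges
    -- has been visited.
    have hver := h.chain.not_mem_of_forced h.ori hcS hαc hvc hf
    have hverc : M.vertexOf (M.α c) ≠ M.vertexOf c := fun h1 => by
      rw [h1, hvc] at hver
      simp at hver
    have hfresh : ∀ w ∈ S, M.vertexOf w ≠ M.vertexOf (M.α c) :=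
      (h.fresh _ hαc).resolve_left hver
    -- `q` is the degree of the new vertex; `n = q - 1` half-edges remain there besides the anchor
    -- `α c`.
    set q := Function.minimalPeriod M.σ (M.α c) with hq
    have hqpos : 0 < q :=
      Function.minimalPeriod_pos_of_mem_periodicPts
        (Function.Injective.mem_periodicPts M.σ.injective _)
    obtain ⟨n, hn⟩ : ∃ n, q = n + 1 := ⟨q - 1, by omega⟩
    have hperiod : (M.σ ^ n) (M.σ (M.α c)) = M.α c := by
      have h1 : (M.σ ^ q) (M.α c) = M.α c := by
        rw [Equiv.Perm.coe_pow]
        exact Function.iterate_minimalPeriod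
      rwa [hn, pow_succ] at h1
    have hinj : ∀ i < q, ∀ j < q, (M.σ ^ i) (M.α c) = (M.σ ^ j) (M.α c) → i = j := by
      intro i hi j hj hij
      simp only [Equiv.Perm.coe_pow] at hij
      exact Function.iterate_injOn_Iio_minimalPeriod hi hj hij
    have hsucc : ∀ i, (M.σ ^ i) (M.σ (M.α c)) = (M.σ ^ (i + 1)) (M.α c) := fun i => by
      rw [pow_succ]; rfl
    have hvert : ∀ i, M.vertexOf ((M.σ ^ i) (M.α c)) = M.vertexOf (M.α c) := fun i =>
      RootedMap.vertexOf_eq_iff.2 (Equiv.Perm.SameCycle.symm ⟨i, by simp⟩)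
    have hnotin : ∀ y, M.vertexOf y = M.vertexOf (M.α c) → y ∉ insert c S := by
      intro y hy h1
      rcases Finset.mem_insert.1 h1 with rfl | h1
      · exact hverc hy.symm
      · exact hfresh y h1 hy
    have hin : Exploring M ω (insert c S) s (c :: b) (M.α c) (M.σ (M.α c)) n := by
      refine ⟨⟨h.nodup, fun y => ?_, fun y hy h1 h2 => ?_, fun y hy => ?_⟩, h.ori, ?_, hperiod,
        fun i _ => ?_, fun i hi h1 => ?_, fun i hi j hj hij => ?_, ?_⟩
      · rw [h.mem_iff, Finset.mem_insert, Finset.mem_insert]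
        constructor
        · rintro ⟨h1, h2, h3⟩
          refine ⟨Or.inr h1, h2, ?_⟩
          rintro (h4 | h4)
          · rw [← h4, M.α_invol] at hαc
            exact hαc h1
          · exact h3 h4
        · rintro ⟨h1, h2, h3⟩
          rw [not_or] at h3
          refine ⟨h1.resolve_left ?_, h2, h3.2⟩
          rintro rfl
          rw [hωc] at h2
          norm_num at h2
      · rw [Finset.mem_insert, not_or] at h2
        rcases Finset.mem_insert.1 hy with rfl | hy
        · simp
        · exact List.mem_cons_of_mem _ (h.pending y hy h1 h2.2)
      · rcases h.fresh_insert hvc y hy with h1 | h1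
        · refine Or.inl ?_
          rw [← hvc] at h1
          exact List.mem_cons_of_mem _ h1
        · exact Or.inr h1
      · refine ⟨rfl, Finset.mem_insert_self c S, hωc, ?_, S, a, Finset.subset_insert c S, hcS, hαc,
          hf, hvc, h.chain⟩
        rw [List.map_cons, hvc]
        exact hver
      · rw [hsucc]
        exact hnotin _ (hvert _)
      · rw [hsucc] at h1
        have := hinj (i + 1) (by omega) 0 (by omega) h1
        omega
      · rw [hsucc, hsucc] at hij
        have := hinj (i + 1) (by omega) (j + 1) (by omega) hij
        omega
      · simp only [reduceCtorEq, iff_false]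
        exact hnotin _ rfl
    obtain ⟨ts₁, W₁, ω₁, S₂, s₂, h₁⟩ := ih _ (hlt (Finset.subset_insert c S)
      (Finset.mem_insert_self c S) hcS) hin rfl
    have hSS₂ : insert c S ⊆ S₂ := fun y hy => (h₁.mem_visited y).2 (Or.inl hy)
    have hω₁c : ω₁ c = -1 := by rw [h₁.agree c (Finset.mem_insert_self c S), hωc]
    have hω₁αc : ω₁ (M.α c) = 1 := by rw [h₁.ori.anti, hω₁c]; rfl
    -- The exploration of the child leaves the current vertex and its ancestors untouched, so the
    -- siblings of `c` are still to be visited.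
    have hold : ∀ y, M.vertexOf y ∈ M.vertexOf a :: b.map M.vertexOf → y ∉ W₁.map Prod.snd := by
      intro y hy h1
      rcases h₁.new y h1 with ⟨i, -, rfl⟩ | ⟨-, h2⟩
      · rw [hsucc, hvert] at hy
        exact hver hy
      · rw [List.map_cons, hvc] at h2
        exact h2 (List.mem_cons_of_mem _ hy)
    have hαcW : M.α c ∉ W₁.map Prod.snd := by
      intro h1
      rcases h₁.new _ h1 with ⟨i, hi, h2⟩ | ⟨-, h2⟩
      · rw [hsucc] at h2
        have := hinj (i + 1) (by omega) 0 (by omega) h2.symm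
        omega
      · simp at h2
    have hcW : c ∉ W₁.map Prod.snd := fun h1 =>
      h₁.disjoint c h1 (Finset.mem_insert_self c S)
    have hαcS₂ : M.α c ∉ S₂ := by
      rw [h₁.mem_visited, not_or]
      exact ⟨hnotin _ rfl, hαcW⟩
    have hall : ∀ y, M.vertexOf y = M.vertexOf (M.α c) → y ∈ insert (M.α c) S₂ := by
      intro y hy
      obtain ⟨i, -, hi⟩ := (RootedMap.vertexOf_eq_iff.1 hy).symm.exists_pow_eq'
      have h1 : (M.σ ^ (i % q)) (M.α c) = y := by
        rw [← hi, Equiv.Perm.coe_pow, Equiv.Perm.coe_pow, Function.iterate_mod_minimalPeriod_eq]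
      have h2 : i % q < q := Nat.mod_lt _ hqpos
      rw [Finset.mem_insert, ← h1]
      cases h3 : i % q with
      | zero => exact Or.inl rfl
      | succ k =>
        rw [← hsucc]
        exact Or.inr (h₁.seen k (by omega))
    have hb : Bookkeeping M ω₁ (insert (M.α c) S₂) s₂ b a := by
      refine ⟨h₁.nodup, fun y => ?_, fun y hy h1 h2 => ?_, fun y hy => ?_⟩
      · rw [h₁.mem_iff, Finset.mem_insert, Finset.mem_insert]
        constructor
        · rintro ⟨h1, h2, h3⟩
          refine ⟨Or.inr h1, h2, ?_⟩
          rintro (h4 | h4)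
          · rw [M.α.injective h4, hω₁c] at h2
            norm_num at h2
          · exact h3 h4
        · rintro ⟨h1, h2, h3⟩
          rw [not_or] at h3
          refine ⟨h1.resolve_left ?_, h2, h3.2⟩
          rintro rfl
          rw [M.α_invol] at h3
          exact h3.2 (hSS₂ (Finset.mem_insert_self c S))
      · rw [Finset.mem_insert, not_or] at h2
        rcases Finset.mem_insert.1 hy with rfl | hy
        · rw [hω₁αc] at h1
          norm_num at h1
        · refine (List.mem_cons.1 (h₁.pending y hy h1 h2.2)).resolve_left ?_
          rintro rfl
          exact h2.1 rfl
      · have h0 : M.vertexOf y ≠ M.vertexOf (M.α c) := fun h1 => hy (hall y h1)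
        rw [Finset.mem_insert, not_or] at hy
        rcases h₁.fresh y hy.2 with h1 | h1
        · refine Or.inl ?_
          have := (List.mem_cons.1 h1).resolve_left h0
          rwa [List.map_cons, hvc] at this
        · refine Or.inr fun w hw => ?_
          rcases Finset.mem_insert.1 hw with rfl | hw
          · exact h0.symm
          · exact h1 w hw
    have hsub : S ⊆ insert (M.α c) S₂ :=
      (Finset.subset_insert c S).trans (hSS₂.trans (Finset.subset_insert _ _))
    have hav : a ≠ M.α c := by
      rintro rfl
      simp at hver
    have hnext : Exploring M ω₁ (insert (M.α c) S₂) s₂ b a (M.σ c) m := by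
      refine h.step hb h₁.ori (fun y hy => h₁.agree y (Finset.mem_insert_of_mem hy)) hsub ?_ ?_
      · intro i hi h1
        have hvi := h.vertexOf_eq (i + 1)
        rcases Finset.mem_insert.1 h1 with h1 | h1
        · rw [h1] at hvi
          rw [hvi] at hver
          simp at hver
        · rcases (h₁.mem_visited _).1 h1 with h1 | h1
          · exact hun i hi h1
          · exact hold _ (by rw [hvi]; simp) h1
      · intro h1
        rcases (h₁.mem_visited _).1 ((Finset.mem_insert.1 h1).resolve_left hav) with h1 | h1
        · exact ha h1
        · exact absurd h1 (hold a (by simp))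
    obtain ⟨ts, W, ω', S', s', hout⟩ := ih _ (hlt hsub (Finset.mem_insert_of_mem
      (hSS₂ (Finset.mem_insert_self c S))) hcS) hnext rfl
    have hlen : ts₁.length = n := by simpa using congrArg List.length h₁.opening
    have hchild : List.ofFn (fun j : Fin ts₁.length => ts₁[j]) = ts₁ := List.ofFn_getElem
    refine ⟨BTree.node () ts₁.length (fun j => ts₁[j]) :: ts, _, ω', S', s',
      hout.cons (A := ((Step.down, ()), c) :: (W₁ ++ [((Step.up, ()), M.α c)]))
      (fun y hy => h₁.agree y (Finset.mem_insert_of_mem hy)) ?_ ?_ ?_ ?_ ?_ ?_ ?_ ?_ ?_ ?_⟩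
    · intro y
      rw [Finset.mem_insert, h₁.mem_visited, Finset.mem_insert]
      simp only [List.map_cons, List.map_append, List.mem_cons, List.mem_append, List.map_nil,
        List.not_mem_nil, or_false]
      tauto
    · simp only [List.map_cons, List.map_append, List.map_nil]
      rw [List.nodup_cons, List.nodup_append]
      refine ⟨?_, h₁.nodup_walk, by simp, ?_⟩
      · rw [List.mem_append, not_or]
        exact ⟨hcW, by simpa using (M.α_ne c).symm⟩
      · rintro y hy z hz rfl
        simp only [List.mem_singleton] at hz
        exact hαcW (hz ▸ hy)
    · intro y hy
      simp only [List.map_cons, List.map_append, List.mem_cons, List.mem_append, List.map_nil,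
        List.not_mem_nil, or_false] at hy
      rcases hy with rfl | hy | rfl
      · exact hcS
      · exact fun h1 => h₁.disjoint y hy (Finset.mem_insert_of_mem h1)
      · exact hαc
    · intro y hy
      simp only [List.map_cons, List.map_append, List.mem_cons, List.mem_append, List.map_nil,
        List.not_mem_nil, or_false] at hy
      rcases hy with rfl | hy | rfl
      · exact Or.inl rfl
      · refine Or.inr ?_
        rcases h₁.new y hy with ⟨i, -, rfl⟩ | ⟨h1, h2⟩
        · rw [hsucc, hvert]
          exact ⟨hfresh, hver⟩
        · refine ⟨fun w hw => h1 w (Finset.mem_insert_of_mem hw), ?_⟩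
          rw [List.map_cons, hvc] at h2
          exact fun h3 => h2 (List.mem_cons_of_mem _ h3)
      · exact Or.inr ⟨hfresh, hver⟩
    · exact Finset.mem_insert_of_mem (hSS₂ (Finset.mem_insert_self c S))
    · rw [BTree.walkFrom_node, hchild, ← h₁.steps]
      simp
    · rw [BTree.nodesEulerian_node, hchild]
      refine ⟨⟨_, ?_, rfl⟩, h₁.eulerian⟩
      -- The balance at the new vertex counts its opening leaves: half of the `q` half-edges are
      -- outgoing, and `α c` is one of them.
      have h1 := h₁.ori.sum_orbit (M.α c)
      rw [← hq, hn, Finset.sum_range_succ', pow_zero, Equiv.Perm.one_apply, hω₁αc] at h1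
      have h2 : ts₁.countP BTree.isOpening =
          ((Finset.range n).filter fun i => ω₁ ((M.σ ^ (i + 1)) (M.α c)) = 1).card := by
        have h3 : ts₁.countP BTree.isOpening = (ts₁.map BTree.isOpening).countP id := by
          rw [List.countP_map]
          rfl
        rw [h3, h₁.opening, List.countP_map, List.countP_eq_length_filter,
          ← List.toFinset_card_of_nodup (List.nodup_range.filter _)]
        congr 1
        ext i
        simp [← hsucc]
      have h3 : ∀ i, ω₁ ((M.σ ^ (i + 1)) (M.α c)) =
          2 * (if ω₁ ((M.σ ^ (i + 1)) (M.α c)) = 1 then 1 else 0) - 1 := by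
        intro i
        rcases h₁.ori.pm ((M.σ ^ (i + 1)) (M.α c)) with h | h <;> simp [h]
      rw [Finset.sum_congr rfl fun i _ => h3 i, Finset.sum_sub_distrib, ← Finset.mul_sum,
        ← Finset.sum_filter, Finset.sum_const, Finset.sum_const, Finset.card_range, ← h2] at h1
      simp only [nsmul_eq_mul, mul_one] at h1
      omega
    · rw [hω₁c]
      rfl
    · refine ⟨rfl, ?_⟩
      rw [rot_append]
      refine ⟨M.α c, ?_, rfl, ?_⟩
      · have := h₁.rot
        rwa [hperiod] at this
      · simp [Rot, Step.turn, Step.isLeaf, M.α_invol]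
    · intro R hR
      rw [List.cons_append, List.append_assoc]
      exact h₁.good _ ⟨c, b, rfl, rfl, hR⟩
  · -- an opening leaf
    -- The failure of forcing supplies the new orientation; what was decided on `S` is unchanged.
    unfold Forced at hf
    push Not at hf
    obtain ⟨ω₁, hω₁, hagree, hne⟩ := hf
    have hωc : ω₁ c = 1 := (hω₁.pm c).resolve_right hne
    have hb : Bookkeeping M ω₁ (insert c S) (c :: s) b a := by
      refine ⟨List.nodup_cons.2 ⟨fun h1 => hcS ((h.mem_iff c).1 h1).1, h.nodup⟩, fun y => ?_,
        fun y hy h1 h2 => ?_, h.fresh_insert hvc⟩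
      · rw [List.mem_cons, h.mem_iff, Finset.mem_insert, Finset.mem_insert]
        constructor
        · rintro (rfl | ⟨h1, h2, h3⟩)
          · exact ⟨Or.inl rfl, hωc, not_or.2 ⟨M.α_ne y, hαc⟩⟩
          · refine ⟨Or.inr h1, by rw [hagree y h1, h2], ?_⟩
            rintro (h4 | h4)
            · rw [← h4, M.α_invol] at hαc
              exact hαc h1
            · exact h3 h4
        · rintro ⟨rfl | h1, h2, h3⟩
          · exact Or.inl rfl
          · rw [not_or] at h3
            exact Or.inr ⟨h1, by rw [← hagree y h1, h2], h3.2⟩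
      · rw [Finset.mem_insert, not_or] at h2
        rcases Finset.mem_insert.1 hy with rfl | hy
        · rw [hωc] at h1
          norm_num at h1
        · exact h.pending y hy (by rw [← hagree y hy, h1]) h2.2
    obtain ⟨ts, W, ω', S', s', hout⟩ := ih _ (hlt (Finset.subset_insert c S)
      (Finset.mem_insert_self c S) hcS)
      (h.step hb hω₁ hagree (Finset.subset_insert c S) hun ha) rfl
    refine ⟨BTree.opening :: ts, _, ω', S', s', hout.cons (A := [((Step.opening, ()), c)])
      hagree ?_ (by simp) (by simpa using hcS) (by simp) (by simp) rfl trivial ?_ ?_ ?_⟩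
    · intro y
      simp [or_comm]
    · simp [hωc, BTree.isOpening]
    · exact ⟨rfl, rfl⟩
    · intro R hR
      exact hR

/-- The exploration starts at the root, chosen outgoing and put on the stack as the root leaf. The
final visited set is stable under `σ` and `α`, so it is everything, and no opening is left
unmatched. -/
theorem RootedMap.IsEulerian.exists_closureWord {M : RootedMap D} (hM : M.IsEulerian) :
    ∃ (T : BTree Unit) (W : List (Entry Unit D)), T.IsEnrichedEulerian ∧ T.IsNode ∧
      ClosureWord T M W := by
  obtain ⟨ω, hω, hroot⟩ := hM.exists_isOri
  set q := Function.minimalPeriod M.σ M.root with hq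
  have hqpos : 0 < q :=
    Function.minimalPeriod_pos_of_mem_periodicPts
      (Function.Injective.mem_periodicPts M.σ.injective _)
  obtain ⟨n, hn⟩ : ∃ n, q = n + 1 := ⟨q - 1, by omega⟩
  have hperiod : (M.σ ^ n) (M.σ M.root) = M.root := by
    have h1 : (M.σ ^ q) M.root = M.root := by
      rw [Equiv.Perm.coe_pow]
      exact Function.iterate_minimalPeriod
    rwa [hn, pow_succ] at h1
  have hinj : ∀ i < q, ∀ j < q, (M.σ ^ i) M.root = (M.σ ^ j) M.root → i = j := by
    intro i hi j hj hij
    simp only [Equiv.Perm.coe_pow] at hij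
    exact Function.iterate_injOn_Iio_minimalPeriod hi hj hij
  have hsucc : ∀ i, (M.σ ^ i) (M.σ M.root) = (M.σ ^ (i + 1)) M.root := fun i => by
    rw [pow_succ]; rfl
  have hstart : Exploring M ω {M.root} [M.root] [] M.root (M.σ M.root) n := by
    refine ⟨⟨by simp, fun y => ?_, fun y hy h1 h2 => ?_, fun y hy => ?_⟩, hω, rfl, hperiod,
      fun i hi h1 => ?_, fun i hi h1 => ?_, fun i hi j hj hij => ?_, by simp⟩
    · simp only [List.mem_singleton, Finset.mem_singleton]
      constructor
      · rintro rfl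
        exact ⟨rfl, hroot, M.α_ne _⟩
      · exact fun h => h.1
    · rw [Finset.mem_singleton.1 hy, hroot] at h1
      norm_num at h1
    · simp only [List.map_nil, List.mem_singleton, Finset.mem_singleton, forall_eq]
      by_cases h : M.vertexOf y = M.vertexOf M.root
      · exact Or.inl h
      · exact Or.inr fun h' => h h'.symm
    · rw [Finset.mem_singleton, hsucc] at h1
      have := hinj (i + 1) (by omega) 0 (by omega) h1
      omega
    · rw [hsucc] at h1
      have := hinj (i + 1) (by omega) 0 (by omega) h1
      omega
    · rw [hsucc, hsucc] at hij
      have := hinj (i + 1) (by omega) (j + 1) (by omega) hij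
      omega
  obtain ⟨ts, W, ω', S', s', h⟩ := exists_explored hstart
  have hrootS : M.root ∈ S' := (h.mem_visited _).2 (Or.inl (by simp))
  have hω'root : ω' M.root = 1 := by rw [h.agree _ (by simp), hroot]
  have hrootW : M.root ∉ W.map Prod.snd := fun h1 => h.disjoint _ h1 (by simp)
  have hcur : ∀ y, M.vertexOf y = M.vertexOf M.root → y ∈ S' := by
    intro y hy
    obtain ⟨i, -, hi⟩ := (RootedMap.vertexOf_eq_iff.1 hy).symm.exists_pow_eq'
    have h1 : (M.σ ^ (i % q)) M.root = y := by
      rw [← hi, Equiv.Perm.coe_pow, Equiv.Perm.coe_pow, Function.iterate_mod_minimalPeriod_eq]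
    have h2 : i % q < q := Nat.mod_lt _ hqpos
    rw [← h1]
    cases h3 : i % q with
    | zero => exact hrootS
    | succ k =>
      rw [← hsucc]
      exact h.seen k (by omega)
  have hvclosed : ∀ x ∈ S', ∀ y, M.vertexOf y = M.vertexOf x → y ∈ S' := by
    intro x hx y hy
    by_contra hyS
    rcases h.fresh y hyS with h1 | h1
    · simp only [List.map_nil, List.mem_singleton] at h1
      exact hyS (hcur y h1)
    · exact h1 x hx hy.symm
  -- No ingoing half-edge is pending since `b` is empty, so every boundary half-edge is outgoing.
  -- The flux, which is zero, counts them.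
  have hαclosed : ∀ x ∈ S', M.α x ∈ S' := by
    have h1 := sum_boundary_eq_sum h.ori.anti S'
    rw [h.ori.bal.sum_eq_zero S' hvclosed] at h1
    have h2 : ∀ x ∈ S'.filter (fun x => M.α x ∉ S'), ω' x = 1 := by
      intro x hx
      rw [Finset.mem_filter] at hx
      refine (h.ori.pm x).resolve_right fun h3 => ?_
      have := h.pending x hx.1 h3 hx.2
      simp at this
    rw [Finset.sum_congr rfl h2, Finset.sum_const, nsmul_eq_mul, mul_one] at h1
    intro x hx
    by_contra h3
    have h4 : (S'.filter fun x => M.α x ∉ S').card = 0 := by exact_mod_cast h1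
    rw [Finset.card_eq_zero] at h4
    have h5 : x ∈ S'.filter fun x => M.α x ∉ S' := Finset.mem_filter.2 ⟨hx, h3⟩
    rw [h4] at h5
    simp at h5
  have hall : ∀ x, x ∈ S' := by
    intro x
    obtain ⟨f, hf, rfl⟩ := M.connected M.root x
    have hstab : ∀ g ∈ Subgroup.closure ({M.σ, M.α} : Set (Equiv.Perm D)),
        ∀ y, y ∈ S' ↔ g y ∈ S' := by
      intro g hg
      induction hg using Subgroup.closure_induction with
      | mem g hg =>
        intro y
        rcases hg with rfl | rfl
        · have h1 : M.vertexOf (M.σ y) = M.vertexOf y := RootedMap.vertexOf_eq_iff.2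
            (Equiv.Perm.sameCycle_apply_left.2 (Equiv.Perm.SameCycle.refl _ _))
          exact ⟨fun hy => hvclosed y hy _ h1, fun hy => hvclosed _ hy _ h1.symm⟩
        · exact ⟨hαclosed y, fun hy => by simpa [M.α_invol] using hαclosed _ hy⟩
      | one => exact fun y => Iff.rfl
      | mul g g' _ _ hg hg' => exact fun y => (hg' y).trans (hg (g' y))
      | inv g _ hg => exact fun y => by rw [hg (g⁻¹ y)]; simp
    exact (hstab f hf M.root).1 hrootS
  have hs' : s' = [] := by
    refine List.eq_nil_iff_forall_not_mem.2 fun y hy => ?_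
    exact ((h.mem_iff y).1 hy).2.2 (hall _)
  have hgood : Good M.α W [M.root] [] := by
    have := h.good [] ⟨hs', rfl⟩
    rwa [List.append_nil] at this
  have hlen : ts.length = n := by simpa using congrArg List.length h.opening
  have hchild : List.ofFn (fun j : Fin ts.length => ts[j]) = ts := List.ofFn_getElem
  have hsteps : ((((Step.opening, ()), M.root) :: W : List (Entry Unit D))).map Prod.fst =
      (BTree.node () ts.length fun j => ts[j]).walk := by
    rw [BTree.walk_node, hchild, List.map_cons, h.steps]
  refine ⟨BTree.node () ts.length (fun j => ts[j]), ((Step.opening, ()), M.root) :: W,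
    ⟨rfl, ?_, ?_⟩, trivial, hsteps, ?_, fun d => ?_, ?_, hgood⟩
  · rw [BTree.nodesEulerian_node, hchild]
    refine ⟨⟨_, ?_, rfl⟩, h.eulerian⟩
    have h1 := h.ori.sum_orbit M.root
    rw [← hq, hn, Finset.sum_range_succ', pow_zero, Equiv.Perm.one_apply, hω'root] at h1
    have h2 : ts.countP BTree.isOpening =
        ((Finset.range n).filter fun i => ω' ((M.σ ^ (i + 1)) M.root) = 1).card := by
      have h3 : ts.countP BTree.isOpening = (ts.map BTree.isOpening).countP id := by
        rw [List.countP_map]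
        rfl
      rw [h3, h.opening, List.countP_map, List.countP_eq_length_filter,
        ← List.toFinset_card_of_nodup (List.nodup_range.filter _)]
      congr 1
      ext i
      simp [← hsucc]
    have h3 : ∀ i, ω' ((M.σ ^ (i + 1)) M.root) =
        2 * (if ω' ((M.σ ^ (i + 1)) M.root) = 1 then 1 else 0) - 1 := by
      intro i
      rcases h.ori.pm ((M.σ ^ (i + 1)) M.root) with h | h <;> simp [h]
    rw [Finset.sum_congr rfl fun i _ => h3 i, Finset.sum_sub_distrib, ← Finset.mul_sum,
      ← Finset.sum_filter, Finset.sum_const, Finset.sum_const, Finset.card_range, ← h2] at h1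
    simp only [nsmul_eq_mul, mul_one] at h1
    omega
  · have h1 := hgood.validIndices
    have h2 := BTree.filterMap_code_walk (x := ()) (n := ts.length) (child := fun j => ts[j])
    rw [← hsteps, List.filterMap_map, List.filterMap_cons_some (b := none) (by rfl)] at h2
    rw [← List.tail_eq_of_cons_eq h2]
    exact h1
  · rw [List.map_cons, List.nodup_cons]
    exact ⟨hrootW, h.nodup_walk⟩
  · have := (h.mem_visited d).1 (hall d)
    simpa using this
  · refine ⟨rfl, ?_⟩
    have := h.rot
    rwa [hperiod] at this

end Exploration


/-! ### Cycles of permutations and transpositions -/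

section Cycles

variable {D : Type}

/-- The number of cycles, including fixed points. -/
noncomputable def numCycles (f : Equiv.Perm D) : ℕ :=
  Nat.card (Quotient (Equiv.Perm.SameCycle.setoid f))

theorem mk_eq_mk_iff_sameCycle {f : Equiv.Perm D} {x y : D} :
    (Quotient.mk (Equiv.Perm.SameCycle.setoid f) x = Quotient.mk _ y) ↔ f.SameCycle x y :=
  Quotient.eq (r := Equiv.Perm.SameCycle.setoid f)

variable [DecidableEq D] [Finite D]

/-- The orbit of `f` is followed from `x` to `y`. The two permutations differ only in the successors
of `a` and `b`, so where the orbit is broken, each side is connected to `a` or `b`. -/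
theorem sameCycle_mul_swap_or {f : Equiv.Perm D} (a b : D) {x y : D} (h : f.SameCycle x y) :
    (f * Equiv.swap a b).SameCycle x y ∨
      (((f * Equiv.swap a b).SameCycle x a ∨ (f * Equiv.swap a b).SameCycle x b) ∧
        ((f * Equiv.swap a b).SameCycle y a ∨ (f * Equiv.swap a b).SameCycle y b)) := by
  obtain ⟨n, rfl⟩ := h.exists_nat_pow_eq
  clear h
  set f' := f * Equiv.swap a b with hf'
  induction n with
  | zero => exact Or.inl (Equiv.Perm.SameCycle.refl _ _)
  | succ n ih =>
    set y := (f ^ n) x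
    have hy : (f ^ (n + 1)) x = f y := by rw [pow_succ']; rfl
    rw [hy]
    have hstep : ∀ z, f'.SameCycle z (f' z) := fun z =>
      Equiv.Perm.sameCycle_apply_right.2 (Equiv.Perm.SameCycle.refl _ _)
    by_cases ha : y = a
    · have h1 : f y = f' b := by simp [hf', ha]
      refine Or.inr ⟨?_, Or.inr (h1 ▸ (hstep b).symm)⟩
      rcases ih with h | h
      · exact Or.inl (ha ▸ h)
      · exact h.1
    by_cases hb : y = b
    · have h1 : f y = f' a := by simp [hf', hb]
      refine Or.inr ⟨?_, Or.inl (h1 ▸ (hstep a).symm)⟩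
      rcases ih with h | h
      · exact Or.inr (hb ▸ h)
      · exact h.1
    · have h1 : f y = f' y := by simp [hf', Equiv.swap_apply_of_ne_of_ne ha hb]
      rw [h1]
      rcases ih with h | ⟨h, h2⟩
      · exact Or.inl (h.trans (hstep y))
      · exact Or.inr ⟨h, h2.imp (fun k => (hstep y).symm.trans k) fun k => (hstep y).symm.trans k⟩

/-- Apart from the cycle of `a`, distinct cycles of the product lie over distinct cycles of `f`: a
cycle of `f` can only break into the pieces that contain `a` and `b`. -/
theorem numCycles_mul_swap_le (f : Equiv.Perm D) (a b : D) :
    numCycles (f * Equiv.swap a b) ≤ numCycles f + 1 := by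
  classical
  set f' := f * Equiv.swap a b with hf'
  have hout : ∀ c : Quotient (Equiv.Perm.SameCycle.setoid f'), Quotient.mk _ c.out = c :=
    fun c => c.out_eq
  let g : Quotient (Equiv.Perm.SameCycle.setoid f') →
      Option (Quotient (Equiv.Perm.SameCycle.setoid f)) := fun c =>
    if f'.SameCycle c.out a then none else some (Quotient.mk _ c.out)
  have hg : Function.Injective g := by
    intro c d hcd
    rw [← hout c, ← hout d, mk_eq_mk_iff_sameCycle]
    by_cases hc : f'.SameCycle c.out a
    · by_cases hd : f'.SameCycle d.out a
      · exact hc.trans hd.symm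
      · simp [g, hc, hd] at hcd
    · by_cases hd : f'.SameCycle d.out a
      · simp [g, hc, hd] at hcd
      · simp only [g, hc, hd, if_false, Option.some.injEq, mk_eq_mk_iff_sameCycle] at hcd
        rcases sameCycle_mul_swap_or a b hcd with h | ⟨h1, h2⟩
        · exact h
        · exact (h1.resolve_left hc).trans (h2.resolve_left hd).symm
  have h1 := Nat.card_le_card_of_injective g hg
  rwa [Finite.card_option] at h1

/-- From `a` the product jumps to `f b` and then copies the orbit of `b` until its first return, at
time `n`; it does not meet `a` because `a` lies on another cycle. -/
theorem sameCycle_mul_swap {f : Equiv.Perm D} {a b : D} (h : ¬ f.SameCycle a b) :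
    (f * Equiv.swap a b).SameCycle a b := by
  set f' := f * Equiv.swap a b with hf'
  have hex : ∃ n, 0 < n ∧ (f ^ n) b = b :=
    ⟨orderOf f, orderOf_pos f, by simp [pow_orderOf_eq_one]⟩
  have hn := Nat.find_spec hex
  set n := Nat.find hex
  have key : ∀ k, k + 1 ≤ n → (f' ^ (k + 1)) a = (f ^ (k + 1)) b := by
    intro k
    induction k with
    | zero => intro _; simp [hf']
    | succ k ih =>
      intro hk
      have h1 : (f ^ (k + 1)) b ≠ a := fun h2 =>
        h (Equiv.Perm.SameCycle.symm ⟨(k + 1 : ℕ), by rw [zpow_natCast]; exact h2⟩)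
      have h2 : (f ^ (k + 1)) b ≠ b := fun h2 => Nat.find_min hex hk ⟨by omega, h2⟩
      rw [pow_succ', Equiv.Perm.mul_apply, ih (by omega), hf', Equiv.Perm.mul_apply,
        Equiv.swap_apply_of_ne_of_ne h1 h2, pow_succ' f (k + 1), Equiv.Perm.mul_apply]
  refine ⟨(n : ℕ), ?_⟩
  rw [zpow_natCast]
  have := key (n - 1) (by omega)
  rw [Nat.sub_add_cancel hn.1] at this
  rw [this, hn.2]

/-- The cycles of `a` and `b` are merged and no other cycle breaks; the cycle of `b` can then be
spared in a surjection onto the cycles of the product. -/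
theorem numCycles_mul_swap_lt {f : Equiv.Perm D} {a b : D} (h : ¬ f.SameCycle a b) :
    numCycles (f * Equiv.swap a b) + 1 ≤ numCycles f := by
  classical
  have hab := sameCycle_mul_swap h
  have hor := fun {x y : D} (k : f.SameCycle x y) => sameCycle_mul_swap_or a b k
  set f' := f * Equiv.swap a b with hf'
  have hor' : ∀ {x y : D}, f.SameCycle x y → f'.SameCycle x y := by
    intro x y k
    rcases hor k with h1 | ⟨h1, h2⟩
    · exact h1
    · have h3 : f'.SameCycle x b := h1.elim (fun k => k.trans hab) id
      have h4 : f'.SameCycle y b := h2.elim (fun k => k.trans hab) id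
      exact h3.trans h4.symm
  let g : Quotient (Equiv.Perm.SameCycle.setoid f) →
      Option (Quotient (Equiv.Perm.SameCycle.setoid f')) := fun c =>
    if f.SameCycle c.out b then none else some (Quotient.mk _ c.out)
  have hout : ∀ x : D, f.SameCycle
      (Quotient.mk (Equiv.Perm.SameCycle.setoid f) x).out x :=
    fun x => mk_eq_mk_iff_sameCycle.1 (Quotient.out_eq _)
  have hg : Function.Surjective g := by
    rintro (_ | c)
    · exact ⟨Quotient.mk _ b, by simp [g, hout b]⟩
    · induction c using Quotient.inductionOn with
      | h x =>
        by_cases hx : f.SameCycle x b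
        · refine ⟨Quotient.mk _ a, ?_⟩
          have h1 : ¬ f.SameCycle (Quotient.mk (Equiv.Perm.SameCycle.setoid f) a).out b :=
            fun k => h ((hout a).symm.trans k)
          simp only [g, h1, if_false, Option.some.injEq, mk_eq_mk_iff_sameCycle]
          exact (hor' (hout a)).trans (hab.trans (hor' hx).symm)
        · refine ⟨Quotient.mk _ x, ?_⟩
          have h1 : ¬ f.SameCycle (Quotient.mk (Equiv.Perm.SameCycle.setoid f) x).out b :=
            fun k => hx ((hout x).symm.trans k)
          simp only [g, h1, if_false, Option.some.injEq, mk_eq_mk_iff_sameCycle]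
          exact hor' (hout x)
  have h1 := Nat.card_le_card_of_surjective g hg
  rwa [Finite.card_option] at h1

end Cycles

/-! ### Cycles of a product with an involution -/

section Involutions

variable {D : Type} [DecidableEq D] [Fintype D]

theorem exists_peel {τ : Equiv.Perm D} (hτ : ∀ x, τ (τ x) = x) {x : D} (hx : τ x ≠ x) :
    ∃ τ' : Equiv.Perm D, (∀ x, τ' (τ' x) = x) ∧ τ = Equiv.swap x (τ x) * τ' ∧
      τ'.support.card + 2 ≤ τ.support.card ∧ ∀ z, z ≠ x → z ≠ τ x → τ' z = τ z := by
  have h0 : ∀ z, z ≠ x → z ≠ τ x → (Equiv.swap x (τ x) * τ) z = τ z := fun z h1 h2 => by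
    rw [Equiv.Perm.mul_apply, Equiv.swap_apply_of_ne_of_ne]
    · exact fun h => h2 (by rw [← h, hτ])
    · exact fun h => h1 (τ.injective h)
  have h1 : (Equiv.swap x (τ x) * τ) x = x := by simp
  have h2 : (Equiv.swap x (τ x) * τ) (τ x) = τ x := by simp [hτ]
  refine ⟨Equiv.swap x (τ x) * τ, fun z => ?_, ?_, ?_, h0⟩
  · by_cases hzx : z = x
    · rw [hzx, h1, h1]
    by_cases hzy : z = τ x
    · rw [hzy, h2, h2]
    · rw [h0 z hzx hzy, h0, hτ]
      · exact fun h => hzy (by rw [← h, hτ])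
      · exact fun h => hzx (τ.injective h)
  · rw [← mul_assoc, Equiv.swap_mul_self, one_mul]
  · have h3 : (Equiv.swap x (τ x) * τ).support ⊆ τ.support \ {x, τ x} := by
      intro z hz
      rw [Equiv.Perm.mem_support] at hz
      have hzx : z ≠ x := fun h => hz (by rw [h, h1])
      have hzy : z ≠ τ x := fun h => hz (by rw [h, h2])
      rw [h0 z hzx hzy] at hz
      simp [hz, hzx, hzy]
    have h4 : ({x, τ x} : Finset D) ⊆ τ.support := by
      intro z hz
      rcases Finset.mem_insert.1 hz with rfl | hz
      · simpa using hx
      · rw [Finset.mem_singleton] at hz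
        simpa [hz, hτ] using hx.symm
    have h5 := Finset.card_le_card h3
    rw [Finset.card_sdiff_of_subset h4, Finset.card_pair hx.symm] at h5
    have h6 := Finset.card_le_card h4
    rw [Finset.card_pair hx.symm] at h6
    omega

/-- The transpositions of `τ` are peeled off one by one: each takes two points of the support and
creates at most one cycle. -/
theorem two_mul_numCycles_mul_le (f : Equiv.Perm D) {τ : Equiv.Perm D}
    (hτ : ∀ x, τ (τ x) = x) :
    2 * numCycles (f * τ) ≤ 2 * numCycles f + τ.support.card := by
  induction hn : τ.support.card using Nat.strong_induction_on generalizing f τ with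
  | _ n ih =>
    by_cases h1 : τ = 1
    · rw [h1, mul_one]
      omega
    · obtain ⟨x, hx⟩ : ∃ x, τ x ≠ x := by
        by_contra! h
        exact h1 (Equiv.ext h)
      obtain ⟨τ', h2, h3, h4, -⟩ := exists_peel hτ hx
      have h5 := ih _ (by omega) (f * Equiv.swap x (τ x)) h2 rfl
      have h6 := numCycles_mul_swap_le f x (τ x)
      have h7 : f * τ = f * Equiv.swap x (τ x) * τ' := by rw [mul_assoc, ← h3]
      rw [h7]
      omega

/-- The bound is not attained because the transposition of `z`, taken just after that of `x`, merges
two cycles. -/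
theorem two_mul_numCycles_mul_lt {f : Equiv.Perm D} {τ : Equiv.Perm D}
    (hτ : ∀ x, τ (τ x) = x) {x z : D} (hx : τ x ≠ x) (hz : τ z ≠ z) (hzx : z ≠ x) (hzy : z ≠ τ x)
    (h : ¬ (f * Equiv.swap x (τ x)).SameCycle z (τ z)) :
    2 * numCycles (f * τ) < 2 * numCycles f + τ.support.card := by
  obtain ⟨τ', h2, h3, h4, h5⟩ := exists_peel hτ hx
  rw [← h5 z hzx hzy] at hz h
  obtain ⟨τ'', h2', h3', h4', -⟩ := exists_peel h2 hz
  have h6 := numCycles_mul_swap_le f x (τ x)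
  have h7 := numCycles_mul_swap_lt h
  have h8 := two_mul_numCycles_mul_le
    (f * Equiv.swap x (τ x) * Equiv.swap z (τ' z)) h2'
  have h9 : f * τ = f * Equiv.swap x (τ x) * Equiv.swap z (τ' z) * τ'' := by
    rw [mul_assoc, mul_assoc, ← h3', ← h3]
  rw [h9]
  omega

end Involutions


/-! ### Planarity of closures -/

section Planarity

variable {κ D : Type}

theorem BTree.countP_walkFrom (t : BTree κ) (p : κ) :
    (t.walkFrom p).countP (fun e => !e.1.isLeaf) = 2 * t.nodeData.length := by
  induction t generalizing p with
  | opening => rfl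
  | closing ι => rfl
  | node x n child ih =>
    have h : ∀ ts : List (BTree κ), (∀ t ∈ ts, ∀ p,
        (walkFrom p t).countP (fun e => !e.1.isLeaf) = 2 * t.nodeData.length) →
        ((ts.map (walkFrom x)).flatten).countP (fun e => !e.1.isLeaf) =
          2 * ((ts.map nodeData).flatten).length := by
      intro ts hts
      induction ts with
      | nil => rfl
      | cons t ts ih =>
        simp only [List.map_cons, List.flatten_cons, List.countP_append, List.length_append,
          hts t (by simp) x, ih fun t' ht' => hts t' (by simp [ht'])]
        ring
    have h2 := h (List.ofFn child) (by
      intro t ht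
      rw [List.mem_ofFn] at ht
      obtain ⟨j, rfl⟩ := ht
      exact ih j)
    rw [walkFrom_node, nodeData_node, List.countP_cons, List.countP_append, h2]
    simp [Step.isLeaf]
    ring

/-- There is one edge between nodes for each node other than the root node. -/
theorem BTree.countP_walk {T : BTree κ} (hN : T.IsNode) :
    T.walk.countP (fun e => !e.1.isLeaf) + 2 = 2 * T.nodeData.length := by
  cases T with
  | opening => exact hN.elim
  | closing ι => exact hN.elim
  | node x n child =>
    have h := countP_walkFrom (node x n child) x
    rw [walkFrom_node, List.countP_cons, List.countP_append] at h
    rw [walk_node, List.countP_cons, ← h]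
    simp [Step.isLeaf]

/-- The kind of each half-edge. -/
theorem ClosureWord.exists_step {T : BTree κ} {M : RootedMap D} {W : List (Entry κ D)}
    (h : ClosureWord T M W) : ∃ st : D → Step, ∀ e ∈ W, st e.2 = e.1.1 := by
  have hex : ∀ x, ∃ e ∈ W, e.2 = x := fun x => by simpa using h.complete x
  choose f hf hfx using hex
  refine ⟨fun x => (f x).1.1, fun e he => congrArg Prod.fst ?_⟩
  refine entry_unique h.nodup (x := e.2) ?_ he
  have := hf e.2
  rwa [← Prod.mk.eta (p := f e.2), hfx] at this

theorem ClosureWord.exists_entry {T : BTree κ} {M : RootedMap D} {W : List (Entry κ D)}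
    (h : ClosureWord T M W) (x : D) : ∃ e ∈ W, e.2 = x := by
  simpa using h.complete x

theorem Rot.isLast {M : RootedMap D} {c z : D} {Q R : List (Entry κ D)} {e : Entry κ D}
    (h : Rot M c (Q ++ e :: R) z) :
    c ∈ (Q ++ [e]).map Prod.snd ∧
      ∀ q ∈ Q, M.σ (q.1.1.turn M.α q.2) ∈ (Q ++ [e]).map Prod.snd := by
  induction Q generalizing c with
  | nil => exact ⟨by simp [h.1], by simp⟩
  | cons q Q ih =>
    obtain ⟨h1, h2⟩ := ih h.2
    refine ⟨by simp [h.1], ?_⟩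
    intro q' hq'
    rcases List.mem_cons.1 hq' with rfl | hq'
    · exact List.mem_cons_of_mem _ h1
    · exact List.mem_cons_of_mem _ (h2 q' hq')

/-- Unmatched half-edges are stacked in the order in which they are met. -/
theorem Good.exists_stack {α : D → D} {P R : List (Entry κ D)} {s b : List D}
    (h : Good α (P ++ R) s b) :
    ∃ s' b', Good α R s' b' ∧ s'.reverse.Sublist (s.reverse ++ P.map Prod.snd) := by
  induction P generalizing s b with
  | nil => exact ⟨s, b, h, by simp⟩
  | cons e P ih =>
    obtain ⟨⟨st, l⟩, x⟩ := e
    cases st with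
    | opening =>
      obtain ⟨s', b', h1, h2⟩ := ih h
      exact ⟨s', b', h1, by simpa using h2⟩
    | closing ι =>
      obtain ⟨y, -, -, h⟩ := h
      obtain ⟨s', b', h1, h2⟩ := ih h
      refine ⟨s', b', h1, h2.trans ?_⟩
      exact ((List.eraseIdx_sublist s ι).reverse).append (List.sublist_cons_self _ _)
    | down =>
      obtain ⟨s', b', h1, h2⟩ := ih h
      exact ⟨s', b', h1, h2.trans ((List.Sublist.refl _).append (List.sublist_cons_self _ _))⟩
    | up =>
      obtain ⟨y, b', -, -, h⟩ := h
      obtain ⟨s', b', h1, h2⟩ := ih h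
      exact ⟨s', b', h1, h2.trans ((List.Sublist.refl _).append (List.sublist_cons_self _ _))⟩

theorem BTree.leaves_iff_walk {T : BTree κ} (hN : T.IsNode) {W : List (Entry κ D)}
    (hW : W.map Prod.fst = T.walk) (ι : ℕ) :
    some ι ∈ T.leaves ↔ ∃ l x, ((Step.closing ι, l), x) ∈ W := by
  cases T with
  | opening => exact hN.elim
  | closing ι => exact hN.elim
  | node x n child =>
    have h := filterMap_code_walk (x := x) (n := n) (child := child)
    rw [← hW, List.filterMap_map] at h
    have h2 : some ι ∈ (node x n child).leaves ↔
        some ι ∈ List.filterMap ((fun e : Step × κ => e.1.code) ∘ Prod.fst) W := by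
      rw [h]; simp
    rw [h2, List.mem_filterMap]
    constructor
    · rintro ⟨⟨⟨st, l⟩, y⟩, he, hc⟩
      cases st with
      | opening => simp [Step.code] at hc
      | closing j =>
        simp only [Function.comp, Step.code, Option.some.injEq] at hc
        exact ⟨l, y, hc ▸ he⟩
      | down => simp [Step.code] at hc
      | up => simp [Step.code] at hc
    · rintro ⟨l, y, he⟩
      exact ⟨_, he, rfl⟩

/-- The half-edges on the stack when all matching-indices are zero. -/
def stackAfter : List D → List (Entry κ D) → List D
  | s, [] => s
  | s, ((.opening, _), x) :: W => stackAfter (x :: s) W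
  | s, ((.closing _, _), _) :: W => stackAfter s.tail W
  | s, ((.down, _), _) :: W => stackAfter s W
  | s, ((.up, _), _) :: W => stackAfter s W

theorem stackAfter_append (s : List D) (P R : List (Entry κ D)) :
    stackAfter s (P ++ R) = stackAfter (stackAfter s P) R := by
  induction P generalizing s with
  | nil => rfl
  | cons e P ih =>
    obtain ⟨⟨st, l⟩, x⟩ := e
    cases st <;> exact ih _

theorem Good.stackAfter {α : D → D} {P R : List (Entry κ D)} {s b : List D}
    (h : Good α (P ++ R) s b) (h0 : ∀ ι l x, ((Step.closing ι, l), x) ∈ P → ι = 0) :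
    ∃ b', Good α R (stackAfter s P) b' := by
  induction P generalizing s b with
  | nil => exact ⟨b, h⟩
  | cons e P ih =>
    obtain ⟨⟨st, l⟩, x⟩ := e
    have h0' : ∀ ι l x, ((Step.closing ι, l), x) ∈ P → ι = 0 :=
      fun ι l x hx => h0 ι l x (by simp [hx])
    cases st with
    | opening => exact ih (s := x :: s) h h0'
    | closing ι =>
      obtain ⟨y, -, -, h⟩ := h
      rw [h0 ι l x (by simp), List.eraseIdx_zero] at h
      exact ih h h0'
    | down => exact ih (b := x :: b) h h0'
    | up =>
      obtain ⟨y, b', -, -, h⟩ := h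
      exact ih h h0'

/-- What lies below `x` has not changed since `x` was pushed. Thus the stack before an opening can
be recovered from the stack before its closing. -/
theorem exists_of_suffix_stackAfter {P : List (Entry κ D)} {x : D} {s : List D}
    (h : (x :: s) <:+ stackAfter [] P) :
    ∃ A l B, P = A ++ ((Step.opening, l), x) :: B ∧ stackAfter [] A = s := by
  induction P using List.reverseRecOn with
  | nil => simp [stackAfter] at h
  | append_singleton P e ih =>
    have lift : (x :: s) <:+ stackAfter [] P →
        ∃ A l B, P ++ [e] = A ++ ((Step.opening, l), x) :: B ∧ stackAfter [] A = s := by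
      intro h
      obtain ⟨A, l, B, rfl, hA⟩ := ih h
      exact ⟨A, l, B ++ [e], by simp, hA⟩
    obtain ⟨⟨st, l⟩, y⟩ := e
    rw [stackAfter_append] at h
    cases st with
    | opening =>
      rcases List.suffix_cons_iff.1 h with h | h
      · obtain ⟨rfl, rfl⟩ := List.cons.inj h
        exact ⟨P, l, [], rfl, rfl⟩
      · exact lift h
    | closing ι => exact lift (h.trans (List.tail_suffix _))
    | down => exact lift h
    | up => exact lift h

end Planarity

/-! ### Faces of a closure and Euler's relation -/

section PlanarityFinite

variable {κ D : Type} [DecidableEq D] [Fintype D]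

/-- The permutations whose product is the rotation around faces: the walk, which is cyclic, and the
exchange of matched leaves. -/
theorem ClosureWord.exists_factorization {T : BTree κ} (hN : T.IsNode) {M : RootedMap D}
    {W : List (Entry κ D)} (h : ClosureWord T M W) :
    ∃ f τ : Equiv.Perm D, M.σ * M.α = f * τ ∧ (∀ x, τ (τ x) = x) ∧
      (∀ e ∈ W, τ e.2 = if e.1.1.isLeaf then M.α e.2 else e.2) ∧
      (∀ e ∈ W, f e.2 = M.σ (e.1.1.turn M.α e.2)) ∧ numCycles f = 1 ∧
      (Nat.card D + 2 = τ.support.card + 2 * Nat.card M.Vertex) := by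
  obtain ⟨st, hst⟩ := h.exists_step
  have hα : ∀ x, (st (M.α x)).isLeaf = (st x).isLeaf := by
    intro x
    obtain ⟨⟨a, x⟩, he, rfl⟩ := h.exists_entry x
    obtain ⟨⟨a', y⟩, he', hy : y = _⟩ := h.exists_entry (M.α x)
    subst hy
    rw [hst _ he', hst _ he]
    exact h.good.isLeaf_eq M.α_invol h.nodup he he'
  have hinv : Function.Involutive fun x => if (st x).isLeaf then M.α x else x := by
    intro x
    by_cases hx : (st x).isLeaf <;> simp [hx, hα, M.α_invol]
  have hinv' : Function.Involutive fun x => if (st x).isLeaf then x else M.α x := by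
    intro x
    by_cases hx : (st x).isLeaf <;> simp [hx, hα, M.α_invol]
  set τ := hinv.toPerm with hτ
  set τ' := hinv'.toPerm with hτ'
  have h1 : M.α = τ' * τ := by
    ext x
    by_cases hx : (st x).isLeaf <;> simp [hτ, hτ', hx, hα]
  refine ⟨M.σ * τ', τ, by rw [h1, mul_assoc], hinv, fun e he => ?_, fun e he => ?_, ?_, ?_⟩
  · simp [hτ, hst e he]
  · simp [hτ', hst e he, Step.turn]
  -- `σ * τ'` sends each half-edge to the next one of the walk, hence has a single cycle.
  · have hconn : ∀ c (V : List (Entry κ D)), (∀ e ∈ V, e ∈ W) → Rot M c V M.root →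
        (M.σ * τ').SameCycle M.root c → ∀ e ∈ V, (M.σ * τ').SameCycle M.root e.2 := by
      intro c V
      induction V generalizing c with
      | nil => simp
      | cons e V ih =>
        intro hV hR hc e' he'
        have h2 : M.σ (e.1.1.turn M.α e.2) = (M.σ * τ') e.2 := by
          simp [hτ', hst e (hV e (by simp)), Step.turn]
        rcases List.mem_cons.1 he' with rfl | he'
        · rw [hR.1]; exact hc
        · refine ih _ (fun e he => hV e (by simp [he])) hR.2 ?_ e' he'
          rw [h2, Equiv.Perm.sameCycle_apply_right, hR.1]
          exact hc
    have h3 := hconn _ W (fun _ => id) h.rot (Equiv.Perm.SameCycle.refl _ _)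
    rw [numCycles, Nat.card_eq_one_iff_unique]
    refine ⟨⟨fun c d => ?_⟩, ⟨Quotient.mk _ M.root⟩⟩
    induction c using Quotient.inductionOn with
    | h x =>
      induction d using Quotient.inductionOn with
      | h y =>
        rw [mk_eq_mk_iff_sameCycle]
        obtain ⟨e, he, rfl⟩ := h.exists_entry x
        obtain ⟨e', he', rfl⟩ := h.exists_entry y
        exact (h3 e he).symm.trans (h3 e' he')
  · have h2 := T.countP_walk hN
    rw [← h.steps, List.countP_map] at h2
    have h3 : W.countP ((fun e => !e.1.isLeaf) ∘ Prod.fst) + τ.support.card = Nat.card D := by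
      have h4 : τ.support.card = W.countP (fun e => e.1.1.isLeaf) := by
        have h5 : τ.support = ((W.filter fun e => e.1.1.isLeaf).map Prod.snd).toFinset := by
          ext x
          obtain ⟨e, he, rfl⟩ := h.exists_entry x
          simp only [Equiv.Perm.mem_support, List.mem_toFinset, List.mem_map, List.mem_filter]
          constructor
          · intro hx
            refine ⟨e, ⟨he, ?_⟩, rfl⟩
            by_contra hl
            exact hx (by simp [hτ, hst e he, hl])
          · rintro ⟨e', ⟨he', hl⟩, hee⟩
            rw [← hee]
            simpa [hτ, hst e' he', hl] using M.α_ne _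
        rw [h5, List.toFinset_card_of_nodup, List.length_map, List.countP_eq_length_filter]
        exact h.nodup.sublist (List.filter_sublist.map _)
      have h5 : Nat.card D = W.length := by
        rw [← Nat.card_congr (List.Nodup.getEquivOfForallMemList _ h.nodup h.complete),
          Nat.card_fin, List.length_map]
      rw [h4, h5, List.length_eq_countP_add_countP (fun e => e.1.1.isLeaf), add_comm]
      congr 2
      ext e
      simp
    rw [h.card_vertex hN]
    omega

/-- A positive index skips the top of the stack. So the match `x` of `y`, the skipped opening `z`,
the closing `y` and the match of `z` occur in this order: two crossing chords. After the
transposition of `x` and `y`, that of `z` merges cycles, and there are too few faces for genus 0. -/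
theorem ClosureWord.not_isPlanar {T : BTree κ} (hN : T.IsNode) {M : RootedMap D}
    {W : List (Entry κ D)} (h : ClosureWord T M W) {ι : ℕ} {l : κ} {y : D}
    (hι : ((Step.closing (ι + 1), l), y) ∈ W) : ¬ M.IsPlanar := by
  obtain ⟨f, τ, h1, h2, h3, h4, h5, h6⟩ := h.exists_factorization hN
  obtain ⟨P, R, hW⟩ := List.append_of_mem hι
  obtain ⟨s, b, hg, hs⟩ := Good.exists_stack (hW ▸ h.good)
  obtain ⟨x, hx, hxy, hg⟩ := hg
  rw [List.reverse_nil, List.nil_append] at hs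
  cases s with
  | nil => simp at hx
  | cons z s =>
    rw [List.getElem?_cons_succ] at hx
    obtain ⟨ι', l', hz⟩ := hg.exists_closing (z := z) (by simp)
    have hxz : [x, z].Sublist (P.map Prod.snd) := by
      refine List.Sublist.trans ?_ hs
      rw [List.reverse_cons]
      exact List.Sublist.append (l₁ := [x])
        (List.singleton_sublist.2 (List.mem_reverse.2 (List.mem_of_getElem? hx)))
        (List.Sublist.refl _)
    obtain ⟨P₀, hP₀, hmap⟩ := List.sublist_map_iff.1 hxz
    obtain ⟨ex, P₁, rfl, rfl, hmap1⟩ := List.map_eq_cons_iff.1 hmap.symm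
    obtain ⟨ez, P₂, rfl, rfl, hmap2⟩ := List.map_eq_cons_iff.1 hmap1
    rw [List.map_eq_nil_iff] at hmap2
    subst hmap2
    rw [List.cons_sublist_iff] at hP₀
    obtain ⟨A, B, rfl, hA, hB⟩ := hP₀
    rw [List.singleton_sublist] at hB
    obtain ⟨A₁, A₂, rfl⟩ := List.append_of_mem hA
    set C := A₂ ++ B with hC
    have hezC : ez ∈ C := List.mem_append_right _ hB
    have hW' : W = A₁ ++ ex :: (C ++ ((Step.closing (ι + 1), l), y) :: R) := by
      rw [hW, hC]; simp
    have hzW : ((Step.closing ι', l'), M.α ez.2) ∈ W := by rw [hW']; simp [hz]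
    have hexW : ex ∈ W := by rw [hW']; simp
    have hezW : ez ∈ W := by rw [hW']; simp [hezC]
    have hnd := h.nodup
    rw [hW'] at hnd
    simp only [List.map_append, List.map_cons] at hnd
    have hτy : τ y = M.α y := by simpa [Step.isLeaf] using h3 _ hι
    have hτz' : τ (M.α ez.2) = ez.2 := by
      have := h3 _ hzW
      simpa [Step.isLeaf, M.α_invol] using this
    have hτx : τ ex.2 = y := by rw [← h2 y, hτy, ← hxy, M.α_invol]
    have hτz : τ ez.2 = M.α ez.2 := by rw [← h2 (M.α ez.2), hτz']
    have hyx : y ≠ ex.2 := by rw [← hxy]; exact M.α_ne _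
    have hrot : Rot M (f ex.2) (C ++ ((Step.closing (ι + 1), l), y) :: R) M.root := by
      have := h.rot
      rw [hW', rot_append] at this
      obtain ⟨c, -, hc⟩ := this
      rw [h4 ex hexW]
      exact hc.2
    obtain ⟨hr1, hr2⟩ := hrot.isLast
    -- `S` is the stretch of the walk after `x`, up to `y`. Once `x` and `y` are exchanged it is
    -- stable; it contains `z` but not its match.
    set S := (C ++ [((Step.closing (ι + 1), l), y)]).map Prod.snd with hS
    have hexS : ex.2 ∉ S := by
      intro hmem
      have h7 := (List.nodup_append.1 hnd).2.1
      rw [List.nodup_cons] at h7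
      refine h7.1 ?_
      simp only [hS, List.map_append, List.map_cons, List.map_nil, List.mem_append,
        List.mem_cons] at hmem ⊢
      tauto
    have hclosed : ∀ w ∈ S, (f * Equiv.swap ex.2 (τ ex.2)) w ∈ S := by
      intro w hw
      by_cases hwy : w = y
      · rw [hwy, hτx]
        simpa using hr1
      · have hwC : w ∈ C.map Prod.snd := by simpa [hS, hwy] using hw
        obtain ⟨e, he, rfl⟩ := List.mem_map.1 hwC
        have hne : e.2 ≠ ex.2 := fun hh => hexS (hh ▸ hw)
        rw [hτx, Equiv.Perm.mul_apply, Equiv.swap_apply_of_ne_of_ne hne hwy, h4 e (by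
          rw [hW']; simp [he])]
        exact hr2 e he
    have hdisj := (List.nodup_cons.1 (List.nodup_append.1 hnd).2.1).2
    have hzS : M.α ez.2 ∉ S := by
      have h7 : (S ++ R.map Prod.snd).Nodup := by simpa [hS] using hdisj
      exact fun hmem => (List.nodup_append.1 h7).2.2 _ hmem _ (List.mem_map_of_mem hz) rfl
    have hnot : ¬ (f * Equiv.swap ex.2 (τ ex.2)).SameCycle ez.2 (τ ez.2) := by
      rw [hτz]
      intro hc
      obtain ⟨n, hn⟩ := hc.exists_nat_pow_eq
      refine hzS (hn ▸ ?_)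
      clear hn
      induction n with
      | zero => simpa [hS] using Or.inl ⟨_, _, hezC⟩
      | succ n ih =>
        rw [pow_succ']
        exact hclosed _ ih
    have hzS' : ez.2 ∈ S := by simpa [hS] using Or.inl ⟨_, _, hezC⟩
    have hlt := two_mul_numCycles_mul_lt h2 (x := ex.2) (z := ez.2) (by rw [hτx]; exact hyx)
      (by rw [hτz]; exact M.α_ne _) (fun hh => hexS (hh ▸ hzS')) (by
        intro hh
        rw [hτx] at hh
        exact (List.nodup_append.1 hdisj).2.2 _ (List.mem_map_of_mem hezC) _ (by simp) hh) hnot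
    rw [← h1, h5] at hlt
    intro hp
    have hF : Nat.card M.Face = numCycles (M.σ * M.α) := rfl
    rw [RootedMap.IsPlanar, hF] at hp
    omega

/-- With zero indices the stack content `lab`, read just before a half-edge, is constant along
faces. Each opening is the top of the stack just after it, and the stack is empty at the root. This
gives one face more than there are openings, the maximum allowed by the transpositions. -/
theorem ClosureWord.isPlanar {T : BTree κ} (hN : T.IsNode) {M : RootedMap D}
    {W : List (Entry κ D)} (h : ClosureWord T M W)
    (h0 : ∀ ι l x, ((Step.closing ι, l), x) ∈ W → ι = 0) : M.IsPlanar := by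
  obtain ⟨f, τ, h1, h2, h3, h4, h5, h6⟩ := h.exists_factorization hN
  have hle := two_mul_numCycles_mul_le f h2
  rw [← h1, h5] at hle
  classical
  suffices hge : τ.support.card + 2 ≤ 2 * numCycles (M.σ * M.α) by
    have hF : Nat.card M.Face = numCycles (M.σ * M.α) := rfl
    rw [RootedMap.IsPlanar, hF]
    omega
  clear hle h6
  have hpos : ∀ x, ∃ P a R, W = P ++ (a, x) :: R := by
    intro x
    obtain ⟨⟨a, x⟩, he, rfl⟩ := h.exists_entry x
    obtain ⟨P, R, hP⟩ := List.append_of_mem he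
    exact ⟨P, a, R, hP⟩
  have huniq : ∀ {P P' R R' : List (Entry κ D)} {a a' : Step × κ} {x : D},
      W = P ++ (a, x) :: R → W = P' ++ (a', x) :: R' → P = P' := by
    have key : ∀ {P R : List (Entry κ D)} {a : Step × κ} {x : D}, W = P ++ (a, x) :: R →
        P = W.takeWhile fun e => e.2 ≠ x := by
      intro P R a x hP
      have hnd := h.nodup
      rw [hP, List.map_append, List.map_cons] at hnd
      rw [hP, List.takeWhile_append_of_pos, List.takeWhile_cons_of_neg (by simp), List.append_nil]
      exact fun e he => by
        simpa using (List.nodup_append.1 hnd).2.2 _ (List.mem_map_of_mem he) x (by simp)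
    intro P P' R R' a a' x hP hP'
    exact (key hP).trans (key hP').symm
  choose pre ent post hpre using hpos
  set lab : D → List D := fun x => stackAfter [] (pre x) with hlab
  have hlab' : ∀ {P a R x}, W = P ++ (a, x) :: R → lab x = stackAfter [] P :=
    fun hP => by rw [hlab, huniq hP (hpre _)]
  have hend : stackAfter [] W = [] := by
    obtain ⟨b, hb⟩ := Good.stackAfter (P := W) (R := []) (by simpa using h.good) h0
    exact hb.1
  have hroot : lab M.root = [] := by
    have := h.rot
    obtain ⟨e, he, -⟩ := h.exists_entry M.root
    cases W with
    | nil => simp at he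
    | cons e W =>
      obtain ⟨a, x⟩ := e
      obtain rfl : x = M.root := this.1
      exact hlab' (P := []) rfl
  have hnext : ∀ {P a R x}, W = P ++ (a, x) :: R →
      lab (f x) = stackAfter [] (P ++ [(a, x)]) := by
    intro P a R x hP
    have hr := h.rot
    rw [hP, rot_append] at hr
    obtain ⟨c, -, -, hr⟩ := hr
    have hf : f x = M.σ (a.1.turn M.α x) := h4 (a, x) (by simp [hP])
    rw [← hf] at hr
    cases R with
    | nil => rw [show f x = M.root from hr, hroot, ← hP, hend]
    | cons e R =>
      obtain ⟨a', x'⟩ := e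
      obtain rfl : x' = f x := hr.1
      exact hlab' (a := a') (R := R) (by rw [hP]; simp)
  -- The stack after a closing is the stack before its opening, and the stack before the closing is
  -- the one after the opening.
  have hmatch : ∀ {P l R x}, W = P ++ ((Step.opening, l), x) :: R →
      lab (f (M.α x)) = lab x ∧ lab (M.α x) = lab (f x) := by
    intro P l R x hP
    obtain ⟨ι, l', hy⟩ := (hP ▸ h.good).closing_of_opening
    have hyW : ((Step.closing ι, l'), M.α x) ∈ W := by rw [hP]; simp [hy]
    obtain ⟨P₂, R₂, hP₂⟩ := List.append_of_mem hyW
    obtain ⟨b, hb⟩ := Good.stackAfter (hP₂ ▸ h.good) fun ι l z hz =>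
      h0 ι l z (by rw [hP₂]; simp [hz])
    obtain ⟨z, hz, hzx, -⟩ := hb
    rw [h0 _ _ _ hyW] at hz
    obtain rfl : z = x := M.α.injective hzx
    obtain ⟨s, hs⟩ : ∃ s, stackAfter [] P₂ = z :: s := by
      cases hst : stackAfter [] P₂ with
      | nil => simp [hst] at hz
      | cons w s => 
        simp only [hst, List.getElem?_cons_zero, Option.some.injEq] at hz
        exact ⟨s, by rw [hz]⟩
    obtain ⟨A, l'', B, hA, hsA⟩ := exists_of_suffix_stackAfter (P := P₂) (x := z) (s := s)
      (by rw [hs])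
    have hPA : P = A := huniq hP (a' := (Step.opening, l''))
      (R' := B ++ ((Step.closing ι, l'), M.α z) :: R₂) (by rw [hP₂, hA]; simp)
    rw [hnext hP₂, hnext hP, hlab' hP, hlab' hP₂, stackAfter_append, stackAfter_append, hs,
      hPA, hsA]
    exact ⟨rfl, rfl⟩
  have hinv : ∀ x, lab ((M.σ * M.α) x) = lab x := by
    intro x
    rw [h1, Equiv.Perm.mul_apply]
    have hx := h3 (ent x, x) (by rw [hpre x]; simp)
    rcases he : ent x with ⟨st, l⟩
    have hP := hpre x
    rw [he] at hP hx
    cases st with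
    | opening =>
      rw [show τ x = M.α x from hx]
      exact (hmatch hP).1
    | closing ι =>
      rw [show τ x = M.α x from hx]
      rcases (hP ▸ h.good).opening_of_closing M.α_invol with hm | ⟨l', hm⟩
      · simp at hm
      · obtain ⟨A, B, hA⟩ := List.append_of_mem hm
        have := (hmatch (P := A) (x := M.α x) (l := l')
          (R := B ++ ((Step.closing ι, l), x) :: post x) (by rw [hP, hA]; simp)).2
        rw [M.α_invol] at this
        exact this.symm
    | down =>
      rw [show τ x = x from hx, hnext hP, hlab' hP, stackAfter_append]
      rfl
    | up =>
      rw [show τ x = x from hx, hnext hP, hlab' hP, stackAfter_append]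
      rfl
  have hinv' : ∀ x y, (M.σ * M.α).SameCycle x y → lab x = lab y := by
    intro x y hxy
    obtain ⟨n, rfl⟩ := hxy.exists_nat_pow_eq
    induction n with
    | zero => rfl
    | succ n ih => rw [pow_succ', Equiv.Perm.mul_apply, hinv]; exact ih ⟨n, rfl⟩
  -- A face is sent to the top of its stack, `none` if the stack is empty; all openings and `none`
  -- are attained.
  let g : Quotient (Equiv.Perm.SameCycle.setoid (M.σ * M.α)) → Option D :=
    Quotient.lift (fun x => (lab x).head?) fun x y hxy => by rw [hinv' x y hxy]
  set O : Finset D := Finset.univ.filter fun x => ∃ l, ((Step.opening, l), x) ∈ W with hO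
  have hrange : (O.insertNone : Set (Option D)) ⊆ Set.range g := by
    intro o ho
    rw [Finset.mem_coe, Finset.mem_insertNone] at ho
    cases o with
    | none => exact ⟨Quotient.mk _ M.root, by simp [g, hroot]⟩
    | some x =>
      obtain ⟨l, hx⟩ := (Finset.mem_filter.1 (ho x rfl)).2
      obtain ⟨P, R, hP⟩ := List.append_of_mem hx
      refine ⟨Quotient.mk _ (f x), ?_⟩
      simp only [g, Quotient.lift_mk, hnext hP, stackAfter_append]
      rfl
  have hcard : O.card + 1 ≤ numCycles (M.σ * M.α) := by
    rw [← Finset.card_insertNone, ← Set.ncard_coe_finset]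
    refine (Set.ncard_le_ncard hrange (Set.toFinite _)).trans ?_
    rw [← Set.image_univ, numCycles, ← Set.ncard_univ]
    exact Set.ncard_image_le (Set.toFinite _)
  have hsupp : τ.support ⊆ O ∪ O.image M.α := by
    intro x hx
    rw [Equiv.Perm.mem_support] at hx
    have hτx := h3 (ent x, x) (by rw [hpre x]; simp)
    have hP := hpre x
    rcases he : ent x with ⟨st, l⟩
    rw [he] at hP hτx
    cases st with
    | opening => exact Finset.mem_union_left _ (Finset.mem_filter.2 ⟨by simp, l, by rw [hP]; simp⟩)
    | closing ι =>
      rcases (hP ▸ h.good).opening_of_closing M.α_invol with hm | ⟨l', hm⟩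
      · simp at hm
      · refine Finset.mem_union_right _ (Finset.mem_image.2 ⟨M.α x, ?_, M.α_invol x⟩)
        exact Finset.mem_filter.2 ⟨by simp, l', by rw [hP]; simp [hm]⟩
    | down => exact (hx hτx).elim
    | up => exact (hx hτx).elim
  have h7 := (Finset.card_le_card hsupp).trans (Finset.card_union_le _ _)
  have h8 : (O.image M.α).card ≤ O.card := Finset.card_image_le
  omega

/-- A closure is planar if and only if all matching-indices are zero. -/
theorem ClosureWord.isPlanar_iff {T : BTree κ} (hN : T.IsNode) {M : RootedMap D}
    {W : List (Entry κ D)} (h : ClosureWord T M W) :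
    M.IsPlanar ↔ ∀ ι, some ι ∈ T.leaves → ι = 0 := by
  constructor
  · intro hp ι hι
    obtain ⟨l, y, hy⟩ := (BTree.leaves_iff_walk hN h.steps ι).1 hι
    cases ι with
    | zero => rfl
    | succ ι => exact (h.not_isPlanar hN hy hp).elim
  · intro h0
    exact h.isPlanar hN fun ι l x hx => h0 ι ((BTree.leaves_iff_walk hN h.steps ι).2 ⟨l, x, hx⟩)

end PlanarityFinite


/-! ### The leaf-extension -/

namespace BTree

/-- The part of the walk around the leaf-extension that replaces a step. -/
def extendStep : Step → List (Step × Bool)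
  | .opening => [(.opening, false)]
  | .closing ι => walkFrom false (branch ι)
  | .down => [(.down, false)]
  | .up => [(.up, false)]

theorem leafExtend_node (l : Unit) (n : ℕ) (child : Fin n → BTree Unit) :
    leafExtend (node l n child) = node false n fun j => (child j).leafExtend := rfl

theorem branch_succ (ι : ℕ) :
    branch (ι + 1) = node true 3 ![closing 0, branch ι, opening] := rfl

theorem ofFn_branch (ι : ℕ) :
    List.ofFn ![closing 0, branch ι, opening] = [closing 0, branch ι, opening] := by
  simp [List.ofFn_succ]

theorem walkFrom_branch_succ (p : Bool) (ι : ℕ) : walkFrom p (branch (ι + 1)) =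
    (.down, p) :: (.closing 0, true) :: (walkFrom true (branch ι) ++
      [(.opening, true), (.up, true)]) := by
  rw [branch_succ, walkFrom_node, ofFn_branch]
  simp [walkFrom]

theorem walkFrom_leafExtend (t : BTree Unit) :
    walkFrom false t.leafExtend = (walkFrom () t).flatMap fun e => extendStep e.1 := by
  induction t with
  | opening => rfl
  | closing ι => simp [leafExtend, walkFrom, extendStep]
  | node l n child ih =>
    rw [leafExtend_node, walkFrom_node, walkFrom_node]
    rw [List.flatMap_cons, List.flatMap_append, List.flatMap_singleton]
    refine congrArg (_ :: ·) (congrArg (· ++ _) ?_)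
    simp only [ih, List.flatMap_def, List.map_flatten, List.map_ofFn, Function.comp_def,
      List.flatten_flatten]

theorem walk_leafExtend {T : BTree Unit} (hN : T.IsNode) :
    T.leafExtend.walk = T.walk.flatMap fun e => extendStep e.1 := by
  cases T with
  | opening => exact hN.elim
  | closing ι => exact hN.elim
  | node l n child =>
    have h := walkFrom_leafExtend (node l n child)
    rw [leafExtend_node, walkFrom_node, walkFrom_node, List.flatMap_cons, List.flatMap_append] at h
    rw [leafExtend_node, walk_node, walk_node, List.flatMap_cons]
    rw [List.flatMap_singleton] at h
    exact congrArg _ (List.append_cancel_right (List.cons.inj h).2)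

theorem isNode_leafExtend {T : BTree Unit} (hN : T.IsNode) : T.leafExtend.IsNode := by
  cases T with
  | opening => exact hN.elim
  | closing ι => exact hN.elim
  | node l n child => trivial

theorem isOpening_branch (ι : ℕ) : (branch ι).isOpening = false := by cases ι <;> rfl

theorem isOpening_leafExtend (t : BTree Unit) : t.leafExtend.isOpening = t.isOpening := by
  cases t with
  | opening => rfl
  | closing ι => exact isOpening_branch ι
  | node l n child => rfl

theorem nodesEulerian_branch (ι : ℕ) : (branch ι).NodesEulerian := by
  induction ι with
  | zero => trivial
  | succ ι ih =>
    rw [branch_succ, nodesEulerian_node, ofFn_branch]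
    refine ⟨⟨2, rfl, ?_⟩, ?_⟩
    · simp [isOpening_branch, show (closing 0 : BTree Bool).isOpening = false from rfl,
        show (opening : BTree Bool).isOpening = true from rfl]
    · intro t ht
      simp only [List.mem_cons, List.not_mem_nil, or_false] at ht
      rcases ht with rfl | rfl | rfl
      · trivial
      · exact ih
      · trivial

theorem NodesEulerian.leafExtend {t : BTree Unit} (ht : t.NodesEulerian) :
    t.leafExtend.NodesEulerian := by
  induction t with
  | opening => trivial
  | closing ι => exact nodesEulerian_branch ι
  | node l n child ih =>
    obtain ⟨⟨k, hk, hc⟩, hch⟩ := ht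
    refine ⟨⟨k, hk, ?_⟩, fun j => ih j (hch j)⟩
    simpa only [isOpening_leafExtend] using hc

theorem leaves_branch_succ (ι : ℕ) :
    (branch (ι + 1)).leaves = some 0 :: ((branch ι).leaves ++ [none]) := by
  rw [branch_succ, leaves_node, ofFn_branch]
  simp [leaves]

/-- The leaves that replace a leaf. -/
def extendLeaf : Option ℕ → List (Option ℕ)
  | none => [none]
  | some ι => (branch ι).leaves

theorem leaves_leafExtend (t : BTree Unit) : t.leafExtend.leaves = t.leaves.flatMap extendLeaf := by
  induction t with
  | opening => rfl
  | closing ι => simp [leafExtend, leaves, extendLeaf]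
  | node l n child ih =>
    simp only [leafExtend_node, leaves, ih, List.flatMap_def, List.map_flatten, List.map_ofFn,
      Function.comp_def, List.flatten_flatten]

/-- The closing leaves of the branch are met at heights `h, h - 1, …, h - ι`, the last of which is
positive, and its `ι` opening leaves then raise the height to `h - 1`. -/
theorem validIndices_branch_append {ι h : ℕ} {l : List (Option ℕ)} (hι : ι < h)
    (hl : ValidIndices (h - 1) l) : ValidIndices h ((branch ι).leaves ++ l) := by
  induction ι generalizing h l with
  | zero => exact ⟨hι, hl⟩
  | succ ι ih =>
    rw [leaves_branch_succ, List.cons_append, List.append_assoc]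
    refine ⟨by omega, ih (by omega) ?_⟩
    change ValidIndices (h - 1 - 1 + 1) l
    rwa [show h - 1 - 1 + 1 = h - 1 by omega]

theorem ValidIndices.flatMap_extendLeaf {h : ℕ} {l : List (Option ℕ)} (hl : ValidIndices h l) :
    ValidIndices h (l.flatMap extendLeaf) := by
  induction l generalizing h with
  | nil => trivial
  | cons a l ih =>
    cases a with
    | none => exact ih (h := h + 1) hl
    | some ι => exact validIndices_branch_append hl.1 (ih hl.2)

theorem IsEnrichedEulerian.leafExtend {T : BTree Unit} (hT : T.IsEnrichedEulerian) :
    T.leafExtend.IsEnrichedEulerian := by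
  refine ⟨by rw [isOpening_leafExtend, hT.1], hT.2.1.leafExtend, ?_⟩
  rw [leaves_leafExtend]
  exact hT.2.2.flatMap_extendLeaf

theorem eq_zero_of_mem_leaves_branch {ι j : ℕ} (h : some j ∈ (branch ι).leaves) : j = 0 := by
  induction ι with
  | zero => simpa [branch, leaves] using h
  | succ ι ih =>
    rw [leaves_branch_succ] at h
    simp only [List.mem_cons, Option.some.injEq, List.mem_append, reduceCtorEq, List.not_mem_nil,
      or_false] at h
    exact h.elim id ih

theorem eq_zero_of_mem_leaves_leafExtend {t : BTree Unit} {j : ℕ}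
    (h : some j ∈ t.leafExtend.leaves) : j = 0 := by
  rw [leaves_leafExtend, List.mem_flatMap] at h
  obtain ⟨a, -, ha⟩ := h
  cases a with
  | none => simp [extendLeaf] at ha
  | some ι => exact eq_zero_of_mem_leaves_branch ha

theorem nodeData_branch (ι : ℕ) : (branch ι).nodeData = List.replicate ι (true, 4) := by
  induction ι with
  | zero => rfl
  | succ ι ih =>
    rw [branch_succ, nodeData_node, ofFn_branch]
    simp [nodeData, ih, List.replicate_succ]

/-- The sum of the matching-indices. -/
def crossings {κ : Type} (t : BTree κ) : ℕ := (t.leaves.filterMap id).sum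

theorem crossings_node {κ : Type} (l : κ) (n : ℕ) (child : Fin n → BTree κ) :
    crossings (node l n child) = ((List.ofFn child).map crossings).sum := by
  rw [crossings, leaves_node]
  induction List.ofFn child with
  | nil => rfl
  | cons t ts ih =>
    simp only [List.map_cons, List.flatten_cons, List.filterMap_append, List.sum_append, ih,
      List.sum_cons]
    rfl

theorem nodeData_leafExtend (t : BTree Unit) :
    t.leafExtend.nodeData.countP (·.1) = t.crossings ∧
      ∀ a ∈ t.leafExtend.nodeData, a.1 = true → a.2 = 4 := by
  induction t with
  | opening => simp [leafExtend, nodeData, crossings, leaves]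
  | closing ι =>
    rw [leafExtend, nodeData_branch]
    refine ⟨by simp [crossings, leaves, List.countP_replicate], ?_⟩
    intro a ha _
    rw [(List.mem_replicate.1 ha).2]
  | node l n child ih =>
    constructor
    · have h : ∀ ts : List (BTree Unit), (∀ t ∈ ts, t.leafExtend.nodeData.countP (·.1) = t.crossings) →
          ((ts.map fun t => t.leafExtend.nodeData).flatten).countP (·.1) =
            (ts.map crossings).sum := by
        intro ts hts
        induction ts with
        | nil => rfl
        | cons t ts ih =>
          rw [List.map_cons, List.flatten_cons, List.countP_append, hts t (by simp),
            ih fun t' ht' => hts t' (by simp [ht'])]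
          rfl
      rw [crossings_node, ← h (List.ofFn child) (by simpa using fun j => (ih j).1), leafExtend_node,
        nodeData_node, List.countP_cons, List.map_ofFn, List.map_ofFn]
      simp [Function.comp_def]
    · rw [leafExtend_node, nodeData_node]
      intro a ha hl
      rcases List.mem_cons.1 ha with rfl | ha
      · simp at hl
      · simp only [List.map_ofFn, List.mem_flatten, List.mem_ofFn, Function.comp] at ha
        obtain ⟨_, ⟨j, rfl⟩, ha⟩ := ha
        exact (ih j).2 a ha hl

end BTree


/-! ### Straight strands -/

section Strands

variable {D : Type} {M : RootedMap D} {X : Set D}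

/-- From a half-edge at which one arrives, one can go straight to arrive at another. -/
def RootedMap.Reach (M : RootedMap D) (X : Set D) : D → D → Prop :=
  Relation.ReflTransGen fun y z => y ∈ X ∧ z = M.α (M.σ (M.σ y))

theorem RootedMap.Arrives.trans_reach {d y z : D} (h : M.Arrives X d y) (hz : M.Reach X y z) :
    M.Arrives X d z := by
  induction hz with
  | refl => exact h
  | tail _ hz ih =>
    rw [hz.2]
    exact .straight ih hz.1

theorem RootedMap.Arrives.reach {d z : D} (h : M.Arrives X d z) : M.Reach X (M.α d) z := by
  induction h with
  | edge => exact .refl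
  | straight _ hy ih => exact ih.tail ⟨hy, rfl⟩

/-- A strand can be followed backwards because, at a crossing-vertex, the opposite of the opposite
half-edge is the initial one. -/
theorem RootedMap.Arrives.symm (hX : ∀ x ∈ X, M.σ x ∈ X ∧ M.σ (M.σ (M.σ (M.σ x))) = x) {d z : D}
    (h : M.Arrives X d z) : M.Arrives X z d := by
  induction h with
  | edge => simpa [M.α_invol] using Arrives.edge (M := M) (X := X) (d := M.α d)
  | @straight y _ hy ih =>
    refine Arrives.trans_reach (y := M.α y) ?_ ih.reach
    have h1 : M.Arrives X (M.α (M.σ (M.σ y))) (M.σ (M.σ y)) := by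
      simpa [M.α_invol] using Arrives.edge (M := M) (X := X) (d := M.α (M.σ (M.σ y)))
    have h2 := h1.straight (hX _ (hX _ hy).1).1
    rwa [(hX _ hy).2] at h2

theorem RootedMap.Reach.opposite (hX : ∀ x ∈ X, M.σ x ∈ X ∧ M.σ (M.σ (M.σ (M.σ x))) = x) {y z : D}
    (h : M.Reach X y z) : y = z ∨ y ∈ X ∧ M.Arrives X z (M.σ (M.σ y)) := by
  induction h using Relation.ReflTransGen.head_induction_on with
  | refl => exact Or.inl rfl
  | @head y w hyw _ ih =>
    obtain ⟨hy, rfl⟩ := hyw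
    refine Or.inr ⟨hy, ?_⟩
    rcases ih with rfl | ⟨h1, h2⟩
    · simpa [M.α_invol] using Arrives.edge (M := M) (X := X) (d := M.α (M.σ (M.σ y)))
    · have h3 := h2.straight (hX _ (hX _ h1).1).1
      rwa [(hX _ h1).2, M.α_invol] at h3

/-- A strand that passes through a half-edge in one direction passes through the opposite half-edge
in the other direction. -/
theorem RootedMap.Arrives.opposite
    (hX : ∀ x ∈ X, M.σ x ∈ X ∧ M.σ (M.σ (M.σ (M.σ x))) = x) {d y z : D}
    (hy : M.Arrives X d y) (hyX : y ∈ X) (hz : M.Arrives X d z) (hzX : z ∉ X) :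
    M.Arrives X z (M.σ (M.σ y)) := by
  -- Going straight is deterministic, so the two arrivals are ordered along the strand; as the
  -- strand stops at `z`, `y` comes first.
  have hun : Relator.RightUnique fun y z => y ∈ X ∧ z = M.α (M.σ (M.σ y)) :=
    fun a b c hb hc => hb.2.trans hc.2.symm
  rcases Relation.ReflTransGen.total_of_right_unique hun hy.reach hz.reach with h | h
  · rcases Reach.opposite hX h with rfl | h
    · exact (hzX hyX).elim
    · exact h.2
  · rcases Relation.ReflTransGen.cases_head h with rfl | ⟨w, hw, -⟩
    · exact (hzX hyX).elim
    · exact (hzX hw.1).elim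

end Strands

/-! ### Strands through the branches -/

section Drawing

variable {D D' : Type}

/-- Each crossing-vertex closes the strand at the top of the stack and reopens it, on the way back,
by the half-edge opposite to the closing one. So the stack loses only its entry `ι`, while the
entries above it have each gone straight through one crossing, in unchanged order. The branch
itself, followed from its end down to `d`, is the strand of the entry `ι`. The last conjunct records
that every half-edge at a crossing lies on one of these strands, in one direction or the other. -/
theorem drawing_branch {M : RootedMap D} {X : Set D} {ι : ℕ} {p : Bool} {d z : D}
    {C R : List (Entry Bool D)} {s b : List D} (hC : C.map Prod.fst = BTree.walkFrom p (BTree.branch ι))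
    (hX : ∀ e ∈ C, e.1.2 = true → e.2 ∈ X) (hr : Rot M d (C ++ R) z)
    (hg : Good M.α (C ++ R) s b) :
    Rot M (M.σ d) R z ∧ ∃ os, os.length = ι ∧ Good M.α R (os ++ s.drop (ι + 1)) b ∧
      (∀ k < ι, ∃ y : D, s[k]? = some y ∧ M.α y ∈ X ∧ os[k]? = some (M.σ (M.σ (M.α y)))) ∧
      (∃ y : D, s[ι]? = some y ∧ M.Reach X (M.α y) d) ∧
      ∀ e ∈ C.tail, M.σ (M.σ (M.σ (M.σ e.2))) = e.2 ∧ ∃ (k : ℕ) (y : D), s[k]? = some y ∧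
        (M.Reach X (M.α y) e.2 ∨ M.Reach X (M.α y) (M.σ (M.σ e.2))) := by
  induction ι generalizing p d C R s b with
  | zero =>
    rw [BTree.branch, BTree.walkFrom, List.map_eq_singleton_iff] at hC
    obtain ⟨⟨a, x⟩, rfl, rfl⟩ := hC
    obtain ⟨rfl, hr⟩ := hr
    obtain ⟨y, hy, rfl, hg⟩ := hg
    refine ⟨hr, [], rfl, ?_, by simp, ⟨y, hy, .refl⟩, by simp⟩
    rw [List.eraseIdx_zero] at hg
    simpa using hg
  | succ ι ih =>
    rw [BTree.walkFrom_branch_succ] at hC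
    obtain ⟨⟨a, x⟩, C₁, rfl, rfl, hC₁⟩ := List.map_eq_cons_iff.1 hC
    obtain ⟨⟨a, c⟩, C₂, rfl, rfl, hC₂⟩ := List.map_eq_cons_iff.1 hC₁
    obtain ⟨C, E, rfl, hC₃, hE⟩ := List.map_eq_append_iff.1 hC₂
    obtain ⟨⟨a, o⟩, E₁, rfl, rfl, hE₁⟩ := List.map_eq_cons_iff.1 hE
    obtain ⟨⟨a, u⟩, E₂, rfl, rfl, hE₂⟩ := List.map_eq_cons_iff.1 hE₁
    obtain rfl := List.map_eq_nil_iff.1 hE₂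
    clear hC hC₁ hC₂ hE hE₁ hE₂
    obtain ⟨rfl, hcd, hr⟩ := hr
    obtain ⟨y, hy, hyc, hg⟩ := hg
    change c = M.σ (M.α x) at hcd
    change Rot M (M.σ c) _ _ at hr
    rw [List.eraseIdx_zero] at hg
    rw [List.append_eq, List.append_assoc] at hr hg
    have hr₀ := hr
    obtain ⟨hr, os, hos, hg, hk, ⟨y', hy', hyd⟩, hcov⟩ := ih hC₃
      (fun e he => hX e (by simp [he])) hr hg
    obtain ⟨ho, hu, hr⟩ := hr
    change o = M.σ (M.σ c) at ho
    change u = M.σ o at hu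
    obtain ⟨y'', b', hb, hux, hg⟩ := hg
    obtain ⟨rfl, rfl⟩ := List.cons.inj hb
    have hur : M.σ u = c := by rw [← hux, hcd]
    have hxu : M.α u = x := by rw [← hux, M.α_invol]
    have hcX : c ∈ X := hX ((.closing 0, true), c) (by simp) rfl
    have hy0 : s = y :: s.tail := by
      cases s with
      | nil => simp at hy
      | cons w s => simp at hy; simp [hy]
    have htl : ∀ k, s.tail[k]? = s[k + 1]? := fun k => by rw [hy0]; rfl
    obtain ⟨e₁, C₁, hC₁, he₁, hl₁⟩ : ∃ e C₁, C = e :: C₁ ∧ e.2 = M.σ c ∧ e.1.2 = true := by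
      obtain ⟨st, w, hw, -⟩ := BTree.walkFrom_head true (BTree.branch ι)
      rw [hw] at hC₃
      obtain ⟨e, C₁, rfl, he, -⟩ := List.map_eq_cons_iff.1 hC₃
      exact ⟨e, C₁, rfl, hr₀.1, by rw [he]⟩
    have hdX : M.σ c ∈ X := he₁ ▸ hX e₁ (by simp [hC₁]) hl₁
    have hdu : M.σ (M.σ (M.σ c)) = u := by rw [hu, ho]
    -- The strand that comes down the rest of the branch goes straight from `σ c` to the upward
    -- half-edge `u`, and thus arrives at `x`.
    have hdR : M.Reach X (M.α y') x := by
      refine hyd.tail ⟨hdX, ?_⟩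
      rw [hdu, hxu]
    refine ⟨?_, o :: os, by simp [hos], ?_, ?_, ⟨y', by rw [← htl]; exact hy', hdR⟩, ?_⟩
    · have : M.σ (M.α u) = M.σ x := by rw [hxu]
      rw [← this]; exact hr
    · rw [hy0]; simpa using hg
    · intro k hk'
      cases k with
      | zero => exact ⟨y, hy, hyc ▸ hcX, by rw [hyc, ho]; rfl⟩
      | succ k =>
        rw [← htl]
        exact hk k (by omega)
    · intro e he
      have h4 : M.σ (M.σ (M.σ (M.σ c))) = c := by rw [hdu, hur]
      have hyc' : M.Reach X (M.α y) c := hyc ▸ .refl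
      simp only [List.tail_cons, List.mem_cons, List.mem_append, List.not_mem_nil, or_false,
        hC₁] at he
      rcases he with rfl | (rfl | he) | rfl | rfl
      · exact ⟨h4, 0, y, hy, Or.inl hyc'⟩
      · refine ⟨by rw [he₁, h4], ι + 1, y', by rw [← htl]; exact hy', Or.inl (he₁ ▸ hyd)⟩
      · obtain ⟨h5, k, w, hw, h6⟩ := hcov e (by simp [hC₁, he])
        exact ⟨h5, k + 1, w, by rw [← htl]; exact hw, h6⟩
      · refine ⟨by simp only [ho, h4], 0, y, hy, Or.inr ?_⟩
        simpa only [ho, h4] using hyc'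
      · refine ⟨by simp only [hu, ho, h4], ι + 1, y', by rw [← htl]; exact hy', Or.inr ?_⟩
        simpa only [hu, ho, h4] using hyd

theorem BTree.eq_true_of_mem_walkFrom_branch {ι : ℕ} {a : Step × Bool}
    (ha : a ∈ walkFrom true (branch ι)) : a.2 = true := by
  induction ι with
  | zero => rw [List.mem_singleton.1 ha]
  | succ ι ih =>
    rw [walkFrom_branch_succ] at ha
    simp only [List.mem_cons, List.mem_append, List.not_mem_nil, or_false] at ha
    rcases ha with rfl | rfl | ha | rfl | rfl
    · rfl
    · rfl
    · exact ih ha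
    · rfl
    · rfl

theorem BTree.extendStep_eq_cons (st : Step) : ∃ st' w, BTree.extendStep st = (st', false) :: w ∧
    ∀ a ∈ w, a.2 = true := by
  cases st with
  | opening => exact ⟨_, _, rfl, by simp⟩
  | down => exact ⟨_, _, rfl, by simp⟩
  | up => exact ⟨_, _, rfl, by simp⟩
  | closing ι =>
    cases ι with
    | zero => exact ⟨_, _, rfl, by simp⟩
    | succ ι =>
      refine ⟨_, _, walkFrom_branch_succ _ _, fun a ha => ?_⟩
      simp only [List.mem_cons, List.mem_append, List.not_mem_nil, or_false] at ha
      rcases ha with rfl | ha | rfl | rfl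
      · rfl
      · exact eq_true_of_mem_walkFrom_branch ha
      · rfl
      · rfl

/-- Chunks are indexed by half-edges rather than by positions, which is possible because no
half-edge is repeated. -/
theorem exists_chunks {W : List (Entry Unit D)} (hW : (W.map Prod.snd).Nodup)
    {V : List (Entry Bool D')}
    (hV : V.map Prod.fst = W.flatMap fun e => BTree.extendStep e.1.1) :
    ∃ g : D → List (Entry Bool D'), V = W.flatMap (fun e => g e.2) ∧
      ∀ e ∈ W, (g e.2).map Prod.fst = BTree.extendStep e.1.1 := by
  classical
  induction W generalizing V with
  | nil => exact ⟨fun _ => [], by simpa using hV, by simp⟩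
  | cons e W ih =>
    rw [List.flatMap_cons, List.map_eq_append_iff] at hV
    obtain ⟨C, V, rfl, hC, hV⟩ := hV
    rw [List.map_cons, List.nodup_cons] at hW
    obtain ⟨g, rfl, hg⟩ := ih hW.2 hV
    have hne : ∀ e' ∈ W, Function.update g e.2 C e'.2 = g e'.2 := fun e' he' =>
      Function.update_of_ne (fun h => hW.1 (List.mem_map.2 ⟨e', he', h⟩)) _ _
    refine ⟨Function.update g e.2 C, ?_, ?_⟩
    · rw [List.flatMap_cons, Function.update_self]
      congr 1
      exact List.flatMap_congr fun e' he' => (hne e' he').symm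
    · intro e' he'
      rcases List.mem_cons.1 he' with rfl | he'
      · rw [Function.update_self, hC]
      · rw [hne e' he', hg e' he']

/-- The correspondence between the half-edges, on a final segment of the walks. -/
theorem drawing_segment {M : RootedMap D} {M' : RootedMap D'} {X : Set D'} {f : D → D'}
    {g : D → List (Entry Bool D')} {W : List (Entry Unit D)}
    (hg : ∀ e ∈ W, (g e.2).map Prod.fst = BTree.extendStep e.1.1)
    (hf : ∀ e ∈ W, ∃ a l, g e.2 = (a, f e.2) :: l)
    (hX : ∀ e ∈ W, ∀ e' ∈ g e.2, e'.1.2 = true → e'.2 ∈ X)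
    {c z : D} {c' : D'} {s b : List D} {s' : List D'}
    (hr : Rot M c W z) (hr' : Rot M' c' (W.flatMap fun e => g e.2) (f z))
    (hm : Good M.α W s b) (hm' : Good M'.α (W.flatMap fun e => g e.2) s' (b.map f))
    (hs : ∀ (k : ℕ) (y : D), s[k]? = some y →
      ∃ y' : D', s'[k]? = some y' ∧ M'.Arrives X (f y) (M'.α y')) (hlen : s'.length = s.length) :
    f c = c' ∧ ∀ e ∈ W, f (M.σ (e.1.1.turn M.α e.2)) = M'.σ (e.1.1.turn M'.α (f e.2)) ∧
      (∀ ι, e.1.1 = .closing ι → M'.Arrives X (f (M.α e.2)) (f e.2)) ∧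
      (e.1.1 = .up → M'.α (f (M.α e.2)) = f e.2) ∧
      ∀ e' ∈ (g e.2).tail, M'.σ (M'.σ (M'.σ (M'.σ e'.2))) = e'.2 ∧
        ∃ y, M'.Arrives X (f y) e'.2 ∨ M'.Arrives X (f y) (M'.σ (M'.σ e'.2)) := by
  induction W generalizing c c' s b s' with
  | nil =>
    rw [Rot] at hr
    rw [List.flatMap_nil, Rot] at hr'
    exact ⟨by rw [hr, hr'], by simp⟩
  | cons e W ih =>
    rw [List.flatMap_cons] at hr' hm'
    have ih := @ih (fun e he => hg e (by simp [he])) (fun e he => hf e (by simp [he]))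
      (fun e he => hX e (by simp [he]))
    have hge := hg e (by simp)
    obtain ⟨a, C, hC⟩ := hf e (by simp)
    have hXe := hX e (by simp)
    obtain ⟨⟨st, l⟩, x⟩ := e
    obtain ⟨rfl, hr⟩ := hr
    simp only at hge hC hXe hr' hm'
    have hc : f x = c' := by
      rw [hC] at hr'
      exact hr'.1
    subst hc
    refine ⟨rfl, ?_⟩
    rw [List.forall_mem_cons]
    have hsingle : ∀ st', [((st', false) : Step × Bool)] = (g x).map Prod.fst →
        g x = [((st', false), f x)] := by
      intro st' h
      rw [hC, List.map_cons, eq_comm, List.cons.injEq] at h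
      obtain ⟨h1, h2⟩ := h
      rw [List.map_eq_nil_iff] at h2
      rw [hC, h2, ← h1]
    cases st with
    | opening =>
      have hx := hsingle .opening hge.symm
      rw [hx] at hr' hm'
      obtain ⟨h1, h2⟩ := ih (s := x :: s) (s' := f x :: s') hr hr'.2 hm hm' (by
        intro k y hk
        cases k with
        | zero => exact ⟨f x, rfl, by obtain rfl : x = y := by simpa using hk
                                      exact RootedMap.Arrives.edge.trans_reach .refl⟩
        | succ k => exact hs k y hk) (by simp [hlen])
      exact ⟨⟨h1, by simp, by simp, by simp [hx]⟩, h2⟩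
    | down =>
      have hx := hsingle .down hge.symm
      rw [hx] at hr' hm'
      obtain ⟨h1, h2⟩ := ih (b := x :: b) hr hr'.2 hm hm' hs hlen
      exact ⟨⟨h1, by simp, by simp, by simp [hx]⟩, h2⟩
    | up =>
      have hx := hsingle .up hge.symm
      rw [hx] at hr' hm'
      obtain ⟨y, b, rfl, rfl, hm⟩ := hm
      obtain ⟨y', b', hb, hy', hm'⟩ := hm'
      obtain ⟨rfl, rfl⟩ := List.cons.inj hb
      obtain ⟨h1, h2⟩ := ih hr hr'.2 hm hm' hs hlen
      refine ⟨⟨h1, by simp, fun _ => ?_, by simp [hx]⟩, h2⟩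
      change M'.α (f (M.α (M.α y))) = _
      rw [M.α_invol, hy']
    | closing ι =>
      obtain ⟨y, hy, rfl, hm⟩ := hm
      obtain ⟨hr', os, hos, hm', hk, ⟨y', hy', hyx⟩, hcov⟩ := drawing_branch hge hXe hr' hm'
      -- The pending openings above position `ι` have moved straight through a crossing of the
      -- branch; those below it are shifted by one position, with strands unchanged.
      obtain ⟨h1, h2⟩ := ih hr hr' hm hm' (by
        intro k w hw
        rcases lt_or_ge k ι with hkι | hkι
        · rw [List.getElem?_eraseIdx_of_lt hkι] at hw
          obtain ⟨v, hv, hvX, hv'⟩ := hk k hkι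
          obtain ⟨v', hv₁, hv₂⟩ := hs k w hw
          obtain rfl : v = v' := by simpa [hv] using hv₁
          exact ⟨_, by rw [List.getElem?_append_left (by omega), hv'], hv₂.straight hvX⟩
        · rw [List.getElem?_eraseIdx_of_ge hkι] at hw
          rw [List.getElem?_append_right (by omega), List.getElem?_drop, hos,
            show ι + 1 + (k - ι) = k + 1 by omega]
          exact hs _ _ hw) (by
        have := (List.getElem?_eq_some_iff.1 hy).1
        simp [List.length_eraseIdx, hos, this, hlen]
        omega)
      refine ⟨⟨h1, fun _ _ => ?_, by simp, fun e' he' => ?_⟩, h2⟩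
      · change M'.Arrives X (f (M.α (M.α y))) _
        rw [M.α_invol]
        obtain ⟨v, hv₁, hv₂⟩ := hs ι y hy
        obtain rfl : y' = v := by simpa [hy'] using hv₁
        exact hv₂.trans_reach hyx
      · obtain ⟨h3, k, w, hw, h4⟩ := hcov e' he'
        refine ⟨h3, ?_⟩
        have hks : k < s.length := hlen ▸ (List.getElem?_eq_some_iff.1 hw).1
        obtain ⟨v, hv₁, hv₂⟩ := hs k s[k] (List.getElem?_eq_getElem hks)
        obtain rfl : w = v := by simpa [hw] using hv₁
        exact ⟨s[k], h4.imp (fun h => hv₂.trans_reach h) fun h => hv₂.trans_reach h⟩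

end Drawing


/-! ### The extended closure as a drawing of the map -/

section Drawing

variable {D D' : Type}

/-- The closure of the leaf-extension is a drawing of the closure. -/
theorem ClosureWord.isDrawingOf {T : BTree Unit} (hN : T.IsNode) {M : RootedMap D}
    {M' : RootedMap D'} {W : List (Entry Unit D)} {W' : List (Entry Bool D')}
    (h : ClosureWord T M W) (h' : ClosureWord T.leafExtend M' W') {X : Set D'}
    (hX : ∀ e ∈ W', e.2 ∈ X ↔ e.1.2 = true) : M'.IsDrawingOf X M := by
  obtain ⟨-, hσX, hdeg⟩ := h'.numVerticesIn (BTree.isNode_leafExtend hN) hX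
  have hV : W'.map Prod.fst = W.flatMap fun e => BTree.extendStep e.1.1 := by
    rw [h'.steps, BTree.walk_leafExtend hN, ← h.steps, List.flatMap_map]
  obtain ⟨g, hgW, hg⟩ := exists_chunks h.nodup hV
  have hhead : ∀ x, ∃ y, ∃ st l, g x = ((st, false), y) :: l ∧ ∀ e ∈ l, e.1.2 = true := by
    intro x
    obtain ⟨e, he, rfl⟩ := h.exists_entry x
    obtain ⟨st, w, hw, hl⟩ := BTree.extendStep_eq_cons e.1.1
    have := hg e he
    rw [hw] at this
    obtain ⟨⟨a, y⟩, l, h1, rfl, h3⟩ := List.map_eq_cons_iff.1 this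
    exact ⟨y, st, l, h1, fun e' he' => hl _ (h3 ▸ List.mem_map_of_mem he')⟩
  -- `f x` is the first half-edge of the chunk of `x`, the only one of the chunk that is not at a
  -- crossing-vertex.
  choose f st tl hf htl using hhead
  have hmem : ∀ e' ∈ W', ∃ x, e' ∈ g x := fun e' he' => by
    rw [hgW, List.mem_flatMap] at he'
    obtain ⟨e, -, he⟩ := he'
    exact ⟨_, he⟩
  have hmem' : ∀ x, ∀ e' ∈ g x, e' ∈ W' := fun x e' he' => by
    obtain ⟨e, he, rfl⟩ := h.exists_entry x
    rw [hgW, List.mem_flatMap]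
    exact ⟨e, he, he'⟩
  have hfX : ∀ x, f x ∉ X := fun x hx => by
    have := (hX ((st x, false), f x) (hmem' x _ (by rw [hf]; simp))).1 hx
    simp at this
  have hroot : f M.root = M'.root := by
    have hr := h.rot
    have hr' := h'.rot
    obtain ⟨e, he, -⟩ := h.exists_entry M.root
    cases W with
    | nil => simp at he
    | cons e W =>
      rw [hgW, List.flatMap_cons, hf, List.cons_append] at hr'
      rw [← hr.1]
      exact hr'.1
  obtain ⟨-, hseg⟩ := drawing_segment (s := []) (s' := []) (b := []) (f := f) (X := X)
    hg (fun e _ => ⟨_, _, hf e.2⟩)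
    (fun e _ e' he' hl => (hX e' (hmem' _ e' he')).2 hl) h.rot (by rw [← hgW, hroot]; exact h'.rot)
    h.good (by rw [← hgW]; exact h'.good) (by simp) rfl
  have hcov : ∀ x ∈ X, M'.σ (M'.σ (M'.σ (M'.σ x))) = x ∧
      ∃ y, M'.Arrives X (f y) x ∨ M'.Arrives X (f y) (M'.σ (M'.σ x)) := by
    intro x hx
    obtain ⟨e', he', rfl⟩ := h'.exists_entry x
    obtain ⟨y, hy⟩ := hmem e' he'
    obtain ⟨e, he, rfl⟩ := h.exists_entry y
    refine (hseg e he).2.2.2 e' ?_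
    rw [hf] at hy ⊢
    rcases List.mem_cons.1 hy with rfl | hy
    · exact (hfX _ hx).elim
    · exact hy
  have hX4 : ∀ x ∈ X, M'.σ x ∈ X ∧ M'.σ (M'.σ (M'.σ (M'.σ x))) = x := fun x hx =>
    ⟨hσX x hx, (hcov x hx).1⟩
  have hup : ∀ {l x}, ((Step.up, l), x) ∈ W → M'.α (f (M.α x)) = f x := fun hx =>
    (hseg _ hx).2.2.1 rfl
  have hdown : ∀ {l x}, ((Step.down, l), x) ∈ W → M'.α (f (M.α x)) = f x := by
    intro l x hx
    obtain ⟨P, R, hP⟩ := List.append_of_mem hx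
    obtain ⟨l', hl'⟩ := (hP ▸ h.good).up_of_down
    have := hup (l := l') (x := M.α x) (by rw [hP]; simp [hl'])
    rw [← this, M'.α_invol, M.α_invol]
  have hclose : ∀ {ι l x}, ((Step.closing ι, l), x) ∈ W → M'.Arrives X (f (M.α x)) (f x) := fun hx =>
    (hseg _ hx).2.1 _ rfl
  have hedge : ∀ x, M'.Arrives X (f x) (f (M.α x)) := by
    intro x
    obtain ⟨⟨⟨s, l⟩, x⟩, he, rfl⟩ := h.exists_entry x
    cases s with
    | opening =>
      obtain ⟨P, R, hP⟩ := List.append_of_mem he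
      obtain ⟨ι, l', hl'⟩ := (hP ▸ h.good).closing_of_opening
      have := hclose (ι := ι) (l := l') (x := M.α x) (by rw [hP]; simp [hl'])
      rwa [M.α_invol] at this
    | closing ι => exact (hclose he).symm hX4
    | down =>
      have := RootedMap.Arrives.edge (M := M') (X := X) (d := f x)
      rwa [← hdown he, M'.α_invol, hdown he] at this
    | up =>
      have := RootedMap.Arrives.edge (M := M') (X := X) (d := f x)
      rwa [← hup he, M'.α_invol, hup he] at this
  refine ⟨fun x hx => ⟨hσX x hx, ?_⟩, fun x hx => ?_, f, ?_, ?_, hroot, fun x => ?_, hedge⟩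
  · obtain ⟨a, ha, hl, hd⟩ := hdeg x hx
    rw [hd, (BTree.nodeData_leafExtend T).2 a ha hl]
  -- If a strand passes through the opposite half-edge, the same edge followed from its other end
  -- passes through `x`.
  · obtain ⟨h4, y, hy | hy⟩ := hcov x hx
    · exact ⟨f y, hfX y, hy⟩
    · have := hy.opposite hX4 (hσX _ (hσX _ hx)) (hedge y) (hfX _)
      rw [h4] at this
      exact ⟨_, hfX _, this⟩
  · have hnd : (W.map fun e => f e.2).Nodup := by
      refine List.Sublist.nodup ?_ h'.nodup
      rw [hgW]
      clear * - hf
      induction W with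
      | nil => simp
      | cons e W ih =>
        rw [List.map_cons, List.flatMap_cons, List.map_append, hf, List.map_cons, List.cons_append]
        exact (ih.trans (List.sublist_append_right _ _)).cons_cons _
    intro x y hxy
    obtain ⟨e, he, rfl⟩ := h.exists_entry x
    obtain ⟨e', he', rfl⟩ := h.exists_entry y
    rw [List.inj_on_of_nodup_map hnd he he' hxy]
  · ext x
    constructor
    · rintro ⟨y, rfl⟩
      exact hfX y
    · intro hx
      obtain ⟨e', he', rfl⟩ := h'.exists_entry x
      obtain ⟨y, hy⟩ := hmem e' he'
      rw [hf] at hy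
      rcases List.mem_cons.1 hy with rfl | hy
      · exact ⟨y, rfl⟩
      · exact (hx ((hX e' he').2 (htl y e' hy))).elim
  · obtain ⟨⟨⟨s, l⟩, x⟩, he, rfl⟩ := h.exists_entry x
    cases s with
    | opening => exact (hseg _ he).1
    | closing ι => exact (hseg _ he).1
    | down =>
      obtain ⟨P, R, hP⟩ := List.append_of_mem he
      obtain ⟨l', hl'⟩ := (hP ▸ h.good).up_of_down
      have hl : ((Step.up, l'), M.α x) ∈ W := by rw [hP]; simp [hl']
      have h1 := (hseg _ hl).1
      have h2 := hup hl
      rw [M.α_invol] at h2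
      change f (M.σ (M.α (M.α x))) = M'.σ (M'.α (f (M.α x))) at h1
      rwa [M.α_invol, ← h2, M'.α_invol] at h1
    | up =>
      obtain ⟨P, R, hP⟩ := List.append_of_mem he
      rcases (hP ▸ h.good).down_of_up M.α_invol with hm | ⟨l', hl'⟩
      · simp at hm
      · have hl : ((Step.down, l'), M.α x) ∈ W := by rw [hP]; simp [hl']
        have h1 := (hseg _ hl).1
        have h2 := hdown hl
        rw [M.α_invol] at h2
        change f (M.σ (M.α (M.α x))) = M'.σ (M'.α (f (M.α x))) at h1
        rwa [M.α_invol, ← h2, M'.α_invol] at h1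

end Drawing

/-! ### Canonical representations and the crossing number -/

section Canonical

variable {D D' : Type}

theorem BTree.isNode_of_isClosure {T : BTree Unit} (hT : T.IsEnrichedEulerian) {M : RootedMap D}
    (h : T.IsClosure M) : T.IsNode := by
  obtain ⟨e, -⟩ := h
  cases T with
  | opening => exact (e.symm M.root).elim0
  | closing ι => exact (e.symm M.root).elim0
  | node l n child => trivial

theorem BTree.IsClosure.unique [Finite D] {T T' : BTree Unit} {M : RootedMap D}
    (hT : T.IsEnrichedEulerian) (hT' : T'.IsEnrichedEulerian) (h : T.IsClosure M)
    (h' : T'.IsClosure M) : T = T' := by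
  have hN := isNode_of_isClosure hT h
  have hN' := isNode_of_isClosure hT' h'
  obtain ⟨e, he⟩ := h
  obtain ⟨e', he'⟩ := h'
  exact closureWord_unique hN hT.2.1 hN' hT'.2.1 (he.closureWord hT hN) (he'.closureWord hT' hN')

theorem RootedMap.IsEulerian.exists_isClosure [Finite D] {M : RootedMap D} (hM : M.IsEulerian) :
    ∃ T : BTree Unit, T.IsEnrichedEulerian ∧ T.IsNode ∧ T.IsClosure M := by
  classical
  have := Fintype.ofFinite D
  obtain ⟨T, W, hT, hN, hW⟩ := hM.exists_closureWord
  exact ⟨T, hT, hN, hW.exists_via hN⟩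

theorem BTree.exists_isClosure {T : BTree Unit} (hT : T.IsEnrichedEulerian) (hN : T.IsNode) :
    ∃ (E : ℕ) (M : RootedMap (Fin (2 * E))), M.IsEulerian ∧ T.IsClosure M := by
  obtain ⟨E, hE⟩ := even_length_walk hT hN
  obtain ⟨M, hM⟩ := exists_isClosureVia hT hN (finCongr hE)
  exact ⟨E, M, (hM.closureWord hT hN).isEulerian hN hT.2.1, _, hM⟩

theorem BTree.exists_isCanonicalRep {T : BTree Unit} (hT : T.IsEnrichedEulerian) (hN : T.IsNode)
    {M : RootedMap D} (h : T.IsClosure M) :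
    ∃ (E' : ℕ) (M' : RootedMap (Fin (2 * E'))) (X : Set (Fin (2 * E'))), M.IsCanonicalRep M' X := by
  obtain ⟨E, hE⟩ := even_length_walk hT.leafExtend (isNode_leafExtend hN)
  obtain ⟨M', hM'⟩ := exists_isClosureVia hT.leafExtend (isNode_leafExtend hN) (finCongr hE)
  exact ⟨E, M', _, T, hT, h, _, hM', rfl⟩

theorem BTree.mem_image_iff_of_mem_ofFn {T : BTree Bool} {e : Fin T.walk.length ≃ D} :
    ∀ a ∈ (List.ofFn fun i => (T.walk.get i, e i)),
      a.2 ∈ e '' {i | (T.walk.get i).2 = true} ↔ a.1.2 = true := by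
  intro a ha
  rw [List.mem_ofFn] at ha
  obtain ⟨i, rfl⟩ := ha
  simp

/-- By uniqueness the tree of the representation is `T`; all indices of its leaf-extension are zero,
whence planarity. -/
theorem RootedMap.IsCanonicalRep.facts [Finite D] [Finite D'] {M : RootedMap D}
    {M' : RootedMap D'} {X : Set D'} (h : M.IsCanonicalRep M' X) {T : BTree Unit}
    (hT : T.IsEnrichedEulerian) (hc : T.IsClosure M) :
    M'.IsEulerian ∧ M'.IsPlanar ∧ M'.IsDrawingOf X M ∧ M'.numVerticesIn X = T.crossings := by
  classical
  have := Fintype.ofFinite D'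
  obtain ⟨T', hT', hc', e, he, rfl⟩ := h
  obtain rfl := BTree.IsClosure.unique hT hT' hc hc'
  have hN := BTree.isNode_of_isClosure hT hc
  obtain ⟨f, hf⟩ := hc
  have hN' := BTree.isNode_leafExtend hN
  have hW := hf.closureWord hT hN
  have hW' := he.closureWord hT.leafExtend hN'
  refine ⟨hW'.isEulerian hN' hT.leafExtend.2.1, ?_, ?_, ?_⟩
  · rw [hW'.isPlanar_iff hN']
    exact fun ι => BTree.eq_zero_of_mem_leaves_leafExtend
  · exact hW.isDrawingOf hN hW' (BTree.mem_image_iff_of_mem_ofFn)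
  · rw [(hW'.numVerticesIn hN' (BTree.mem_image_iff_of_mem_ofFn)).1,
      (BTree.nodeData_leafExtend T).1]

theorem RootedMap.crossingNumber_eq [Finite D] {M : RootedMap D} {T : BTree Unit}
    (hT : T.IsEnrichedEulerian) (hc : T.IsClosure M) : M.crossingNumber = T.crossings := by
  have hset : {c | ∃ (E' : ℕ) (M' : RootedMap (Fin (2 * E'))) (X : Set (Fin (2 * E'))),
      M.IsCanonicalRep M' X ∧ M'.numVerticesIn X = c} = {T.crossings} := by
    ext c
    constructor
    · rintro ⟨E', M', X, h, rfl⟩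
      exact (h.facts hT hc).2.2.2
    · rintro rfl
      obtain ⟨E', M', X, h⟩ := BTree.exists_isCanonicalRep hT (BTree.isNode_of_isClosure hT hc) hc
      exact ⟨E', M', X, h, (h.facts hT hc).2.2.2⟩
  rw [crossingNumber, hset, csInf_singleton]

theorem RootedMap.IsCanonicalRep.exists_isIso {D₁ D₂ : Type} [Finite D] {M : RootedMap D}
    {M₁ : RootedMap D₁} {M₂ : RootedMap D₂} {X₁ : Set D₁} {X₂ : Set D₂}
    (h₁ : M.IsCanonicalRep M₁ X₁) (h₂ : M.IsCanonicalRep M₂ X₂) :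
    ∃ e : D₁ ≃ D₂, RootedMap.IsIso M₁ M₂ e ∧ e '' X₁ = X₂ := by
  obtain ⟨T, hT, hc, e, he, rfl⟩ := h₁
  obtain ⟨T', hT', hc', e', he', rfl⟩ := h₂
  obtain rfl := BTree.IsClosure.unique hT hT' hc hc'
  have hN := BTree.isNode_leafExtend (BTree.isNode_of_isClosure hT hc)
  refine ⟨_, he.isIso hT.leafExtend hN he', ?_⟩
  rw [← Set.image_comp]
  congr 1
  ext i
  simp

theorem BTree.crossings_eq_zero_iff {κ : Type} {T : BTree κ} :
    T.crossings = 0 ↔ ∀ ι, some ι ∈ T.leaves → ι = 0 := by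
  rw [crossings, List.sum_eq_zero_iff]
  simp [List.mem_filterMap]

/-- Both sides say that all matching-indices of the tree vanish. -/
theorem RootedMap.crossingNumber_eq_zero_iff [Finite D] {M : RootedMap D} (hM : M.IsEulerian) :
    M.crossingNumber = 0 ↔ M.IsPlanar := by
  classical
  have := Fintype.ofFinite D
  obtain ⟨T, hT, hN, hc⟩ := hM.exists_isClosure
  rw [crossingNumber_eq hT hc, BTree.crossings_eq_zero_iff]
  obtain ⟨e, he⟩ := hc
  rw [(he.closureWord hT hN).isPlanar_iff hN]

end Canonical


/-! ### The recursive system -/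

section System

variable {R : Type*} [CommSemiring R]

/-- Power series with the same coefficients of index less than `n`. -/
def AgreeBelow (n : ℕ) (f f' : PowerSeries R) : Prop :=
  ∀ m < n, PowerSeries.coeff m f = PowerSeries.coeff m f'

theorem AgreeBelow.mul {n : ℕ} {f f' h h' : PowerSeries R} (hf : AgreeBelow n f f')
    (hh : AgreeBelow n h h') : AgreeBelow n (f * h) (f' * h') := by
  intro m hm
  rw [PowerSeries.coeff_mul, PowerSeries.coeff_mul]
  refine Finset.sum_congr rfl fun p hp => ?_
  rw [Finset.HasAntidiagonal.mem_antidiagonal] at hp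
  rw [hf _ (by omega), hh _ (by omega)]

theorem AgreeBelow.prod {ι : Type*} {n : ℕ} (s : Finset ι) {f f' : ι → PowerSeries R}
    (h : ∀ j ∈ s, AgreeBelow n (f j) (f' j)) : AgreeBelow n (∏ j ∈ s, f j) (∏ j ∈ s, f' j) := by
  classical
  induction s using Finset.induction_on with
  | empty => exact fun _ _ => rfl
  | insert a s ha ih =>
    rw [Finset.prod_insert ha, Finset.prod_insert ha]
    exact (h a (by simp)).mul (ih fun j hj => h j (by simp [hj]))

theorem coeff_system (g : ℕ → R) (a : R) (B : ℕ → PowerSeries R) (n : ℕ) :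
    PowerSeries.coeff n (PowerSeries.C a +
      ∑ k ∈ Finset.Icc 1 n, PowerSeries.X ^ k * PowerSeries.C (g k) * B k) =
    (if n = 0 then a else 0) + ∑ k ∈ Finset.Icc 1 n, g k * PowerSeries.coeff (n - k) (B k) := by
  rw [map_add, map_sum, PowerSeries.coeff_C]
  congr 1
  refine Finset.sum_congr rfl fun k hk => ?_
  rw [mul_assoc, PowerSeries.coeff_X_pow_mul', if_pos (Finset.mem_Icc.1 hk).2,
    PowerSeries.coeff_C_mul]

/-- Because of the factor `t ^ k` with `k ≥ 1`, the coefficient of index `n` involves only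
coefficients of smaller index, for all `i` simultaneously. -/
theorem IsRecursiveSystem.unique {g : ℕ → R} {q : R} {r r' : ℕ → PowerSeries R}
    (h : IsRecursiveSystem g q r) (h' : IsRecursiveSystem g q r') : r = r' := by
  have key : ∀ n i, PowerSeries.coeff n (r i) = PowerSeries.coeff n (r' i) := by
    intro n
    induction n using Nat.strong_induction_on with
    | _ n ih =>
      intro i
      rcases Nat.eq_zero_or_pos i with rfl | hi
      · rw [h.1, h'.1]
      rw [h.2 i hi n, h'.2 i hi n, coeff_system, coeff_system]
      congr 1
      refine Finset.sum_congr rfl fun k hk => ?_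
      rw [Finset.mem_Icc] at hk
      rw [map_sum, map_sum]
      congr 1
      refine Finset.sum_congr rfl fun s _ => ?_
      refine AgreeBelow.prod (n := n) _ (fun j _ => ?_) _ (by omega)
      split_ifs
      · exact fun _ _ => rfl
      · exact fun m hm => ih m hm _
  exact funext fun i => PowerSeries.ext fun n => key n i

end System

/-! ### Trees counted by size -/

namespace BTree

/-- The number of edges of the closure. -/
def size {κ : Type} : BTree κ → ℕ
  | opening => 0
  | closing _ => 0
  | node _ n child => (n + 1) / 2 + ∑ j, (child j).size

def weight {κ : Type} {R : Type*} [CommSemiring R] (g : ℕ → R) (q : R) : BTree κ → R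
  | opening => 1
  | closing ι => q ^ ι
  | node _ n child => g ((n + 1) / 2) * ∏ j, (child j).weight g q

theorem weight_eq {κ : Type} {R : Type*} [CommSemiring R] (g : ℕ → R) (q : R) (t : BTree κ) :
    t.weight g q = (t.nodeData.map fun a => g (a.2 / 2)).prod * q ^ t.crossings := by
  induction t with
  | opening => simp [weight, nodeData, crossings, leaves]
  | closing ι => simp [weight, nodeData, crossings, leaves]
  | node l n child ih =>
    have h : ∀ ts : List (BTree κ), (∀ t ∈ ts, t.weight g q =
        (t.nodeData.map fun a => g (a.2 / 2)).prod * q ^ t.crossings) →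
        (ts.map (weight g q)).prod = ((ts.map nodeData).flatten.map fun a => g (a.2 / 2)).prod *
          q ^ (ts.map crossings).sum := by
      intro ts hts
      induction ts with
      | nil => simp
      | cons t ts ih =>
        rw [List.map_cons, List.prod_cons, hts t (by simp), ih fun t' ht' => hts t' (by simp [ht'])]
        simp only [List.map_cons, List.flatten_cons, List.map_append, List.prod_append,
          List.sum_cons, pow_add]
        ring
    have h2 := h (List.ofFn child) (by simpa using ih)
    rw [weight, nodeData_node, crossings_node, List.map_cons, List.prod_cons, mul_assoc, ← h2,
      List.map_ofFn, List.prod_ofFn]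
    rfl

theorem NodesEulerian.two_mul_size {κ : Type} {t : BTree κ} (ht : t.NodesEulerian) :
    2 * t.size = (t.nodeData.map Prod.snd).sum := by
  induction t with
  | opening => rfl
  | closing ι => rfl
  | node l n child ih =>
    obtain ⟨⟨k, hk, -⟩, hch⟩ := ht
    have h : ∀ ts : List (BTree κ), (∀ t ∈ ts, 2 * t.size = (t.nodeData.map Prod.snd).sum) →
        2 * (ts.map size).sum = ((ts.map nodeData).flatten.map Prod.snd).sum := by
      intro ts hts
      induction ts with
      | nil => rfl
      | cons t ts ih =>
        simp only [List.map_cons, List.flatten_cons, List.map_append, List.sum_append,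
          List.sum_cons, mul_add, hts t (by simp), ih fun t' ht' => hts t' (by simp [ht'])]
    have h2 := h (List.ofFn child) (by simpa using fun j => ih j (hch j))
    rw [size, nodeData_node, List.map_cons, List.sum_cons, ← h2, List.map_ofFn, List.sum_ofFn,
      mul_add]
    simp only [Function.comp]
    omega

theorem pathHeight_zero (i : ℕ) {n : ℕ} (s : Fin n → Bool) : pathHeight i s 0 = i := by
  simp [pathHeight]

theorem pathHeight_succ (i i' : ℕ) {n : ℕ} (s : Fin (n + 1) → Bool) (j : ℕ)
    (h : (i' : ℤ) = i + if s 0 then 1 else -1) :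
    pathHeight i s (j + 1) = pathHeight i' (fun l => s l.succ) j := by
  simp [pathHeight, Fin.sum_univ_succ, h, add_assoc]

/-- An opening child raises the height by one and any other child lowers it by one in total, so the
heights between successive children are those of a path. -/
theorem validIndices_flatten_iff {n : ℕ} (c : Fin n → BTree Unit) (hc : ∀ j, (c j).NodesEulerian)
    (i : ℕ) : ValidIndices i (List.ofFn fun j => (c j).leaves).flatten ↔
      (∀ j ≤ n, 0 ≤ pathHeight i (fun l => (c l).isOpening) j) ∧
        ∀ j : Fin n, (c j).isOpening = false →
          ValidIndices (pathHeight i (fun l => (c l).isOpening) j).toNat (c j).leaves := by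
  induction n generalizing i with
  | zero =>
    simp only [List.ofFn_zero, List.flatten_nil, IsEmpty.forall_iff, and_true]
    refine ⟨fun _ j hj => ?_, fun _ => trivial⟩
    rw [Nat.le_zero.1 hj, pathHeight_zero]
    positivity
  | succ n ih =>
    have hcount := (hc 0).countP_leaves
    rw [List.ofFn_succ, List.flatten_cons, validIndices_append, Fin.forall_fin_succ]
    have hstep : ∀ i' : ℕ, (i' : ℤ) = i + (if (c 0).isOpening then 1 else -1) →
        (((∀ j ≤ n + 1, 0 ≤ pathHeight i (fun l => (c l).isOpening) j) ∧
          ∀ j : Fin n, (c j.succ).isOpening = false →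
          ValidIndices (pathHeight i (fun l => (c l).isOpening) j.succ.val).toNat
            (c j.succ).leaves) ↔
        ValidIndices i' (List.ofFn fun j => (c (Fin.succ j)).leaves).flatten) := by
      intro i' hi'
      rw [ih (fun j => c j.succ) (fun j => hc _) i']
      refine and_congr ⟨fun h j hj => ?_, fun h j hj => ?_⟩ (forall_congr' fun j => ?_)
      · rw [← pathHeight_succ i i' (fun l => (c l).isOpening) j hi']
        exact h _ (by omega)
      · cases j with
        | zero => rw [pathHeight_zero]; positivity
        | succ j =>
          rw [pathHeight_succ i i' (fun l => (c l).isOpening) j hi']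
          exact h _ (by omega)
      · rw [Fin.val_succ, pathHeight_succ i i' (fun l => (c l).isOpening) j hi']
    rw [Fin.val_zero, pathHeight_zero, Int.toNat_natCast]
    cases h0 : (c 0).isOpening with
    | true =>
      have hleaf : (c 0).leaves = [none] := by
        cases hc0 : c 0 with
        | opening => rfl
        | closing ι => rw [hc0] at h0; simp [isOpening] at h0
        | node l n child => rw [hc0] at h0; simp [isOpening] at h0
      have := hstep (i + 1) (by simp [h0])
      rw [hleaf]
      simpa [ValidIndices] using this.symm
    | false =>
      simp only [h0] at hcount
      constructor
      · rintro ⟨h1, h2⟩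
        -- A valid subtree with one closing in excess needs `1 ≤ i`, so that `i - 1` is not
        -- truncated.
        have h3 := h1.countP_le
        have h4 := (hstep (i - 1) (by simp [h0]; simp at hcount; omega)).2 (by
          convert h2 using 1
          simp at hcount
          omega)
        exact ⟨h4.1, fun _ => h1, h4.2⟩
      · rintro ⟨h1, h2, h3⟩
        have h4 := (h2 rfl).countP_le
        refine ⟨h2 rfl, ?_⟩
        have h5 := (hstep (i - 1) (by simp [h0]; simp at hcount; omega)).1 ⟨h1, h3⟩
        convert h5 using 1
        simp at hcount
        omega

theorem pathHeight_end (i : ℕ) {n : ℕ} (s : Fin n → Bool) :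
    pathHeight i s n = i + 2 * (Finset.univ.filter fun j => s j = true).card - n := by
  have h : ∀ l : Fin n, (if l.val < n then (if s l then (1 : ℤ) else -1) else 0) =
      2 * (if s l = true then 1 else 0) - 1 := by
    intro l
    rw [if_pos l.2]
    split_ifs <;> simp
  rw [pathHeight, Finset.sum_congr rfl fun l _ => h l, Finset.sum_sub_distrib, ← Finset.mul_sum,
    Finset.sum_boole]
  simp
  ring

end BTree


/-! ### Generating series of the trees -/

namespace BTree

/-- The trees counted by the coefficients of the series. -/
def Counted (i n : ℕ) : Set (BTree Unit) :=
  {t | t.isOpening = false ∧ t.NodesEulerian ∧ ValidIndices i t.leaves ∧ t.size = n}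

theorem eq_opening_iff {κ : Type} {t : BTree κ} : t = opening ↔ t.isOpening = true := by
  cases t <;> simp [isOpening]

theorem closing_mem_counted {ι i n : ℕ} : closing ι ∈ Counted i n ↔ ι < i ∧ n = 0 :=
  ⟨fun h => ⟨h.2.2.1.1, h.2.2.2.symm⟩, fun ⟨h, h'⟩ => ⟨rfl, trivial, ⟨h, trivial⟩, h'.symm⟩⟩

/-- Having `k - 1` openings among the `2k - 1` children is equivalent to the path ending at height
`i - 1`. -/
theorem node_mem_counted {k i n : ℕ} (hk : 1 ≤ k) (c : Fin (2 * k - 1) → BTree Unit) :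
    node () (2 * k - 1) c ∈ Counted i n ↔
      (fun j => (c j).isOpening) ∈ dyckPaths k i ∧ k + ∑ j, (c j).size = n ∧
        ∀ j, (c j).isOpening = false →
          c j ∈ Counted (pathHeight i (fun l => (c l).isOpening) j).toNat (c j).size := by
  have hk' : 2 * k - 1 + 1 = 2 * k := by omega
  have hend := pathHeight_end i (fun j => (c j).isOpening)
  have hsize : (node () (2 * k - 1) c).size = k + ∑ j, (c j).size := by
    rw [size, hk', Nat.mul_div_cancel_left _ (by norm_num)]
  have hall : ∀ j, (c j).isOpening = true → (c j).NodesEulerian := fun j hj => by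
    rw [eq_opening_iff.2 hj]; trivial
  constructor
  · rintro ⟨-, ⟨⟨k', hk1, hcard⟩, hE⟩, hv, rfl⟩
    rw [leaves, validIndices_flatten_iff c hE] at hv
    obtain rfl : k' = k := by omega
    refine ⟨Finset.mem_filter.2 ⟨Finset.mem_univ _, fun j => hv.1 j (by omega), ?_⟩, hsize.symm,
      fun j hj => ⟨hj, hE j, hv.2 j hj, rfl⟩⟩
    rw [hend]
    omega
  · rintro ⟨hs, rfl, hch⟩
    obtain ⟨-, hs1, hs2⟩ := Finset.mem_filter.1 hs
    have hE : ∀ j, (c j).NodesEulerian := fun j => by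
      cases hj : (c j).isOpening with
      | true => exact hall j hj
      | false => exact (hch j hj).2.1
    rw [hend] at hs2
    refine ⟨rfl, ⟨⟨k, hk', ?_⟩, hE⟩, ?_, hsize⟩
    · omega
    · rw [leaves, validIndices_flatten_iff c hE]
      exact ⟨fun j hj => hs1 ⟨j, by omega⟩, fun j hj => (hch j hj).2.2.1⟩

theorem exists_eq_of_node_mem_counted {i n N : ℕ} {l : Unit} {c : Fin N → BTree Unit}
    (h : node l N c ∈ Counted i n) : ∃ k, 1 ≤ k ∧ k ≤ n ∧ N = 2 * k - 1 := by
  obtain ⟨-, ⟨⟨k, hk, -⟩, -⟩, -, rfl⟩ := h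
  exact ⟨k, by omega, by rw [size]; omega, by omega⟩

/-- A node takes `k ≥ 1` of the size, so its subtrees are smaller; the starting height of each is
determined by the path of the node. -/
theorem finite_counted (i n : ℕ) : (Counted i n).Finite := by
  induction n using Nat.strong_induction_on generalizing i with
  | _ n ih =>
    refine Set.Finite.subset (s := closing '' Set.Iio i ∪ ⋃ k ∈ Set.Icc 1 n,
      ⋃ s : Fin (2 * k - 1) → Bool, node () (2 * k - 1) '' Set.pi Set.univ fun j =>
        {opening} ∪ ⋃ m ∈ Set.Iio n, Counted (pathHeight i s j).toNat m) ?_ ?_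
    · refine ((Set.finite_Iio i).image _).union ((Set.finite_Icc 1 n).biUnion fun k _ =>
        Set.finite_iUnion fun s => (Set.Finite.pi fun j => (Set.finite_singleton _).union
          ((Set.finite_Iio n).biUnion fun m hm => ih m hm _)).image _)
    · intro t ht
      cases t with
      | opening => simp [Counted, isOpening] at ht
      | closing ι => exact Or.inl ⟨ι, (closing_mem_counted.1 ht).1, rfl⟩
      | node l N c =>
        obtain ⟨k, hk1, hkn, rfl⟩ := exists_eq_of_node_mem_counted ht
        obtain ⟨-, h2, h3⟩ := (node_mem_counted hk1 c).1 ht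
        refine Or.inr ?_
        simp only [Set.mem_iUnion]
        refine ⟨k, ⟨hk1, hkn⟩, fun j => (c j).isOpening, c, fun j _ => ?_, rfl⟩
        cases hj : (c j).isOpening with
        | true => exact Or.inl (eq_opening_iff.2 hj)
        | false =>
          refine Or.inr ?_
          simp only [Set.mem_iUnion]
          refine ⟨(c j).size, ?_, h3 j hj⟩
          have := Finset.single_le_sum (f := fun j => (c j).size) (fun _ _ => Nat.zero_le _)
            (Finset.mem_univ j)
          simp only [Set.mem_Iio] at this ⊢
          omega

noncomputable def trees (i n : ℕ) : Finset (BTree Unit) := (finite_counted i n).toFinset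

theorem mem_trees {i n : ℕ} {t : BTree Unit} : t ∈ trees i n ↔ t ∈ Counted i n :=
  Set.Finite.mem_toFinset _

/-- The possible subtrees of a given size, `b` telling whether they are opening leaves. -/
noncomputable def subtrees (b : Bool) (h m : ℕ) : Finset (BTree Unit) :=
  if b then (if m = 0 then {opening} else ∅) else trees h m

theorem mem_subtrees {b : Bool} {h m : ℕ} {t : BTree Unit} : t ∈ subtrees b h m ↔
    t.isOpening = b ∧ t.size = m ∧ (t.isOpening = false → t ∈ Counted h t.size) := by
  cases b with
  | true =>
    simp only [subtrees, if_true]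
    constructor
    · intro ht
      split_ifs at ht with hm
      · rw [Finset.mem_singleton.1 ht]
        simp [isOpening, size, hm]
      · simp at ht
    · rintro ⟨h1, h2, -⟩
      rw [← eq_opening_iff] at h1
      subst h1
      rw [← h2]
      simp [size]
  | false =>
    simp only [subtrees, Bool.false_eq_true, if_false, mem_trees]
    constructor
    · intro ht
      exact ⟨ht.1, ht.2.2.2, fun _ => ht.2.2.2.symm ▸ ht⟩
    · rintro ⟨h1, rfl, h2⟩
      exact h2 h1

theorem sum_biUnion_of_eq {A B R : Type*} [DecidableEq A] [DecidableEq B] [AddCommMonoid R]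
    (s : Finset B) (f : B → Finset A) (φ : A → B) (h : ∀ x ∈ s, ∀ t ∈ f x, φ t = x) (w : A → R) :
    ∑ t ∈ s.biUnion f, w t = ∑ x ∈ s, ∑ t ∈ f x, w t := by
  refine Finset.sum_biUnion fun x hx y hy hxy => Finset.disjoint_left.2 fun t htx hty => hxy ?_
  rw [← h x hx t htx, ← h y hy t hty]

open scoped Classical in
/-- The families of subtrees of a node. -/
noncomputable def families (i k m : ℕ) : Finset (Fin (2 * k - 1) → BTree Unit) :=
  (dyckPaths k i).biUnion fun s => (Finset.univ.finsuppAntidiag m).biUnion fun μ =>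
    Fintype.piFinset fun j => subtrees (s j) (pathHeight i s j).toNat (μ j)

theorem mem_families {i k m : ℕ} {c : Fin (2 * k - 1) → BTree Unit} : c ∈ families i k m ↔
    (fun j => (c j).isOpening) ∈ dyckPaths k i ∧ ∑ j, (c j).size = m ∧
        ∀ j, (c j).isOpening = false →
          c j ∈ Counted (pathHeight i (fun l => (c l).isOpening) j).toNat (c j).size := by
  classical
  simp only [families, Finset.mem_biUnion, Fintype.mem_piFinset, mem_subtrees,
    Finset.mem_finsuppAntidiag]
  constructor
  · rintro ⟨s, hs, μ, hμ, hc⟩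
    obtain rfl : (fun j => (c j).isOpening) = s := funext fun j => (hc j).1
    refine ⟨hs, ?_, fun j => (hc j).2.2⟩
    rw [← hμ.1]
    exact Finset.sum_congr rfl fun j _ => (hc j).2.1
  · rintro ⟨h1, h2, h3⟩
    exact ⟨_, h1, Finsupp.equivFunOnFinite.symm fun j => (c j).size, ⟨by simpa using h2, by simp⟩,
      fun j => ⟨rfl, rfl, h3 j⟩⟩

section Series

variable {R : Type*} [CommSemiring R] (g : ℕ → R) (q : R)

noncomputable def series (i : ℕ) : PowerSeries R :=
  PowerSeries.mk fun n => ∑ t ∈ trees i n, t.weight g q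

theorem coeff_ite_series (b : Bool) (h m : ℕ) :
    PowerSeries.coeff m (if b then 1 else series g q h) = ∑ t ∈ subtrees b h m, t.weight g q := by
  cases b with
  | true =>
    simp only [subtrees, if_true, PowerSeries.coeff_one]
    split_ifs <;> simp [weight]
  | false => simp [subtrees, series]

/-- A coefficient of a product of series is a sum over the ways `μ` of sharing the degree among the
factors, here the sizes of the subtrees. -/
theorem sum_families (i k m : ℕ) :
    ∑ c ∈ families i k m, ∏ j, (c j).weight g q =
      PowerSeries.coeff m (∑ s ∈ dyckPaths k i, pathWeight (series g q) i s) := by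
  classical
  have hsub : ∀ (s : Fin (2 * k - 1) → Bool) (μ : Fin (2 * k - 1) →₀ ℕ),
      ∀ c ∈ Fintype.piFinset fun j => subtrees (s j) (pathHeight i s j).toNat (μ j),
      (∀ j, (c j).isOpening = s j) ∧ ∀ j, (c j).size = μ j := by
    intro s μ c hc
    rw [Fintype.mem_piFinset] at hc
    exact ⟨fun j => (mem_subtrees.1 (hc j)).1, fun j => (mem_subtrees.1 (hc j)).2.1⟩
  rw [families, sum_biUnion_of_eq _ _ (fun c j => (c j).isOpening), map_sum]
  · refine Finset.sum_congr rfl fun s _ => ?_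
    rw [sum_biUnion_of_eq _ _ (fun c => Finsupp.equivFunOnFinite.symm fun j => (c j).size),
      pathWeight, PowerSeries.coeff_prod]
    · refine Finset.sum_congr rfl fun μ _ => ?_
      simp only [coeff_ite_series]
      rw [Finset.prod_univ_sum]
    · intro μ _ c hc
      ext j
      exact (hsub s μ c hc).2 j
  · intro s _ c hc
    rw [Finset.mem_biUnion] at hc
    obtain ⟨μ, _, hc⟩ := hc
    exact funext (hsub s μ c hc).1

theorem trees_eq (i n : ℕ) [DecidableEq (BTree Unit)] : trees i n =
    (if n = 0 then (Finset.range i).image closing else ∅) ∪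
      (Finset.Icc 1 n).biUnion fun k => (families i k (n - k)).image (node () (2 * k - 1)) := by
  ext t
  rw [mem_trees, Finset.mem_union, Finset.mem_biUnion]
  cases t with
  | opening =>
    simp only [Counted, isOpening]
    split_ifs <;> simp
  | closing ι =>
    rw [closing_mem_counted]
    split_ifs with hn <;> simp [hn]
  | node l N c =>
    constructor
    · intro h
      obtain ⟨k, hk1, hkn, rfl⟩ := exists_eq_of_node_mem_counted h
      obtain ⟨h1, h2, h3⟩ := (node_mem_counted hk1 c).1 h
      exact Or.inr ⟨k, Finset.mem_Icc.2 ⟨hk1, hkn⟩, Finset.mem_image.2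
        ⟨c, mem_families.2 ⟨h1, by omega, h3⟩, rfl⟩⟩
    · rintro (h | ⟨k, hk, h⟩)
      · split_ifs at h <;> simp at h
      · rw [Finset.mem_Icc] at hk
        obtain ⟨c', hc', h⟩ := Finset.mem_image.1 h
        rw [← h, node_mem_counted hk.1]
        obtain ⟨h1, h2, h3⟩ := mem_families.1 hc'
        exact ⟨h1, by omega, h3⟩

theorem sum_trees (i n : ℕ) : ∑ t ∈ trees i n, t.weight g q =
    (if n = 0 then ∑ l ∈ Finset.range i, q ^ l else 0) +
      ∑ k ∈ Finset.Icc 1 n, g k *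
        PowerSeries.coeff (n - k) (∑ s ∈ dyckPaths k i, pathWeight (series g q) i s) := by
  classical
  rw [trees_eq, Finset.sum_union]
  · congr 1
    · split_ifs
      · rw [Finset.sum_image fun a _ b _ h => by simpa using h]
        rfl
      · simp
    -- The union over `k` is disjoint since the degree of the root node determines `k`; the values
    -- at leaves are irrelevant.
    · rw [sum_biUnion_of_eq (φ := fun t : BTree Unit => match t with
        | opening => 0
        | closing _ => 0
        | node _ N _ => (N + 1) / 2)]
      · refine Finset.sum_congr rfl fun k hk => ?_
        rw [Finset.mem_Icc] at hk
        rw [Finset.sum_image fun a _ b _ h => by simpa using h, ← sum_families, Finset.mul_sum]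
        refine Finset.sum_congr rfl fun c _ => ?_
        rw [weight, show (2 * k - 1 + 1) / 2 = k by omega]
      · intro k hk t ht
        rw [Finset.mem_Icc] at hk
        obtain ⟨c, -, rfl⟩ := Finset.mem_image.1 ht
        simp only
        omega
  · rw [Finset.disjoint_left]
    intro t ht ht'
    rw [Finset.mem_biUnion] at ht'
    obtain ⟨k, -, hk⟩ := ht'
    obtain ⟨c, -, rfl⟩ := Finset.mem_image.1 hk
    split_ifs at ht <;> simp at ht

theorem isRecursiveSystem_series : IsRecursiveSystem g q (series g q) := by
  constructor
  · ext n
    rw [series, PowerSeries.coeff_mk, map_zero]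
    -- There is no tree for `i = 0`: a tree with one closing in excess cannot be valid from height
    -- 0.
    refine Finset.sum_eq_zero fun t ht => ?_
    obtain ⟨h1, h2, h3, -⟩ := mem_trees.1 ht
    have h4 := h3.countP_le
    have h5 := h2.countP_leaves
    simp only [h1, Bool.false_eq_true, if_false] at h5
    omega
  · intro i _ n
    rw [coeff_system, ← sum_trees, series, PowerSeries.coeff_mk]

end Series

end BTree


/-! ### Counting maps -/

section Counting

/-- The tree of a rooted Eulerian map with `E` edges. -/
theorem RootedMap.IsEulerian.exists_mem_trees {E : ℕ} {M : RootedMap (Fin (2 * E))}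
    (hM : M.IsEulerian) : ∃ T ∈ BTree.trees 1 E, T.IsNode ∧ T.IsClosure M := by
  obtain ⟨T, hT, hN, hc⟩ := hM.exists_isClosure
  refine ⟨T, BTree.mem_trees.2 ⟨hT.1, hT.2.1, hT.2.2, ?_⟩, hN, hc⟩
  obtain ⟨e, he⟩ := hc
  have h1 := (he.closureWord hT hN).length_eq hN
  rw [← hT.2.1.two_mul_size, Nat.card_fin] at h1
  omega

theorem BTree.exists_isClosure_of_mem_trees {E : ℕ} {T : BTree Unit} (hT : T ∈ trees 1 E)
    (hN : T.IsNode) :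
    ∃ M : RootedMap (Fin (2 * E)), M.IsEulerian ∧ T.IsClosure M := by
  obtain ⟨h1, h2, h3, h4⟩ := mem_trees.1 hT
  have hE : T.IsEnrichedEulerian := ⟨h1, h2, h3⟩
  obtain ⟨M₀, hM₀⟩ := exists_isClosureVia hE hN (Equiv.refl _)
  have h5 := (hM₀.closureWord hE hN).length_eq hN
  rw [← h2.two_mul_size, Nat.card_fin, h4] at h5
  obtain ⟨M, hM⟩ := exists_isClosureVia hE hN (finCongr h5)
  exact ⟨M, (hM.closureWord hE hN).isEulerian hN h2, _, hM⟩

/-- Trees with a node correspond to classes of maps through the closure. The only nodeless tree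
valid from height 1 is a closing leaf of index 0, which gives the conventional term. -/
theorem BTree.sum_trees_eq_sum_eulerianMap {R : Type*} [CommSemiring R] (g : ℕ → R) (q : R)
    (E : ℕ) : ∑ t ∈ trees 1 E, t.weight g q = (if E = 0 then 1 else 0) +
      ∑ M : EulerianMap E, M.vertexWeight g * q ^ M.crossingNumber := by
  classical
  have hE : ∀ {T}, T ∈ trees 1 E → T.IsEnrichedEulerian := fun hT =>
    let ⟨h1, h2, h3, _⟩ := mem_trees.1 hT
    ⟨h1, h2, h3⟩
  rw [← Finset.sum_filter_add_sum_filter_not _ (fun t => ¬ t.IsNode)]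
  congr 1
  · have : (trees 1 E).filter (fun t => ¬ t.IsNode) = if E = 0 then {closing 0} else ∅ := by
      ext t
      rw [Finset.mem_filter, mem_trees]
      cases t with
      | opening => split_ifs <;> simp [Counted, isOpening]
      | closing ι =>
        rw [closing_mem_counted]
        split_ifs with h <;> simp [h, IsNode]
      | node l n c => split_ifs <;> simp [IsNode]
    rw [this]
    split_ifs <;> simp [weight]
  · simp only [not_not]
    choose T hT hN hc using
      fun M : {M : RootedMap (Fin (2 * E)) // M.IsEulerian} => M.2.exists_mem_trees
    refine (Finset.sum_bij (fun M _ => T M.out) (fun M _ => Finset.mem_filter.2 ⟨hT _, hN _⟩)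
      (fun M₁ _ M₂ _ h => ?_) (fun t ht => ?_) (fun M _ => ?_)).symm
    · obtain ⟨e₁, h₁⟩ := hc M₁.out
      obtain ⟨e₂, h₂⟩ : (T M₁.out).IsClosure M₂.out.1 := by
        have := hc M₂.out
        rwa [← h] at this
      rw [← M₁.out_eq, ← M₂.out_eq]
      exact Quotient.sound ⟨_, h₁.isIso (hE (hT _)) (hN _) h₂⟩
    · obtain ⟨ht, htN⟩ := Finset.mem_filter.1 ht
      obtain ⟨M, hM, hcM⟩ := exists_isClosure_of_mem_trees ht htN
      refine ⟨Quotient.mk _ ⟨M, hM⟩, Finset.mem_univ _, ?_⟩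
      obtain ⟨f, hf⟩ : (eulerianMapSetoid E).r (Quotient.mk (eulerianMapSetoid E) ⟨M, hM⟩).out
          ⟨M, hM⟩ := Quotient.mk_out _
      exact ((hc _).of_iso hf).unique (hE (hT _)) (hE ht) hcM
    · have h1 : EulerianMap.vertexWeight g M = M.out.1.vertexWeight g := by
        conv_lhs => rw [← M.out_eq]
        rfl
      have h2 : EulerianMap.crossingNumber M = M.out.1.crossingNumber := by
        conv_lhs => rw [← M.out_eq]
        rfl
      have hTE := hE (hT M.out)
      rw [h1, h2, RootedMap.crossingNumber_eq hTE (hc M.out), weight_eq]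
      obtain ⟨e, he⟩ := hc M.out
      rw [(he.closureWord hTE (hN _)).vertexWeight g (hN _)]

theorem IsRecursiveSystem.eq_countingSeries {R : Type*} [CommSemiring R] {g : ℕ → R} {q : R}
    {r : ℕ → PowerSeries R} (h : IsRecursiveSystem g q r) :
    r 1 = countingSeries fun _ M => M.vertexWeight g * q ^ M.crossingNumber := by
  rw [h.unique (BTree.isRecursiveSystem_series g q)]
  ext n
  rw [BTree.series, PowerSeries.coeff_mk, BTree.sum_trees_eq_sum_eulerianMap, countingSeries,
    map_add, PowerSeries.coeff_one, PowerSeries.coeff_mk]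

theorem EulerianMap.crossingNumber_eq_zero_iff {E : ℕ} (M : EulerianMap E) :
    M.crossingNumber = 0 ↔ M.IsPlanar := by
  induction M using Quotient.inductionOn with
  | h M => exact RootedMap.crossingNumber_eq_zero_iff M.2

end Counting

open scoped Classical in
theorem mainTheorem10 :
    -- every enriched Eulerian tree with at least one node closes into a rooted Eulerian map
    (∀ T : BTree Unit, T.IsEnrichedEulerian → T.IsNode →
      ∃ (E : ℕ) (M : RootedMap (Fin (2 * E))), M.IsEulerian ∧ T.IsClosure M) ∧
    -- every rooted Eulerian map is the closure of exactly one enriched Eulerian tree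
    (∀ (D : Type) [Finite D] (M : RootedMap D), M.IsEulerian →
      ∃! T : BTree Unit, T.IsEnrichedEulerian ∧ T.IsClosure M) ∧
    -- leaf-extension gives a balanced Eulerian tree
    (∀ T : BTree Unit, T.IsEnrichedEulerian → T.leafExtend.IsEnrichedEulerian) ∧
    -- every rooted Eulerian map has a canonical planar representation
    (∀ (D : Type) [Finite D] (M : RootedMap D), M.IsEulerian →
      ∃ (E' : ℕ) (M' : RootedMap (Fin (2 * E'))) (X : Set (Fin (2 * E'))),
        M.IsCanonicalRep M' X) ∧
    -- which is unique up to isomorphism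
    (∀ (D D₁ D₂ : Type) [Finite D] [Finite D₁] [Finite D₂] (M : RootedMap D) (M₁ : RootedMap D₁)
      (M₂ : RootedMap D₂) (X₁ : Set D₁) (X₂ : Set D₂), M.IsEulerian →
      M.IsCanonicalRep M₁ X₁ → M.IsCanonicalRep M₂ X₂ →
        ∃ e : D₁ ≃ D₂, RootedMap.IsIso M₁ M₂ e ∧ e '' X₁ = X₂) ∧
    -- it is a planar Eulerian map, which yields the given map when its crossing-vertices are seen
    -- as crossings of two edges
    (∀ (D D' : Type) [Finite D] [Finite D'] (M : RootedMap D) (M' : RootedMap D') (X : Set D'),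
      M.IsEulerian → M.IsCanonicalRep M' X →
        M'.IsEulerian ∧ M'.IsPlanar ∧ M'.IsDrawingOf X M ∧
          M'.numVerticesIn X = M.crossingNumber) ∧
    -- it has no crossing-vertices if and only if the map is planar
    (∀ (D : Type) [Finite D] (M : RootedMap D), M.IsEulerian →
      (M.crossingNumber = 0 ↔ M.IsPlanar)) ∧
    -- the series `r_i(t, q)` are well defined, and `r_1(t, q)` counts rooted Eulerian
    -- maps with weight `q` per crossing-vertex; with the cases `q = 0` and `q = 1`
    (∀ (R : Type*) [CommSemiring R] (g : ℕ → R),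
      (∀ q : R, ∃! r : ℕ → PowerSeries R, IsRecursiveSystem g q r) ∧
      (∀ (q : R) (r : ℕ → PowerSeries R), IsRecursiveSystem g q r →
        r 1 = countingSeries fun _ M => M.vertexWeight g * q ^ M.crossingNumber) ∧
      (∀ r : ℕ → PowerSeries R, IsRecursiveSystem g 0 r →
        r 1 = countingSeries fun _ M => if M.IsPlanar then M.vertexWeight g else 0) ∧
      (∀ r : ℕ → PowerSeries R, IsRecursiveSystem g 1 r →
        r 1 = countingSeries fun _ M => M.vertexWeight g)) := by
  refine ⟨fun T hT hN => BTree.exists_isClosure hT hN, fun D _ M hM => ?_,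
    fun T hT => hT.leafExtend, fun D _ M hM => ?_,
    fun D D₁ D₂ _ _ _ M M₁ M₂ X₁ X₂ _ h₁ h₂ => h₁.exists_isIso h₂,
    fun D D' _ _ M M' X hM h => ?_, fun D _ M hM => RootedMap.crossingNumber_eq_zero_iff hM,
    fun R _ g => ⟨fun q => ?_, fun q r h => h.eq_countingSeries, fun r h => ?_, fun r h => ?_⟩⟩
  · obtain ⟨T, hT, -, hc⟩ := hM.exists_isClosure
    exact ⟨T, ⟨hT, hc⟩, fun T' h => h.2.unique h.1 hT hc⟩
  · obtain ⟨T, hT, hN, hc⟩ := hM.exists_isClosure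
    exact BTree.exists_isCanonicalRep hT hN hc
  · obtain ⟨T, hT, -, hc⟩ := hM.exists_isClosure
    rw [RootedMap.crossingNumber_eq hT hc]
    exact h.facts hT hc
  · exact ⟨_, BTree.isRecursiveSystem_series g q, fun r h =>
      h.unique (BTree.isRecursiveSystem_series g q)⟩
  · rw [h.eq_countingSeries]
    congr 1
    funext E M
    -- At `q = 0` only the maps with crossing number zero survive, which are the planar ones.
    rw [← M.crossingNumber_eq_zero_iff]
    split_ifs with h0
    · rw [h0, pow_zero, mul_one]
    · rw [zero_pow h0, mul_zero]
  · rw [h.eq_countingSeries]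
    simp
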